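/- Let $\tau=\frac{-1+i\sqrt3}{2}$, let $\mathcal O_3=\mathbb Z[\tau]$ be the ring of integers of $\mathbb Q(i\sqrt3)$, and let ${\rm Bi}(3)={\rm PSL}(2,\mathcal O_3)$. Denote by $T,U,A,L\in{\rm Bi}(3)$ the classes of $$\begin{pmatrix}1&1\\0&1\end{pmatrix},\quad \begin{pmatrix}1&\tau\\0&1\end{pmatrix},\quad \begin{pmatrix}0&-1\\1&0\end{pmatrix},\quad \begin{pmatrix}\tau^{-1}&0\\0&\tau\end{pmatrix}.$$ Swan's relations for ${\rm Bi}(3)$ are $$[T,U]=L^3=(AL)^2=A^2=(TA)^3=(UAL)^3=1,\quad L^{-1}UL=T,\quad L^{-1}TL=T^{-1}U^{-1}.$$ For $u\in\mathbb C\setminus\{0,-1\}$ put $$\rho_u(T)=\begin{pmatrix}1&0&0&0\\ -\frac{2-u+u^2}{u^2}&\frac1u+u&-1&\frac1u+u\\0&1&0&0\\0&0&0&1\end{pmatrix},\qquad \rho_u(U)=\begin{pmatrix}1+u&0&0&-u\\ -\frac{2}{u+u^2}&\frac1{1+u}&\frac1{1+u}&-\frac u{1+u}\\ -\frac{2+u+u^2}{u^2+u^3}&-\frac1{1+u}&\frac{1+u+u^2}{u+u^2}&\frac1{u+u^2}\\1&0&0&0\end{pmatrix},$$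 $$\rho_u(A)=\begin{pmatrix}1&0&0&0\\0&0&0&1\\ -\frac{2-u+u^2}{u^2}&\frac1u+u&-1&\frac1u+u\\0&1&0&0\end{pmatrix},\qquad \rho_u(L)=\begin{pmatrix}\frac{-1+u}{1+u}&-\frac{u^2}{1+u}&\frac u{1+u}&-\frac{u^2}{1+u}\\ -\frac2{u+u^2}&\frac1{1+u}&\frac1{1+u}&-\frac u{1+u}\\ -\frac{2+u+u^2}{u^2}&\frac1u&0&\frac1u\\ -\frac2{u+u^2}&-\frac u{1+u}&\frac1{1+u}&\frac1{1+u}\end{pmatrix}.$$ Let $\rho_{\rm hyp}:{\rm Bi}(3)\to{\rm SO}(3,1)\subset{\rm SL}(4,\mathbb C)$ be the lattice embedding given by ${\rm PSL}(2,\mathbb C)\simeq{\rm SO}^0(3,1)$, that is, by the action $X\mapsto gXg^*$ on Hermitian $2\times2$ matrices with the quadratic form $\det$, written in the basis $\begin{pmatrix}1&0\\0&1\end{pmatrix},\begin{pmatrix}1&0\\0&-1\end{pmatrix},\begin{pmatrix}0&1\\1&0\end{pmatrix},\begin{pmatrix}0&i\\-i&0\end{pmatrix}$. Then the following hold. 1.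 For every $u\in\mathbb C\setminus\{0,-1\}$ the four matrices above lie in ${\rm SL}(4,\mathbb C)$ and satisfy Swan's relations, and there is a unique homomorphism $\rho_u:{\rm Bi}(3)\to{\rm SL}(4,\mathbb C)$ with these values on $T,U,A,L$. 2. $\rho_1$ is conjugate in ${\rm GL}(4,\mathbb C)$ to $\rho_{\rm hyp}$. If $u,u'\in\mathbb C\setminus\{0,-1\}$ and $u'\notin\{u,1/u\}$, then $\rho_u$ and $\rho_{u'}$ are not conjugate in ${\rm GL}(4,\mathbb C)$. 3. For every $u$ with $|u|=1$, $u\ne-1$, the representation $\rho_u$ preserves a nonzero Hermitian form $H_u$ on $\mathbb C^4$, which has signature $(3,1)$ if ${\rm Re}\,u>1/4$ and signature $(4,0)$ if ${\rm Re}\,u<1/4$. 4. For every $u$ with $|u|=1$, $u\neq\pm1$, the matrices $\rho_u(T)$ and $\rho_u(U)$ are elliptic, i.e. diagonalizable over $\mathbb C$ with all eigenvalues of modulus $1$; moreover, for every Hermitian form $H$ of signature $(3,1)$ preserved by $\rho_u$ they are elliptic isometries of complex hyperbolic space, i.e. each of them fixes a line spanned by a vector $v$ with $H(v,v)<0$.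 In particular, $\rho_u$ is not both faithful and of discrete image in ${\rm SL}(4,\mathbb C)$. 5. For every $u$ with $|u|=1$ and $1/4<{\rm Re}\,u<1$, and every Hermitian form $H$ of signature $(3,1)$ preserved by $\rho_u$, the image $\rho_u({\rm Bi}(3))$ is Zariski-dense in the real algebraic group ${\rm SU}(H)\simeq{\rm SU}(3,1)$: it is contained in ${\rm SU}(H)$, and every real polynomial in the real and imaginary parts of the matrix entries that vanishes on $\rho_u({\rm Bi}(3))$ vanishes on ${\rm SU}(H)$. -/

import Mathlib

open Matrix
open scoped MatrixGroups

noncomputable section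

namespace Bianchi

/-! ### The Bianchi group `Bi(3) = PSL(2, O₃)` -/

/-- The primitive cube root of unity `τ = (-1 + i√3)/2`. -/
def τ : ℂ := (-1 + Complex.I * (Real.sqrt 3 : ℂ)) / 2

/-- The ring of integers `O₃ = ℤ[τ]` of `ℚ(i√3)`, as a subring of `ℂ` (see `mem_O3_iff`). -/
def O3 : Subalgebra ℤ ℂ := Algebra.adjoin ℤ {τ}

theorem τ_sq : τ ^ 2 + τ + 1 = 0 := by
  have h : ((Real.sqrt 3 : ℝ) : ℂ) ^ 2 = 3 := by
    rw [← Complex.ofReal_pow, Real.sq_sqrt (by norm_num)]; norm_num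
  unfold τ
  linear_combination (1 / 4 : ℂ) * Complex.I ^ 2 * h + (3 / 4 : ℂ) * Complex.I_sq

theorem τ_isPrimitiveRoot : IsPrimitiveRoot τ 3 := by
  rw [← Polynomial.isRoot_cyclotomic_iff, Polynomial.cyclotomic_three]
  simpa using τ_sq

/-- `O₃` consists exactly of the elements of the field `ℚ(i√3)` that are integral over `ℤ`. -/
theorem mem_O3_iff (x : ℂ) :
    x ∈ O3 ↔
      x ∈ IntermediateField.adjoin ℚ {Complex.I * (Real.sqrt 3 : ℂ)} ∧ IsIntegral ℤ x := by
  have hK : IntermediateField.adjoin ℚ {Complex.I * (Real.sqrt 3 : ℂ)} =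
      IntermediateField.adjoin ℚ {τ} := by
    apply le_antisymm
    · rw [IntermediateField.adjoin_simple_le_iff]
      have h1 : Complex.I * (Real.sqrt 3 : ℂ) = 2 * τ + 1 := by unfold τ; ring
      rw [h1]
      exact add_mem (mul_mem (ofNat_mem _ 2)
        (IntermediateField.mem_adjoin_simple_self ℚ τ)) (one_mem _)
    · rw [IntermediateField.adjoin_simple_le_iff]
      unfold τ
      exact div_mem (add_mem (neg_mem (one_mem _))
        (IntermediateField.mem_adjoin_simple_self ℚ _)) (ofNat_mem _ 2)
  rw [hK]
  set K := IntermediateField.adjoin ℚ {τ} with hKdef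
  have hint : IsIntegral ℤ τ := τ_isPrimitiveRoot.isIntegral (by norm_num)
  constructor
  · intro hx
    refine ⟨?_, ?_⟩
    · have hle : O3 ≤ K.toSubalgebra.restrictScalars ℤ := by
        apply Algebra.adjoin_le
        intro y hy
        rw [Set.mem_singleton_iff] at hy
        subst hy
        exact IntermediateField.mem_adjoin_simple_self ℚ τ
      exact hle hx
    · exact (adjoin_le_integralClosure hint) hx
  · rintro ⟨hxK, hxi⟩
    have : Fact (Nat.Prime 3) := ⟨Nat.prime_three⟩
    let ζ : K := ⟨τ, IntermediateField.mem_adjoin_simple_self ℚ τ⟩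
    have hζ : IsPrimitiveRoot ζ 3 := by
      apply IsPrimitiveRoot.of_map_of_injective (f := K.val) (k := 3) _ K.val.injective
      exact τ_isPrimitiveRoot
    have : IsCyclotomicExtension {3} ℚ K := by
      change IsCyclotomicExtension {3} ℚ (IntermediateField.adjoin ℚ {τ}).toSubalgebra
      rw [IntermediateField.adjoin_simple_toSubalgebra_of_isAlgebraic
        (hint.tower_top (A := ℚ)).isAlgebraic]
      exact τ_isPrimitiveRoot.adjoin_isCyclotomicExtension ℚ
    have hic := IsCyclotomicExtension.Rat.isIntegralClosure_adjoin_singleton_of_prime hζ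
    have hxi' : IsIntegral ℤ (⟨x, hxK⟩ : K) := by
      have hinj : Function.Injective (K.val.restrictScalars ℤ) := K.val.injective
      exact (isIntegral_algHom_iff (K.val.restrictScalars ℤ) hinj).1 hxi
    obtain ⟨y, hy⟩ := hic.isIntegral_iff.1 hxi'
    have hmem : (K.val.restrictScalars ℤ) (y : K) ∈
        (Algebra.adjoin ℤ ({ζ} : Set K)).map (K.val.restrictScalars ℤ) := ⟨y, y.2, rfl⟩
    rw [AlgHom.map_adjoin, Set.image_singleton] at hmem
    have hyx : (y : K) = ⟨x, hxK⟩ := hy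
    rw [hyx] at hmem
    exact hmem

/-- `τ` as an element of `O₃`. -/
def τ' : O3 := ⟨τ, Algebra.self_mem_adjoin_singleton ℤ τ⟩

theorem τ'_sq : τ' ^ 2 + τ' + 1 = 0 := Subtype.ext τ_sq

theorem τ'_pow_two_mul : τ' ^ 2 * τ' = 1 := by
  linear_combination (τ' - 1) * τ'_sq

/-- The Bianchi group `Bi(3) = PSL(2, O₃)`. -/
abbrev Bi3 : Type := PSL(2, O3)

/-- `T = [1 1; 0 1]`. -/
def matT : SL(2, O3) := ⟨!![1, 1; 0, 1], by simp [Matrix.det_fin_two_of]⟩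

/-- `U = [1 τ; 0 1]`. -/
def matU : SL(2, O3) := ⟨!![1, τ'; 0, 1], by simp [Matrix.det_fin_two_of]⟩

/-- `A = [0 -1; 1 0]`. -/
def matA : SL(2, O3) := ⟨!![0, -1; 1, 0], by simp [Matrix.det_fin_two_of]⟩

/-- `L = [τ⁻¹ 0; 0 τ]`, where `τ⁻¹ = τ²`. -/
def matL : SL(2, O3) :=
  ⟨!![τ' ^ 2, 0; 0, τ'], by simp [Matrix.det_fin_two_of, τ'_pow_two_mul]⟩

/-- The generators of `Bi(3)`: the classes of the four matrices above. -/
def genT : Bi3 := QuotientGroup.mk matT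
def genU : Bi3 := QuotientGroup.mk matU
def genA : Bi3 := QuotientGroup.mk matA
def genL : Bi3 := QuotientGroup.mk matL

/-- The defining relations in Swan's presentation of `Bi(3)`. -/
def SwanRelations {G : Type*} [Group G] (T U A L : G) : Prop :=
  T * U * T⁻¹ * U⁻¹ = 1 ∧ L ^ 3 = 1 ∧ (A * L) ^ 2 = 1 ∧ A ^ 2 = 1 ∧ (T * A) ^ 3 = 1 ∧
    (U * A * L) ^ 3 = 1 ∧ L⁻¹ * U * L = T ∧ L⁻¹ * T * L = T⁻¹ * U⁻¹

/-! ### The family `ρ_u` -/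

def rhoT (u : ℂ) : Matrix (Fin 4) (Fin 4) ℂ :=
  !![1, 0, 0, 0;
     -((2 - u + u ^ 2) / u ^ 2), 1 / u + u, -1, 1 / u + u;
     0, 1, 0, 0;
     0, 0, 0, 1]

def rhoU (u : ℂ) : Matrix (Fin 4) (Fin 4) ℂ :=
  !![1 + u, 0, 0, -u;
     -(2 / (u + u ^ 2)), 1 / (1 + u), 1 / (1 + u), -(u / (1 + u));
     -((2 + u + u ^ 2) / (u ^ 2 + u ^ 3)), -(1 / (1 + u)),
       (1 + u + u ^ 2) / (u + u ^ 2), 1 / (u + u ^ 2);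
     1, 0, 0, 0]

def rhoA (u : ℂ) : Matrix (Fin 4) (Fin 4) ℂ :=
  !![1, 0, 0, 0;
     0, 0, 0, 1;
     -((2 - u + u ^ 2) / u ^ 2), 1 / u + u, -1, 1 / u + u;
     0, 1, 0, 0]

def rhoL (u : ℂ) : Matrix (Fin 4) (Fin 4) ℂ :=
  !![(-1 + u) / (1 + u), -(u ^ 2 / (1 + u)), u / (1 + u), -(u ^ 2 / (1 + u));
     -(2 / (u + u ^ 2)), 1 / (1 + u), 1 / (1 + u), -(u / (1 + u));
     -((2 + u + u ^ 2) / u ^ 2), 1 / u, 0, 1 / u;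
     -(2 / (u + u ^ 2)), -(u / (1 + u)), 1 / (1 + u), 1 / (1 + u)]

/-- `ρ` is the representation `ρ_u : Bi(3) → SL(4, ℂ)`: it takes the prescribed values on the
generators `T, U, A, L`. -/
def IsRho (u : ℂ) (ρ : Bi3 →* SL(4, ℂ)) : Prop :=
  (ρ genT : Matrix (Fin 4) (Fin 4) ℂ) = rhoT u ∧
  (ρ genU : Matrix (Fin 4) (Fin 4) ℂ) = rhoU u ∧
  (ρ genA : Matrix (Fin 4) (Fin 4) ℂ) = rhoA u ∧
  (ρ genL : Matrix (Fin 4) (Fin 4) ℂ) = rhoL u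

/-- The representations `ρ` and `ρ'` are conjugate by an element of `GL(4, ℂ)`. -/
def AreConjugate (ρ ρ' : Bi3 →* SL(4, ℂ)) : Prop :=
  ∃ P : GL (Fin 4) ℂ, ∀ g : Bi3,
    (P : Matrix (Fin 4) (Fin 4) ℂ) * (ρ g : Matrix (Fin 4) (Fin 4) ℂ) *
      ((P⁻¹ : GL (Fin 4) ℂ) : Matrix (Fin 4) (Fin 4) ℂ) = (ρ' g : Matrix (Fin 4) (Fin 4) ℂ)

/-! ### The hyperbolic (lattice) representation -/

/-- An orthogonal basis of the real vector space of Hermitian `2 × 2` matrices, in which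
`det = x₀² - x₁² - x₂² - x₃²`. -/
def hermBasis : Fin 4 → Matrix (Fin 2) (Fin 2) ℂ :=
  ![!![1, 0; 0, 1], !![1, 0; 0, -1], !![0, 1; 1, 0], !![0, Complex.I; -Complex.I, 0]]

/-- The isomorphism `PSL(2, ℂ) ≃ SO⁰(3, 1)` on the level of matrices: the real `4 × 4` matrix of
the isometry `X ↦ g X g*` of the space of Hermitian `2 × 2` matrices with the quadratic form `det`,
in the basis `hermBasis` (which is orthogonal for `⟨X, Y⟩ = Re tr (X Y)`, with all squared
norms `2`). -/
def lorentz (g : Matrix (Fin 2) (Fin 2) ℂ) : Matrix (Fin 4) (Fin 4) ℝ :=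
  Matrix.of fun i j => (Matrix.trace (hermBasis i * (g * hermBasis j * gᴴ))).re / 2

/-- `ρ_hyp` on the class of `g ∈ SL(2, O₃)`: the lattice embedding of `Bi(3)` in `SO(3, 1)`,
with its entries regarded as complex numbers. -/
def rhoHyp (g : SL(2, O3)) : Matrix (Fin 4) (Fin 4) ℂ :=
  (lorentz ((g : Matrix (Fin 2) (Fin 2) O3).map fun x => (x : ℂ))).map fun x => (x : ℂ)

/-- `ρ` is conjugate in `GL(4, ℂ)` to `ρ_hyp`. -/
def IsConjugateToHyp (ρ : Bi3 →* SL(4, ℂ)) : Prop :=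
  ∃ P : GL (Fin 4) ℂ, ∀ g : SL(2, O3),
    (P : Matrix (Fin 4) (Fin 4) ℂ) *
      (ρ (QuotientGroup.mk g) : Matrix (Fin 4) (Fin 4) ℂ) *
      ((P⁻¹ : GL (Fin 4) ℂ) : Matrix (Fin 4) (Fin 4) ℂ) = rhoHyp g

/-! ### Hermitian forms, ellipticity, Zariski density -/

/-- The Hermitian form with matrix `H` on `ℂ⁴` has signature `(p, q)`, where `p + q = 4`. -/
def HasSignature (H : Matrix (Fin 4) (Fin 4) ℂ) (p q : ℕ) : Prop :=
  p + q = 4 ∧ ∃ P : GL (Fin 4) ℂ,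
    (P : Matrix (Fin 4) (Fin 4) ℂ)ᴴ * H * (P : Matrix (Fin 4) (Fin 4) ℂ) =
      Matrix.diagonal fun i : Fin 4 => if (i : ℕ) < p then (1 : ℂ) else -1

/-- The special unitary group `SU(H) = {g ∈ SL(4, ℂ) | g* H g = H}`; it is a copy of `SU(3, 1)`
when `H` has signature `(3, 1)`. -/
def SU (H : Matrix (Fin 4) (Fin 4) ℂ) : Set SL(4, ℂ) :=
  {g | (g : Matrix (Fin 4) (Fin 4) ℂ)ᴴ * H * (g : Matrix (Fin 4) (Fin 4) ℂ) = H}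

/-- `ρ` preserves the Hermitian form with matrix `H`. -/
def PreservesForm (ρ : Bi3 →* SL(4, ℂ)) (H : Matrix (Fin 4) (Fin 4) ℂ) : Prop :=
  H.IsHermitian ∧ ∀ g : Bi3, ρ g ∈ SU H

/-- Ellipticity of a linear map: diagonalizable over `ℂ` with all eigenvalues of modulus one. -/
def IsElliptic (g : SL(4, ℂ)) : Prop :=
  ∃ (P : GL (Fin 4) ℂ) (d : Fin 4 → ℂ), (∀ i, ‖d i‖ = 1) ∧
    (g : Matrix (Fin 4) (Fin 4) ℂ) =
      (P : Matrix (Fin 4) (Fin 4) ℂ) * Matrix.diagonal d *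
        ((P⁻¹ : GL (Fin 4) ℂ) : Matrix (Fin 4) (Fin 4) ℂ)

/-- `g` fixes a point of the complex hyperbolic space of `H`, that is, of the space of lines
of `ℂ⁴` spanned by a vector that is negative for `H`. -/
def FixesHyperbolicPoint (H : Matrix (Fin 4) (Fin 4) ℂ) (g : SL(4, ℂ)) : Prop :=
  ∃ v : Fin 4 → ℂ, (star v ⬝ᵥ (H *ᵥ v)).re < 0 ∧
    ∃ c : ℂ, (g : Matrix (Fin 4) (Fin 4) ℂ) *ᵥ v = c • v

/-- The real coordinates of a complex `4 × 4` matrix: the real and imaginary parts of its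
entries. -/
def realCoords (g : SL(4, ℂ)) : (Fin 4 × Fin 4) ⊕ (Fin 4 × Fin 4) → ℝ :=
  Sum.elim (fun p => ((g : Matrix (Fin 4) (Fin 4) ℂ) p.1 p.2).re)
    (fun p => ((g : Matrix (Fin 4) (Fin 4) ℂ) p.1 p.2).im)

/-- `S` is a Zariski-dense subset of the real algebraic set `G`: every real polynomial in the real
and imaginary parts of the matrix entries that vanishes on `S` vanishes on `G`. -/
def IsZariskiDenseIn (S G : Set SL(4, ℂ)) : Prop :=
  S ⊆ G ∧ ∀ p : MvPolynomial ((Fin 4 × Fin 4) ⊕ (Fin 4 × Fin 4)) ℝ,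
    (∀ g ∈ S, MvPolynomial.eval (realCoords g) p = 0) →
      ∀ g ∈ G, MvPolynomial.eval (realCoords g) p = 0

end Bianchi

end

noncomputable section
namespace Bianchi

/-! ### Arithmetic of the Eisenstein integers -/

/-! Existence of `ρ_u` rests on the fact that Swan's relations present `Bi(3)`. Given elements of a
group `G` satisfying them, pair them with the generators of `Bi(3)` and let `S ⊆ G × Bi(3)` be the
subgroup generated by the pairs; a homomorphism exists once the projection `S → Bi(3)` is injective.
To see this, the Euclidean algorithm in `ℤ[τ]` attaches to each vector `(a, c)` a coset of the cusp
group `B` generated by the translations and `L` (`cosetOf`). The relations make the coset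
independent of the quotients chosen and compatible with the generators (`CuspData.equivariant`,
`CuspData.A_smul_cosetOf`). An element of `S` over the identity then fixes the coset of `(1, 0)`, so
it lies in `B`, where it is visibly trivial (`exists_hom_of_swan`). Uniqueness holds because the
four elements generate, again by Euclid.

For `u ≠ 1` the commuting matrices of `T` and `U` have a common eigenbasis (`eigQ`), in which `L`
permutes three basis vectors and `A` depends only on `a = -(u² + u + 1)/(u - 1)²`. When `|u| = 1`,
`a` is real and `diag((1 - a²)/3, 1, 1, 1)` is invariant; its first entry changes sign at `a = 1`,
that is at `Re u = 1/4`. At `u = 1` the form is the pullback of the Lorentz form. Non-conjugacy is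
read off the trace `2 + u + 1/u` of `ρ_u(T)`.

Any invariant form is diagonal in the eigenbasis, so a form of signature `(3, 1)` is negative on
some common eigenvector of `T` and `U`. Since `T` has infinite order while powers of `u` return
arbitrarily close to `1`, the image cannot be discrete with `ρ_u` injective.

For Zariski density, work with the Lie algebra of the Zariski closure of the image. If `u` is not a
root of unity, the closure contains the circle through the powers of `T`; otherwise an explicit
loxodromic word has powers dense in a real hyperbola. Either way the Lie algebra contains a
non-scalar element. The pair `T`, `U` acts on the off-diagonal matrix entries by pairwise distinct
characters, so elementary matrices split off in the complexified Lie algebra, and conjugation by `A`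
spreads one of them to all (`IsNormalizedGroup.single_mem_of_ne_scalar`). Hence the real Lie algebra
contains the generators of rotations, boosts and one central phase. Their flows preserve the closure
(`flow_mul_mem_zariskiClosure`), and Gaussian elimination with these flows reduces every special
isometry to the identity (`IsNormalizedGroup.mem_zariskiClosure`). -/

theorem τ_re : τ.re = -1 / 2 := by simp [τ]

theorem τ_im : τ.im = √3 / 2 := by simp [τ]

theorem coe_τ' : ((τ' : O3) : ℂ) = τ := rfl

theorem O3_exists_coords (x : O3) : ∃ m n : ℤ, x = m + n * τ' := by
  obtain ⟨x, hx⟩ := x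
  induction hx using Algebra.adjoin_induction with
  | mem x hx =>
    rw [Set.mem_singleton_iff] at hx
    subst hx
    exact ⟨0, 1, by simp [τ']⟩
  | algebraMap r => exact ⟨r, 0, by apply Subtype.ext; simp⟩
  | add x y hx hy h1 h2 =>
    obtain ⟨m, n, h⟩ := h1
    obtain ⟨m', n', h'⟩ := h2
    refine ⟨m + m', n + n', ?_⟩
    have : (⟨x + y, add_mem hx hy⟩ : O3) = ⟨x, hx⟩ + ⟨y, hy⟩ := rfl
    rw [this, h, h']
    push_cast
    ring
  | mul x y hx hy h1 h2 =>
    obtain ⟨m, n, h⟩ := h1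
    obtain ⟨m', n', h'⟩ := h2
    refine ⟨m * m' - n * n', m * n' + n * m' - n * n', ?_⟩
    have : (⟨x * y, mul_mem hx hy⟩ : O3) = ⟨x, hx⟩ * ⟨y, hy⟩ := rfl
    rw [this, h, h']
    push_cast
    linear_combination (n * n' : O3) * τ'_sq

theorem coe_coords (m n : ℤ) : ((m + n * τ' : O3) : ℂ) = m + n * τ := by
  push_cast [coe_τ']
  rfl

theorem normSq_coords (m n : ℤ) :
    Complex.normSq ((m + n * τ' : O3) : ℂ) = ((m ^ 2 - m * n + n ^ 2 : ℤ) : ℝ) := by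
  rw [coe_coords, Complex.normSq_apply]
  simp only [Complex.add_re, Complex.add_im, Complex.mul_re, Complex.mul_im, Complex.intCast_re,
    Complex.intCast_im, τ_re, τ_im]
  push_cast
  linear_combination (n ^ 2 / 4 : ℝ) * Real.sq_sqrt (show (0 : ℝ) ≤ 3 by norm_num)

theorem coords_injective {m n m' n' : ℤ} (h : (m + n * τ' : O3) = m' + n' * τ') :
    m = m' ∧ n = n' := by
  have h1 : (m + n * τ : ℂ) = m' + n' * τ := by rw [← coe_coords, h, coe_coords]
  have him := congrArg Complex.im h1
  have hre := congrArg Complex.re h1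
  simp only [Complex.add_re, Complex.add_im, Complex.mul_re, Complex.mul_im, Complex.intCast_re,
    Complex.intCast_im, τ_re, τ_im] at him hre
  have h3 : (0 : ℝ) < √3 := Real.sqrt_pos.2 (by norm_num)
  have hn : (n : ℝ) = n' := by
    have : (n - n' : ℝ) * √3 = 0 := by linarith
    rcases mul_eq_zero.1 this with h | h <;> linarith
  have hm : (m : ℝ) = m' := by rw [hn] at hre; linarith
  exact ⟨by exact_mod_cast hm, by exact_mod_cast hn⟩

/-- The norm of an Eisenstein integer. -/
def nrm (x : O3) : ℕ := ⌊Complex.normSq (x : ℂ)⌋₊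

theorem nrm_cast (x : O3) : (nrm x : ℝ) = Complex.normSq (x : ℂ) := by
  obtain ⟨m, n, rfl⟩ := O3_exists_coords x
  have h := normSq_coords m n
  have h0 := Complex.normSq_nonneg ((m + n * τ' : O3) : ℂ)
  rw [h] at h0
  obtain ⟨k, hk⟩ := Int.eq_ofNat_of_zero_le (a := m ^ 2 - m * n + n ^ 2) (by exact_mod_cast h0)
  rw [nrm, h, hk]
  simp

theorem nrm_coords (m n : ℤ) : (nrm (m + n * τ') : ℤ) = m ^ 2 - m * n + n ^ 2 := by
  have : ((nrm (m + n * τ') : ℤ) : ℝ) = ((m ^ 2 - m * n + n ^ 2 : ℤ) : ℝ) := by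
    rw [← normSq_coords, ← nrm_cast]; simp
  exact_mod_cast this

theorem nrm_mul (x y : O3) : nrm (x * y) = nrm x * nrm y := by
  have : (nrm (x * y) : ℝ) = nrm x * nrm y := by simp [nrm_cast]
  exact_mod_cast this

theorem nrm_neg (x : O3) : nrm (-x) = nrm x := by simp [nrm]

theorem nrm_one : nrm 1 = 1 := by simp [nrm]

theorem nrm_zero : nrm 0 = 0 := by simp [nrm]

theorem nrm_eq_zero {x : O3} : nrm x = 0 ↔ x = 0 := by
  rw [← Nat.cast_eq_zero (R := ℝ), nrm_cast, Complex.normSq_eq_zero]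
  simp

theorem nrm_lt_iff {x y : O3} : nrm x < nrm y ↔ ‖(x : ℂ)‖ < ‖(y : ℂ)‖ := by
  rw [← Nat.cast_lt (α := ℝ), nrm_cast, nrm_cast, Complex.normSq_eq_norm_sq,
    Complex.normSq_eq_norm_sq]
  exact pow_lt_pow_iff_left₀ (norm_nonneg _) (norm_nonneg _) two_ne_zero

theorem nrm_τ' : nrm τ' = 1 := by
  have := nrm_coords 0 1
  simp at this
  exact this

theorem τ'_cube : τ' ^ 3 = 1 := by linear_combination (τ' - 1) * τ'_sq

theorem eq_sixth_root_of_nrm_eq_one {x : O3} (hx : nrm x = 1) :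
    ∃ k : ℕ, x = τ' ^ k ∨ x = -τ' ^ k := by
  obtain ⟨m, n, rfl⟩ := O3_exists_coords x
  have h := nrm_coords m n
  rw [hx] at h
  -- `4(m² - mn + n²) = 3m² + (m - 2n)²` confines `m`, and by symmetry `n`, to finitely many values.
  have hm : m ^ 2 ≤ 1 := by push_cast at h; nlinarith [sq_nonneg (m - 2 * n)]
  have hn : n ^ 2 ≤ 1 := by push_cast at h; nlinarith [sq_nonneg (n - 2 * m)]
  have hm1 : m ≤ 1 := by nlinarith
  have hm2 : -1 ≤ m := by nlinarith
  have hn1 : n ≤ 1 := by nlinarith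
  have hn2 : -1 ≤ n := by nlinarith
  interval_cases m <;> interval_cases n <;> simp at h
  · exact ⟨2, Or.inl (by push_cast; linear_combination -τ'_sq)⟩
  · exact ⟨0, Or.inr (by simp)⟩
  · exact ⟨1, Or.inr (by simp)⟩
  · exact ⟨1, Or.inl (by simp)⟩
  · exact ⟨0, Or.inl (by simp)⟩
  · exact ⟨2, Or.inr (by push_cast; linear_combination τ'_sq)⟩

/-- The six elements of norm `3` are the sums of two adjacent sixth roots of unity. This splits a
change of quotient of norm `3` into two changes by units. -/
theorem exists_nrm_one_add_of_nrm_eq_three {x : O3} (hx : nrm x = 3) :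
    ∃ y z : O3, nrm y = 1 ∧ nrm z = 1 ∧ x = y + z ∧ nrm (y - z) = 1 := by
  obtain ⟨m, n, rfl⟩ := O3_exists_coords x
  have h := nrm_coords m n
  rw [hx] at h
  have key : ∀ a b c d : ℤ, a ^ 2 - a * b + b ^ 2 = 1 → c ^ 2 - c * d + d ^ 2 = 1 →
      (a - c) ^ 2 - (a - c) * (b - d) + (b - d) ^ 2 = 1 → m = a + c → n = b + d →
      ∃ y z : O3, nrm y = 1 ∧ nrm z = 1 ∧ (m + n * τ' : O3) = y + z ∧ nrm (y - z) = 1 := by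
    intro a b c d h1 h2 h3 hm hn
    refine ⟨a + b * τ', c + d * τ', ?_, ?_, ?_, ?_⟩
    · have := nrm_coords a b
      omega
    · have := nrm_coords c d
      omega
    · rw [hm, hn]; push_cast; ring
    · have := nrm_coords (a - c) (b - d)
      rw [h3] at this
      have e : (a + b * τ' - (c + d * τ') : O3) = (a - c : ℤ) + (b - d : ℤ) * τ' := by
        push_cast; ring
      rw [e]
      omega
  have hm : m ^ 2 ≤ 4 := by push_cast at h; nlinarith [sq_nonneg (m - 2 * n)]
  have hn : n ^ 2 ≤ 4 := by push_cast at h; nlinarith [sq_nonneg (n - 2 * m)]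
  have hm1 : m ≤ 2 := by nlinarith
  have hm2 : -2 ≤ m := by nlinarith
  have hn1 : n ≤ 2 := by nlinarith
  have hn2 : -2 ≤ n := by nlinarith
  interval_cases m <;> interval_cases n <;> simp at h
  · exact key (-1) 0 (-1) (-1) (by norm_num) (by norm_num) (by norm_num) (by norm_num) (by norm_num)
  · exact key (-1) (-1) 0 (-1) (by norm_num) (by norm_num) (by norm_num) (by norm_num) (by norm_num)
  · exact key (-1) 0 0 1 (by norm_num) (by norm_num) (by norm_num) (by norm_num) (by norm_num)
  · exact key 1 0 0 (-1) (by norm_num) (by norm_num) (by norm_num) (by norm_num) (by norm_num)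
  · exact key 1 1 0 1 (by norm_num) (by norm_num) (by norm_num) (by norm_num) (by norm_num)
  · exact key 1 0 1 1 (by norm_num) (by norm_num) (by norm_num) (by norm_num) (by norm_num)

theorem nrm_of_lt_four {x : O3} (hx : nrm x < 4) : nrm x = 0 ∨ nrm x = 1 ∨ nrm x = 3 := by
  obtain ⟨m, n, rfl⟩ := O3_exists_coords x
  have h := nrm_coords m n
  have : nrm (m + n * τ') ≠ 2 := by
    intro h2
    rw [h2] at h
    have hm : m ^ 2 ≤ 4 := by push_cast at h; nlinarith [sq_nonneg (m - 2 * n)]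
    have hn : n ^ 2 ≤ 4 := by push_cast at h; nlinarith [sq_nonneg (n - 2 * m)]
    have hm1 : m ≤ 2 := by nlinarith
    have hm2 : -2 ≤ m := by nlinarith
    have hn1 : n ≤ 2 := by nlinarith
    have hn2 : -2 ≤ n := by nlinarith
    interval_cases m <;> interval_cases n <;> simp at h
  omega

/-- Rounding the two coordinates of `a / c` in turn leaves an error of squared modulus at most `1/4
+ 3/16 < 1`. -/
theorem exists_quotient (a c : O3) (hc : c ≠ 0) : ∃ q : O3, nrm (q * c - a) < nrm c := by
  have hc' : (c : ℂ) ≠ 0 := by simpa using hc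
  have h3 : (0 : ℝ) < √3 := Real.sqrt_pos.2 (by norm_num)
  have h33 : √3 ^ 2 = (3 : ℝ) := Real.sq_sqrt (by norm_num)
  set z : ℂ := a / c with hz
  set n : ℤ := round (2 * z.im / √3) with hn
  set m : ℤ := round (z.re + n / 2) with hm
  refine ⟨m + n * τ', ?_⟩
  rw [nrm_lt_iff]
  have e : ((((m + n * τ' : O3) * c - a : O3)) : ℂ) = (m + n * τ - z) * c := by
    have := coe_coords m n
    push_cast at this ⊢
    rw [this, sub_mul, hz, div_mul_cancel₀ _ hc']
  rw [e, norm_mul]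
  have hlt : ‖(m + n * τ - z : ℂ)‖ < 1 := by
    rw [← sq_lt_one_iff₀ (norm_nonneg _), ← Complex.normSq_eq_norm_sq, Complex.normSq_apply]
    simp only [Complex.add_re, Complex.add_im, Complex.mul_re, Complex.mul_im, Complex.intCast_re,
      Complex.intCast_im, τ_re, τ_im, Complex.sub_re, Complex.sub_im]
    have h1 := abs_le.1 (abs_sub_round (2 * z.im / √3))
    have h2 := abs_le.1 (abs_sub_round (z.re + n / 2))
    rw [← hn] at h1
    rw [← hm] at h2
    set w := 2 * z.im / √3 with hw
    have hzw : z.im = w * √3 / 2 := by rw [hw]; field_simp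
    rw [hzw]
    have e1 : (m + (n * (-1 / 2) - 0 * (√3 / 2)) - z.re) ^ 2 ≤ (1 / 2) ^ 2 := by
      apply sq_le_sq' <;> linarith
    have e2 : (w - n) ^ 2 ≤ (1 / 2) ^ 2 := by
      apply sq_le_sq' <;> linarith
    nlinarith
  have : 0 < ‖(c : ℂ)‖ := norm_pos_iff.2 hc'
  nlinarith

/-- The six points `δ c` are the vertices of a regular hexagon on the circle through `a`, so one of
them is within `30°` of `a`, hence closer than the radius. This makes the algorithm progress when
both coordinates have equal norm. -/
theorem exists_unit_close (a c : O3) (hc : c ≠ 0) (h : nrm a = nrm c) :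
    ∃ δ : O3, nrm δ = 1 ∧ nrm (δ * c - a) < nrm c := by
  have hc' : (c : ℂ) ≠ 0 := by simpa using hc
  have hcn : 0 < Complex.normSq (c : ℂ) := Complex.normSq_pos.2 hc'
  have h' : Complex.normSq (a : ℂ) = Complex.normSq (c : ℂ) := by
    rw [← nrm_cast, ← nrm_cast, h]
  have h33 : √3 ^ 2 = (3 : ℝ) := Real.sq_sqrt (by norm_num)
  by_contra! hcon
  -- `Re (a conj(δ c)) ≤ N(c) / 2` for each sixth root of unity `δ`
  have key : ∀ m n : ℤ, m ^ 2 - m * n + n ^ 2 = 1 →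
      2 * ((a : ℂ).re * ((m - n / 2) * (c : ℂ).re - n * √3 / 2 * (c : ℂ).im) +
        (a : ℂ).im * ((m - n / 2) * (c : ℂ).im + n * √3 / 2 * (c : ℂ).re)) ≤
        Complex.normSq (c : ℂ) := by
    intro m n hmn
    have h1 := hcon (m + n * τ') (by have := nrm_coords m n; omega)
    rw [← Nat.cast_le (α := ℝ), nrm_cast, nrm_cast] at h1
    have h2 : Complex.normSq (((m + n * τ' : O3) * c : O3) : ℂ) = Complex.normSq (c : ℂ) := by
      push_cast
      rw [Complex.normSq_mul]
      have := normSq_coords m n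
      push_cast at this
      rw [this]
      have hmn' : (m ^ 2 - m * n + n ^ 2 : ℝ) = 1 := by exact_mod_cast hmn
      rw [hmn', one_mul]
    have e : (((m + n * τ' : O3) * c : O3) : ℂ) = (m + n * τ) * c := by
      have := coe_coords m n
      push_cast at this ⊢
      rw [this]
    rw [Subalgebra.coe_sub, Complex.normSq_sub, h2, e, h'] at h1
    simp only [Complex.mul_re, Complex.mul_im, Complex.add_re, Complex.add_im,
      Complex.intCast_re, Complex.intCast_im, τ_re, τ_im, Complex.conj_re, Complex.conj_im] at h1
    linarith
  have k1 := key 1 0 (by norm_num)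
  have k2 := key (-1) 0 (by norm_num)
  have k3 := key 0 1 (by norm_num)
  have k4 := key 0 (-1) (by norm_num)
  have k5 := key (-1) (-1) (by norm_num)
  have k6 := key 1 1 (by norm_num)
  rw [Complex.normSq_apply] at h' hcn
  rw [Complex.normSq_apply] at k1 k2 k3 k4 k5 k6
  rw [Complex.normSq_apply] at h'
  push_cast at k1 k2 k3 k4 k5 k6
  generalize (a : ℂ).re = x at *
  generalize (a : ℂ).im = y at *
  generalize (c : ℂ).re = s at *
  generalize (c : ℂ).im = t at *
  set α := x * s + y * t with hα
  set β := y * s - x * t with hβ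
  have hab : α ^ 2 + β ^ 2 = (s * s + t * t) ^ 2 := by
    have : α ^ 2 + β ^ 2 = (x * x + y * y) * (s * s + t * t) := by rw [hα, hβ]; ring
    rw [this, h']; ring
  set M := s * s + t * t
  -- If all six vertices were far from `a`, the sum of the next three inequalities would read `6(α²
  -- + β²) = 6M² ≤ 3M²`.
  have l1 : (2 * α) ^ 2 ≤ M ^ 2 := by apply sq_le_sq' <;> rw [hα] <;> linarith
  have l2 : (-α + √3 * β) ^ 2 ≤ M ^ 2 := by apply sq_le_sq' <;> rw [hα, hβ] <;> linarith
  have l3 : (-α - √3 * β) ^ 2 ≤ M ^ 2 := by apply sq_le_sq' <;> rw [hα, hβ] <;> linarith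
  nlinarith [mul_pos hcn hcn]

/-- Put `b' = b + (y + z)c`. The parallelogram law with `|b' - b|² = 3|c|²` gives `|b' + b| < |c|`,
and `2(b + yc) = (b' + b) + (y - z)c` is then shorter than `2|c|`. -/
theorem nrm_add_unit_mul_lt {b c y z : O3} (hb : nrm b < nrm c)
    (hb' : nrm (b + (y + z) * c) < nrm c) (hyz : nrm (y + z) = 3) (h1 : nrm (y - z) = 1) :
    nrm (b + y * c) < nrm c := by
  rw [nrm_lt_iff] at *
  have e3 : ‖((y : ℂ) + z)‖ ^ 2 = 3 := by
    have := nrm_cast (y + z)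
    rw [hyz, Complex.normSq_eq_norm_sq] at this
    push_cast at this
    linarith
  have e1 : ‖((y : ℂ) - z)‖ = 1 := by
    have := nrm_cast (y - z)
    rw [h1, Complex.normSq_eq_norm_sq] at this
    push_cast at this
    nlinarith [norm_nonneg ((y : ℂ) - z)]
  push_cast at *
  have par := parallelogram_law_with_norm ℝ ((b : ℂ) + (y + z) * c) b
  have e2 : ‖(b : ℂ) + (y + z) * c - b‖ ^ 2 = 3 * ‖(c : ℂ)‖ ^ 2 := by
    rw [add_sub_cancel_left, norm_mul, mul_pow, e3]
  have lt1 : ‖(b : ℂ) + (y + z) * c + b‖ < ‖(c : ℂ)‖ := by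
    apply lt_of_pow_lt_pow_left₀ 2 (norm_nonneg _)
    nlinarith [norm_nonneg (b : ℂ), norm_nonneg ((b : ℂ) + (y + z) * c), norm_nonneg (c : ℂ)]
  have tri : ‖(2 : ℂ) * (b + y * c)‖ ≤ ‖(b : ℂ) + (y + z) * c + b‖ + ‖((y : ℂ) - z) * c‖ := by
    refine le_trans (le_of_eq ?_) (norm_add_le _ _)
    congr 1
    ring
  rw [norm_mul, norm_mul, e1] at tri
  norm_num at tri
  linarith

end Bianchi
end

noncomputable section
namespace Bianchi

/-! ### Swan's presentation, by the Euclidean algorithm -/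

/-- Translations `tr`, the inversion `A` and the rotation `L` in a group `Γ`, satisfying the
relations of `Bi(3)`. -/
structure CuspData (Γ : Type*) [Group Γ] where
  tr : O3 → Γ
  A : Γ
  L : Γ
  tr_add : ∀ x y, tr (x + y) = tr x * tr y
  L_tr : ∀ x, L * tr x = tr (τ' * x) * L
  A_sq : A * A = 1
  L_cube : L ^ 3 = 1
  L_A_L : L * A * L = A
  A_tr_one : A * tr 1 * A = tr (-1) * A * tr (-1)

namespace CuspData

variable {Γ : Type*} [Group Γ] (d : CuspData Γ)

theorem tr_zero : d.tr 0 = 1 := by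
  have := d.tr_add 0 0
  rw [add_zero] at this
  exact left_eq_mul.1 this

theorem tr_neg (x : O3) : d.tr (-x) = (d.tr x)⁻¹ := by
  rw [eq_inv_iff_mul_eq_one, ← d.tr_add, neg_add_cancel, d.tr_zero]

theorem A_inv : d.A⁻¹ = d.A := inv_eq_of_mul_eq_one_left d.A_sq

theorem L_inv_tr (x : O3) : d.L⁻¹ * d.tr x = d.tr (τ' ^ 2 * x) * d.L⁻¹ := by
  rw [inv_mul_eq_iff_eq_mul, ← mul_assoc, d.L_tr, mul_inv_cancel_right, ← mul_assoc]
  rw [show τ' * τ' ^ 2 = 1 by linear_combination τ'_cube, one_mul]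

theorem L_inv_A : d.L⁻¹ * d.A = d.A * d.L := by
  rw [inv_mul_eq_iff_eq_mul, ← mul_assoc, d.L_A_L]

theorem L_pow_tr (k : ℕ) (x : O3) : d.L ^ k * d.tr x = d.tr (τ' ^ k * x) * d.L ^ k := by
  induction k with
  | zero => simp
  | succ k ih =>
    rw [pow_succ', mul_assoc, ih, ← mul_assoc, d.L_tr, mul_assoc, ← mul_assoc τ', ← pow_succ']

/-- Conjugation by `L` turns `A * tr x * A` into `A * tr (τ' * x) * A`, so the relation for `ε`
propagates to every `ε * τ' ^ j`. -/
theorem A_tr_unit_A_of_sign (ε : O3) (h : d.A * d.tr ε * d.A = d.tr (-ε) * d.A * d.tr (-ε))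
    (j : ℕ) : d.A * d.tr (ε * τ' ^ j) * d.A =
      d.tr (-(ε * τ' ^ (2 * j))) * d.A * d.tr (-(ε * τ' ^ j)) * d.L ^ (2 * j) := by
  induction j with
  | zero => simpa using h
  | succ j ih =>
    have e1 : d.L⁻¹ * (d.A * d.tr (ε * τ' ^ j) * d.A) * d.L =
        d.A * d.tr (ε * τ' ^ (j + 1)) * d.A := by
      calc _ = (d.L⁻¹ * d.A) * d.tr (ε * τ' ^ j) * d.A * d.L := by group
        _ = d.A * (d.L * d.tr (ε * τ' ^ j)) * (d.A * d.L) := by rw [d.L_inv_A]; group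
        _ = d.A * d.tr (τ' * (ε * τ' ^ j)) * (d.L * d.L⁻¹) * d.A := by
          rw [d.L_tr, ← d.L_inv_A]; group
        _ = _ := by rw [mul_inv_cancel, mul_one]; congr 3; ring
    rw [← e1, ih]
    calc _ = (d.L⁻¹ * d.tr (-(ε * τ' ^ (2 * j)))) * d.A * d.tr (-(ε * τ' ^ j)) *
          d.L ^ (2 * j) * d.L := by group
      _ = d.tr (τ' ^ 2 * -(ε * τ' ^ (2 * j))) * (d.L⁻¹ * d.A) * d.tr (-(ε * τ' ^ j)) *
          d.L ^ (2 * j) * d.L := by rw [d.L_inv_tr]; group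
      _ = d.tr (τ' ^ 2 * -(ε * τ' ^ (2 * j))) * d.A * (d.L * d.tr (-(ε * τ' ^ j))) *
          d.L ^ (2 * j) * d.L := by rw [d.L_inv_A]; group
      _ = d.tr (τ' ^ 2 * -(ε * τ' ^ (2 * j))) * d.A * d.tr (τ' * -(ε * τ' ^ j)) *
          (d.L * d.L ^ (2 * j) * d.L) := by rw [d.L_tr]; group
      _ = _ := by
        rw [← pow_succ', ← pow_succ, show 2 * j + 1 + 1 = 2 * (j + 1) by ring]
        congr 4 <;> ring

theorem A_tr_neg_one : d.A * d.tr (-1) * d.A = d.tr (-(-1)) * d.A * d.tr (-(-1)) := by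
  have h := congrArg (fun x => x⁻¹) d.A_tr_one
  simp only [_root_.mul_inv_rev, d.A_inv, ← d.tr_neg] at h
  simpa only [mul_assoc] using h

/-- The relation `(T A)³ = 1` for all six unit translations at once, in the shape that the Euclidean
algorithm consumes; `δ'` is the inverse of `δ`. -/
theorem A_tr_unit_A {δ : O3} (h : nrm δ = 1) : ∃ (k : ℕ) (δ' : O3), δ' * δ = 1 ∧
    δ ^ 2 = τ' ^ k ∧ d.A * d.tr δ * d.A = d.tr (-δ') * d.A * d.tr (-δ) * d.L ^ k := by
  obtain ⟨j, rfl | rfl⟩ := eq_sixth_root_of_nrm_eq_one h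
  · refine ⟨2 * j, τ' ^ (2 * j), ?_, ?_, ?_⟩
    · rw [← pow_add, show 2 * j + j = 3 * j by ring, pow_mul, τ'_cube, one_pow]
    · rw [← pow_mul, mul_comm]
    · simpa using d.A_tr_unit_A_of_sign 1 d.A_tr_one j
  · refine ⟨2 * j, -τ' ^ (2 * j), ?_, ?_, ?_⟩
    · rw [neg_mul_neg, ← pow_add, show 2 * j + j = 3 * j by ring, pow_mul, τ'_cube, one_pow]
    · rw [neg_sq, ← pow_mul, mul_comm]
    · simpa using d.A_tr_unit_A_of_sign (-1) d.A_tr_neg_one j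

/-- The stabilizer of the cusp. -/
def B : Subgroup Γ := Subgroup.closure (Set.range d.tr ∪ {d.L})

theorem tr_mem_B (x : O3) : d.tr x ∈ d.B := Subgroup.subset_closure (Or.inl ⟨x, rfl⟩)

theorem L_mem_B : d.L ∈ d.B := Subgroup.subset_closure (Or.inr rfl)

theorem exists_of_mem_B {g : Γ} (hg : g ∈ d.B) : ∃ (x : O3) (k : ℕ), g = d.tr x * d.L ^ k := by
  induction hg using Subgroup.closure_induction with
  | mem g hg =>
    rcases hg with ⟨x, rfl⟩ | hg
    · exact ⟨x, 0, by simp⟩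
    · rw [Set.mem_singleton_iff.1 hg]
      exact ⟨0, 1, by simp [d.tr_zero]⟩
  | one => exact ⟨0, 0, by simp [d.tr_zero]⟩
  | mul g h _ _ ihg ihh =>
    obtain ⟨x, k, rfl⟩ := ihg
    obtain ⟨y, l, rfl⟩ := ihh
    refine ⟨x + τ' ^ k * y, k + l, ?_⟩
    rw [d.tr_add, pow_add, mul_assoc, ← mul_assoc (d.L ^ k), d.L_pow_tr]
    group
  | inv g _ ih =>
    obtain ⟨x, k, rfl⟩ := ih
    have hL : (d.L ^ k)⁻¹ = d.L ^ (2 * k) := by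
      rw [inv_eq_iff_mul_eq_one, ← pow_add, show k + 2 * k = 3 * k by ring, pow_mul, d.L_cube,
        one_pow]
    exact ⟨τ' ^ (2 * k) * -x, 2 * k, by rw [_root_.mul_inv_rev, hL, ← d.tr_neg, d.L_pow_tr]⟩

open Classical in
/-- The coset of the elements of `Γ` taking the cusp at infinity to `(a : c)`, computed with the
Euclidean algorithm. -/
def cosetOf (a c : O3) : Γ ⧸ d.B :=
  if hc : c = 0 then ((1 : Γ) : Γ ⧸ d.B)
  else d.tr (exists_quotient a c hc).choose • d.A •
    cosetOf c ((exists_quotient a c hc).choose * c - a)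
termination_by nrm c
decreasing_by exact (exists_quotient a c hc).choose_spec

theorem cosetOf_zero (a : O3) : d.cosetOf a 0 = ((1 : Γ) : Γ ⧸ d.B) := by
  rw [cosetOf, dif_pos rfl]

theorem exists_cosetOf (a c : O3) (hc : c ≠ 0) : ∃ q : O3, nrm (q * c - a) < nrm c ∧
    d.cosetOf a c = d.tr q • d.A • d.cosetOf c (q * c - a) := by
  refine ⟨(exists_quotient a c hc).choose, (exists_quotient a c hc).choose_spec, ?_⟩
  rw [cosetOf, dif_neg hc]

theorem smul_one_of_mem {g : Γ} (hg : g ∈ d.B) :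
    g • ((1 : Γ) : Γ ⧸ d.B) = ((1 : Γ) : Γ ⧸ d.B) := by
  rw [MulAction.Quotient.smul_coe, smul_eq_mul, mul_one, QuotientGroup.eq, mul_one]
  exact inv_mem hg

theorem A_smul_A_smul (x : Γ ⧸ d.B) : d.A • d.A • x = x := by
  rw [smul_smul, d.A_sq, one_smul]

/-- The equivariance properties of `cosetOf` at `(a, c)`, without the inversion. -/
structure Equivariant (a c : O3) : Prop where
  quotient : ∀ q, nrm (q * c - a) < nrm c →
    d.cosetOf a c = d.tr q • d.A • d.cosetOf c (q * c - a)
  scale : ∀ ε, nrm ε = 1 → d.cosetOf (ε * a) (ε * c) = d.cosetOf a c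
  rotate : d.cosetOf (τ' * a) c = d.L • d.cosetOf a c

variable {d}

theorem cosetOf_add_mul {a c : O3} (h : ∀ a, d.Equivariant a c) (q : O3) :
    d.cosetOf (a + q * c) c = d.tr q • d.cosetOf a c := by
  by_cases hc : c = 0
  · subst hc
    rw [cosetOf_zero, cosetOf_zero, smul_one_of_mem _ (d.tr_mem_B q)]
  · obtain ⟨q₀, h1, h2⟩ := d.exists_cosetOf a c hc
    have e : (q + q₀) * c - (a + q * c) = q₀ * c - a := by ring
    rw [(h (a + q * c)).quotient (q + q₀) (by rwa [e]), e, h2, d.tr_add, mul_smul]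

theorem cosetOf_pow_mul {c : O3} (h : ∀ a, d.Equivariant a c) (a : O3) (k : ℕ) :
    d.cosetOf (τ' ^ k * a) c = d.L ^ k • d.cosetOf a c := by
  induction k with
  | zero => simp
  | succ k ih => rw [pow_succ', mul_assoc, (h _).rotate, ih, smul_smul, ← pow_succ']

/-- One use of the relation `(T A) ^ 3 = 1`. -/
theorem A_smul_tr_smul_A_smul {δ : O3} (hδ : nrm δ = 1) {c b : O3}
    (h : ∀ a, d.Equivariant a b) : ∃ δ' : O3, δ' * δ = 1 ∧
      d.A • d.tr δ • d.A • d.cosetOf c b =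
        d.tr (-δ') • d.A • d.cosetOf (δ ^ 2 * c - δ * b) b := by
  obtain ⟨k, δ', h1, h2, h3⟩ := d.A_tr_unit_A hδ
  refine ⟨δ', h1, ?_⟩
  rw [sub_eq_add_neg, ← neg_mul, cosetOf_add_mul h, h2, cosetOf_pow_mul h]
  simp only [smul_smul]
  rw [← mul_assoc, h3]
  simp only [mul_assoc]

/-- Two admissible remainders that differ by a unit multiple of `c` lead to the same coset. Applying
`A` to both sides turns the claim into the relation `(T A)³ = 1` at points whose coordinates are
unit multiples of the two remainders; these have norm below `n`, so the inductive hypotheses apply.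
-/
theorem quotient_step {n : ℕ} {b c δ : O3}
    (ih : ∀ c, nrm c < n → ∀ a, d.Equivariant a c)
    (ihA : ∀ a c, nrm c < n → nrm a < n → (a ≠ 0 ∨ c ≠ 0) →
      d.A • d.cosetOf a c = d.cosetOf (-c) a)
    (hc : c ≠ 0) (hb : nrm b < n) (hδ : nrm δ = 1) (hb' : nrm (b + δ * c) < n) :
    d.A • d.cosetOf c b = d.tr δ • d.A • d.cosetOf c (b + δ * c) := by
  obtain ⟨δ', h1, h2⟩ := A_smul_tr_smul_A_smul (d := d) hδ (c := c) (ih _ hb')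
  rw [← d.A_smul_A_smul (d.tr δ • d.A • d.cosetOf c (b + δ * c)), h2]
  congr 1
  have e1 : δ ^ 2 * c - δ * (b + δ * c) = -(δ * b) := by ring
  have hn : nrm (-(δ * b)) < n := by rw [nrm_neg, nrm_mul, hδ, one_mul]; exact hb
  have hδ0 : δ ≠ 0 := by rintro rfl; simp at h1
  rw [e1, ihA _ _ hb' hn ?_, ← cosetOf_add_mul (ih _ hn)]
  · have e2 : -(b + δ * c) + -δ' * -(δ * b) = -δ * c := by linear_combination b * h1
    rw [e2, ← neg_mul, (ih _ hb _).scale]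
    rwa [nrm_neg]
  · by_contra! hcon
    obtain ⟨h3, h4⟩ := hcon
    have hb0 : b = 0 := by simpa [hδ0] using h3
    simp [hb0, hδ0, hc] at h4

/-- The substance is independence of the chosen quotient; once it is known, scaling and rotation
follow by multiplying one admissible quotient and its remainder by a unit. -/
theorem equivariant_of_lt {n : ℕ} {a c : O3} (hcn : nrm c = n)
    (ih : ∀ c, nrm c < n → ∀ a, d.Equivariant a c)
    (ihA : ∀ a c, nrm c < n → nrm a < n → (a ≠ 0 ∨ c ≠ 0) →
      d.A • d.cosetOf a c = d.cosetOf (-c) a) : d.Equivariant a c := by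
  by_cases hc : c = 0
  · subst hc
    exact ⟨fun q h => by simp [nrm_zero] at h, fun ε _ => by simp [cosetOf_zero],
      by rw [cosetOf_zero, cosetOf_zero, smul_one_of_mem _ d.L_mem_B]⟩
  have quot : ∀ c, nrm c = n → c ≠ 0 → ∀ a q, nrm (q * c - a) < nrm c →
      d.cosetOf a c = d.tr q • d.A • d.cosetOf c (q * c - a) := by
    intro c hcn hc a q hq
    obtain ⟨q₀, h1, h2⟩ := d.exists_cosetOf a c hc
    rw [h2]
    obtain ⟨δ, rfl⟩ : ∃ δ, q = q₀ + δ := ⟨q - q₀, by ring⟩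
    have e : (q₀ + δ) * c - a = (q₀ * c - a) + δ * c := by ring
    rw [e] at hq ⊢
    generalize q₀ * c - a = b at *
    rw [d.tr_add, mul_smul]
    congr 1
    -- Two remainders shorter than `|c|` differ by less than `2|c|`, so only quotient changes of
    -- norm `0`, `1` or `3` occur.
    have hδ : nrm δ < 4 := by
      have hcpos : 0 < nrm c := Nat.pos_of_ne_zero (mt nrm_eq_zero.1 hc)
      have h3 : ‖(δ * c : ℂ)‖ < 2 * ‖(c : ℂ)‖ := by
        have t := norm_sub_le ((b : ℂ) + δ * c) b
        rw [add_sub_cancel_left] at t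
        have := nrm_lt_iff.1 h1
        have := nrm_lt_iff.1 hq
        push_cast at this
        linarith
      have h4 : nrm (δ * c) < nrm (2 * c) := by
        rw [nrm_lt_iff]
        rw [Subalgebra.coe_mul, Subalgebra.coe_mul, norm_mul ((2 : O3) : ℂ)]
        have h2 : ((2 : O3) : ℂ) = 2 := rfl
        rw [h2]
        simpa using h3
      rw [nrm_mul, nrm_mul] at h4
      have h5 : nrm 2 = 4 := by
        have := nrm_coords 2 0
        simp only [Int.cast_ofNat, Int.cast_zero, zero_mul, add_zero] at this
        norm_num at this
        exact_mod_cast this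
      rw [h5] at h4
      exact lt_of_mul_lt_mul_right h4 (Nat.zero_le _)
    rw [hcn] at h1 hq
    rcases nrm_of_lt_four hδ with h0 | h0 | h0
    · rw [nrm_eq_zero] at h0
      subst h0
      simp [d.tr_zero]
    · exact quotient_step ih ihA hc h1 h0 hq
    -- A change of norm `3` passes through the intermediate quotient `q₀ + y`, whose remainder is
    -- admissible as well, so two unit steps suffice.
    · obtain ⟨y, z, hy, hz, rfl, hyz⟩ := exists_nrm_one_add_of_nrm_eq_three h0
      have h6 := nrm_add_unit_mul_lt (b := b) (c := c) (by rwa [hcn]) (by rwa [hcn]) h0 hyz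
      rw [hcn] at h6
      have e2 : b + (y + z) * c = (b + y * c) + z * c := by ring
      rw [quotient_step ih ihA hc h1 hy h6, d.tr_add, mul_smul]
      congr 1
      rw [e2] at hq ⊢
      exact quotient_step ih ihA hc h6 hz hq
  refine ⟨quot c hcn hc a, ?_, ?_⟩
  · intro ε hε
    obtain ⟨q₀, h1, h2⟩ := d.exists_cosetOf a c hc
    have hε0 : ε ≠ 0 := by rintro rfl; simp [nrm_zero] at hε
    have e : q₀ * (ε * c) - ε * a = ε * (q₀ * c - a) := by ring
    rw [quot (ε * c) (by rw [nrm_mul, hε, one_mul, hcn]) (mul_ne_zero hε0 hc) (ε * a) q₀ ?_, e,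
      (ih _ (hcn ▸ h1) _).scale _ hε, h2]
    rwa [e, nrm_mul, nrm_mul, hε, one_mul, one_mul]
  · obtain ⟨q₀, h1, h2⟩ := d.exists_cosetOf a c hc
    have e : (τ' * q₀) * c - τ' * a = τ' * (q₀ * c - a) := by ring
    have hb := ih _ (hcn ▸ h1)
    have e2 : d.cosetOf c (τ' * (q₀ * c - a)) = d.L⁻¹ • d.cosetOf c (q₀ * c - a) := by
      -- Scaling both coordinates by `τ'²` moves the unit from the second coordinate to the first,
      -- where it acts as `L² = L⁻¹`.
      have h3 : nrm (τ' ^ 2) = 1 := by rw [pow_two, nrm_mul, nrm_τ']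
      have h4 := (ih (τ' * (q₀ * c - a)) (by rw [nrm_mul, nrm_τ', one_mul, ← hcn]; exact h1)
        c).scale _ h3
      rw [← h4, ← mul_assoc, τ'_pow_two_mul, one_mul, cosetOf_pow_mul hb]
      congr 1
      rw [eq_inv_iff_mul_eq_one, ← pow_succ, d.L_cube]
    rw [quot c hcn hc (τ' * a) (τ' * q₀) ?_, e, e2, h2]
    · simp only [smul_smul]
      congr 1
      rw [← mul_assoc d.L, d.L_tr, mul_assoc]
      congr 1
      rw [mul_inv_eq_iff_eq_mul, d.L_A_L]
    · rwa [e, nrm_mul, nrm_τ', one_mul]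

/-- If the norms of `a` and `c` differ, `0` is an admissible quotient for one of the two sides and
the other side unfolds to it. If they agree, both sides are divided with a unit quotient and
compared through `(T A)³ = 1`. -/
theorem A_smul_of_equivariant {n : ℕ} (ih : ∀ c, nrm c ≤ n → ∀ a, d.Equivariant a c) {a c : O3}
    (hc : nrm c ≤ n) (ha : nrm a ≤ n) (h0 : a ≠ 0 ∨ c ≠ 0) :
    d.A • d.cosetOf a c = d.cosetOf (-c) a := by
  have hneg : nrm (-1) = 1 := by rw [nrm_neg, nrm_one]
  rcases lt_trichotomy (nrm c) (nrm a) with h | h | h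
  · rw [(ih a ha (-c)).quotient 0 (by simpa using h), d.tr_zero, one_smul]
    simp
  · have hc0 : c ≠ 0 := by
      rintro rfl
      rw [nrm_zero, eq_comm, nrm_eq_zero] at h
      simp [h] at h0
    obtain ⟨δ, hδ, hlt⟩ := exists_unit_close a c hc0 h.symm
    have hb := ih (δ * c - a) (hlt.le.trans hc)
    obtain ⟨δ', h1, h2⟩ := A_smul_tr_smul_A_smul (d := d) hδ (c := c) hb
    have hδ' : nrm δ' = 1 := by
      have := congrArg nrm h1
      rwa [nrm_mul, hδ, mul_one, nrm_one] at this
    have e : -δ' * a - -c = δ' * (δ * c - a) := by linear_combination -c * h1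
    rw [(ih c hc a).quotient δ hlt, h2, (ih a ha (-c)).quotient (-δ') ?_, e]
    · congr 2
      rw [← (ih _ (by rw [nrm_mul, hδ', one_mul]; exact hlt.le.trans hc) a).scale δ hδ,
        ← mul_assoc, mul_comm δ δ', h1, one_mul]
      congr 1
      ring
    · rw [e, nrm_mul, hδ', one_mul, ← h]
      exact hlt
  · rw [(ih c hc a).quotient 0 (by simpa [nrm_neg] using h), d.tr_zero, one_smul, A_smul_A_smul]
    have h1 := (ih a ha (-c)).scale (-1) hneg
    simp only [neg_mul, one_mul, neg_neg] at h1
    simpa using h1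

theorem equivariant (a c : O3) : d.Equivariant a c := by
  have key : ∀ n : ℕ, ∀ c, nrm c = n → ∀ a, d.Equivariant a c := by
    intro n
    induction n using Nat.strong_induction_on with
    | _ n ih =>
      intro c hc a
      refine equivariant_of_lt hc (fun c h a => ih _ h c rfl a) ?_
      intro a c h1 h2 h0
      -- Norms below `n` are at most `n - 1`; the truncated case `n = 0` is excluded by `h1`.
      refine A_smul_of_equivariant (n := n - 1) ?_ (by omega) (by omega) h0
      exact fun c hc a => ih (nrm c) (by omega) c rfl a
  exact key _ c rfl a

theorem A_smul_cosetOf (a c : O3) (h0 : a ≠ 0 ∨ c ≠ 0) :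
    d.A • d.cosetOf a c = d.cosetOf (-c) a :=
  A_smul_of_equivariant (n := max (nrm c) (nrm a)) (fun c _ a => equivariant a c)
    (le_max_left _ _) (le_max_right _ _) h0

end CuspData

end Bianchi
end

noncomputable section
namespace Bianchi

/-! ### Generators of `SL(2, O₃)` and of `Bi(3)` -/

/-- The translation `[1 x; 0 1]`. -/
def matTr (x : O3) : SL(2, O3) := ⟨!![1, x; 0, 1], by simp [Matrix.det_fin_two_of]⟩

theorem SL_ext {n : ℕ} {R : Type*} [CommRing R] {M N : SL(n, R)}
    (h : (M : Matrix (Fin n) (Fin n) R) = (N : Matrix (Fin n) (Fin n) R)) : M = N :=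
  Subtype.ext h

theorem coe_matTr (x : O3) : (matTr x : Matrix (Fin 2) (Fin 2) O3) = !![1, x; 0, 1] := rfl

theorem coe_matT : (matT : Matrix (Fin 2) (Fin 2) O3) = !![1, 1; 0, 1] := rfl

theorem coe_matU : (matU : Matrix (Fin 2) (Fin 2) O3) = !![1, τ'; 0, 1] := rfl

theorem coe_matA : (matA : Matrix (Fin 2) (Fin 2) O3) = !![0, -1; 1, 0] := rfl

theorem coe_matL : (matL : Matrix (Fin 2) (Fin 2) O3) = !![τ' ^ 2, 0; 0, τ'] := rfl

theorem matTr_add (x y : O3) : matTr (x + y) = matTr x * matTr y := by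
  apply SL_ext
  rw [Matrix.SpecialLinearGroup.coe_mul]
  simp [coe_matTr, add_comm]

theorem matTr_zero : matTr 0 = 1 := by
  apply SL_ext
  simp [coe_matTr, Matrix.one_fin_two]

/-- The translations as a homomorphism. -/
def matTrHom : Multiplicative O3 →* SL(2, O3) where
  toFun x := matTr x.toAdd
  map_one' := matTr_zero
  map_mul' _ _ := matTr_add _ _

theorem matTr_coords (m n : ℤ) : matTr (m + n * τ') = matT ^ m * matU ^ n := by
  have h1 : matT = matTrHom (Multiplicative.ofAdd 1) := rfl
  have h2 : matU = matTrHom (Multiplicative.ofAdd τ') := rfl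
  rw [h1, h2, ← map_zpow matTrHom, ← map_zpow matTrHom, ← map_mul matTrHom, ← ofAdd_zsmul, ← ofAdd_zsmul, ← ofAdd_add]
  simp [matTrHom]

theorem matA_sq : matA * matA = -1 := by
  apply SL_ext
  rw [Matrix.SpecialLinearGroup.coe_mul, Matrix.SpecialLinearGroup.coe_neg]
  ext i j
  fin_cases i <;> fin_cases j <;> simp [coe_matA]

theorem matL_pow (k : ℕ) :
    ((matL ^ k : SL(2, O3)) : Matrix (Fin 2) (Fin 2) O3) = !![τ' ^ (2 * k), 0; 0, τ' ^ k] := by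
  rw [Matrix.SpecialLinearGroup.coe_pow]
  have : (matL : Matrix (Fin 2) (Fin 2) O3) = Matrix.diagonal ![τ' ^ 2, τ'] := by
    ext i j; fin_cases i <;> fin_cases j <;> simp [coe_matL]
  rw [this, Matrix.diagonal_pow]
  ext i j
  fin_cases i <;> fin_cases j <;> simp [pow_mul]

/-- `SL(2, O₃)` is generated by the four matrices. -/
theorem closure_eq_top : Subgroup.closure {matT, matU, matA, matL} = ⊤ := by
  set S := Subgroup.closure {matT, matU, matA, matL} with hS
  have hT : matT ∈ S := Subgroup.subset_closure (by simp)
  have hU : matU ∈ S := Subgroup.subset_closure (by simp)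
  have hA : matA ∈ S := Subgroup.subset_closure (by simp)
  have hL : matL ∈ S := Subgroup.subset_closure (by simp)
  have htr : ∀ x, matTr x ∈ S := by
    intro x
    obtain ⟨m, n, rfl⟩ := O3_exists_coords x
    rw [matTr_coords]
    exact mul_mem (zpow_mem hT m) (zpow_mem hU n)
  have hneg : (-1 : SL(2, O3)) ∈ S := matA_sq ▸ mul_mem hA hA
  have key : ∀ n : ℕ, ∀ M : SL(2, O3), nrm (M 1 0) = n → M ∈ S := by
    intro n
    induction n using Nat.strong_induction_on with
    | _ n ih =>
      intro M hM
      have hdet := M.2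
      rw [Matrix.det_fin_two] at hdet
      by_cases hc : M 1 0 = 0
      · have hc' : (M : Matrix (Fin 2) (Fin 2) O3) 1 0 = 0 := hc
        rw [hc', mul_zero, sub_zero] at hdet
        have hd : nrm ((M : Matrix (Fin 2) (Fin 2) O3) 1 1) = 1 := by
          have h := congrArg nrm hdet
          rw [nrm_mul, nrm_one] at h
          exact Nat.eq_one_of_mul_eq_one_left h
        obtain ⟨k, hk⟩ := eq_sixth_root_of_nrm_eq_one hd
        -- An upper triangular matrix of determinant one has unit diagonal entries, hence is, up to
        -- the sign `ε`, a translation times a power of `L`.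
        have hkey : ∀ ε : O3, ε * ε = 1 → (M : Matrix (Fin 2) (Fin 2) O3) 1 1 = ε * τ' ^ k →
            (M : Matrix (Fin 2) (Fin 2) O3) = ε • ((matTr (ε * τ' ^ (2 * k) *
              (M : Matrix (Fin 2) (Fin 2) O3) 0 1) * matL ^ k : SL(2, O3)) : Matrix (Fin 2) (Fin 2) O3) := by
          intro ε hε h
          have h3 : τ' ^ (2 * k) * τ' ^ k = 1 := by
            rw [← pow_add, show 2 * k + k = 3 * k by ring, pow_mul, τ'_cube, one_pow]
          rw [h] at hdet
          rw [Matrix.SpecialLinearGroup.coe_mul, matL_pow]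
          refine Matrix.ext fun i j => ?_
          fin_cases i <;> fin_cases j <;> simp [coe_matTr, h, hc']
          · linear_combination (ε * τ' ^ (2 * k)) * hdet -
              (M : Matrix (Fin 2) (Fin 2) O3) 0 0 * h3 * ε * ε -
              (M : Matrix (Fin 2) (Fin 2) O3) 0 0 * hε
          · linear_combination -(M : Matrix (Fin 2) (Fin 2) O3) 0 1 * h3 * ε * ε -
              (M : Matrix (Fin 2) (Fin 2) O3) 0 1 * hε
        rcases hk with hk | hk
        · have e := hkey 1 (by ring) (by rw [hk, one_mul])
          rw [one_smul] at e
          rw [SL_ext e]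
          exact mul_mem (htr _) (pow_mem hL k)
        · have e := hkey (-1) (by ring) (by rw [hk, neg_one_mul])
          rw [neg_one_smul] at e
          have e' : M = -1 * (matTr (-1 * τ' ^ (2 * k) *
              (M : Matrix (Fin 2) (Fin 2) O3) 0 1) * matL ^ k) := by
            rw [neg_one_mul]
            apply SL_ext
            rw [Matrix.SpecialLinearGroup.coe_neg]
            exact e
          rw [e']
          exact mul_mem hneg (mul_mem (htr _) (pow_mem hL k))
      · obtain ⟨q, hq⟩ := exists_quotient (M 0 0) (M 1 0) hc
        -- One Euclidean step on the first column: the new lower left entry is `q * c - a`, of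
        -- smaller norm.
        have h1 : matA⁻¹ * (matTr (-q) * M) ∈ S := by
          refine ih _ (hM ▸ hq) _ ?_
          rw [Matrix.SpecialLinearGroup.coe_mul, Matrix.SpecialLinearGroup.coe_mul, Matrix.SpecialLinearGroup.coe_inv]
          congr 1
          simp [coe_matA, coe_matTr, Matrix.adjugate_fin_two_of, Matrix.vecMul_eq_sum, Fin.sum_univ_two]
          ring
        have h2 : M = (matTr (-q))⁻¹ * (matA * (matA⁻¹ * (matTr (-q) * M))) := by group
        rw [h2]
        exact mul_mem (inv_mem (htr _)) (mul_mem hA h1)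
  rw [eq_top_iff]
  exact fun M _ => key _ M rfl

theorem closure_gen_eq_top : Subgroup.closure {genT, genU, genA, genL} = ⊤ := by
  have h := congrArg (Subgroup.map (QuotientGroup.mk' (Subgroup.center SL(2, O3)))) closure_eq_top
  rw [MonoidHom.map_closure, Subgroup.map_top_of_surjective _ (QuotientGroup.mk'_surjective _)]
    at h
  rw [← h]
  congr 1
  simp only [Set.image_insert_eq, Set.image_singleton]
  rfl

theorem hom_ext {G : Type*} [Group G] {φ ψ : Bi3 →* G} (hT : φ genT = ψ genT)
    (hU : φ genU = ψ genU) (hA : φ genA = ψ genA) (hL : φ genL = ψ genL) : φ = ψ := by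
  apply MonoidHom.eq_of_eqOn_dense closure_gen_eq_top
  rintro x (rfl | rfl | rfl | rfl) <;> assumption

theorem gen_induction {P : Bi3 → Prop} (hT : P genT) (hU : P genU) (hA : P genA) (hL : P genL)
    (one : P 1) (mul : ∀ x y, P x → P y → P (x * y)) (inv : ∀ x, P x → P x⁻¹) (g : Bi3) : P g := by
  have hg : g ∈ Subgroup.closure {genT, genU, genA, genL} := by
    rw [closure_gen_eq_top]; trivial
  induction hg using Subgroup.closure_induction with
  | mem x hx => rcases hx with rfl | rfl | rfl | rfl <;> assumption
  | one => exact one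
  | mul x y _ _ hx hy => exact mul x y hx hy
  | inv x _ hx => exact inv x hx

/-! ### Swan's relations -/

theorem mk_neg_one : ((-1 : SL(2, O3)) : Bi3) = 1 := by
  rw [QuotientGroup.eq_one_iff, Subgroup.mem_center_iff]
  intro g
  simp

theorem τ'_mul_pow_two : τ' * τ' ^ 2 = 1 := by linear_combination τ'_cube

theorem swan_gen : SwanRelations genT genU genA genL := by
  have key : ∀ M N : SL(2, O3), M = N → (M : Bi3) = (N : Bi3) := fun M N h => by rw [h]
  have neg : ∀ M N : SL(2, O3), M = -1 * N → (M : Bi3) = (N : Bi3) := fun M N h => by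
    rw [h, QuotientGroup.mk_mul, mk_neg_one, one_mul]
  have h3 := τ'_cube
  have h2 := τ'_sq
  refine ⟨?_, ?_, ?_, ?_, ?_, ?_, ?_, ?_⟩
  · rw [mul_inv_eq_one, mul_inv_eq_iff_eq_mul]
    refine key (matT * matU) (matU * matT) ?_
    change matTr 1 * matTr τ' = matTr τ' * matTr 1
    rw [← matTr_add, ← matTr_add, add_comm]
  · refine key (matL ^ 3) 1 ?_
    apply SL_ext
    rw [matL_pow, mul_comm, pow_mul, h3]
    simp [Matrix.one_fin_two]
  · refine neg ((matA * matL) ^ 2) 1 ?_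
    apply SL_ext
    rw [pow_two]
    simp only [Matrix.SpecialLinearGroup.coe_mul, Matrix.SpecialLinearGroup.coe_neg, Matrix.SpecialLinearGroup.coe_one,
      coe_matA, coe_matL]
    simp [Matrix.one_fin_two, τ'_mul_pow_two, τ'_pow_two_mul]
  · refine neg (matA ^ 2) 1 ?_
    rw [pow_two, matA_sq, mul_one]
  · refine neg ((matT * matA) ^ 3) 1 ?_
    apply SL_ext
    rw [pow_three]
    simp only [Matrix.SpecialLinearGroup.coe_mul, Matrix.SpecialLinearGroup.coe_neg, Matrix.SpecialLinearGroup.coe_one,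
      coe_matA, coe_matT]
    simp [Matrix.one_fin_two]
  · refine neg ((matU * matA * matL) ^ 3) 1 ?_
    apply SL_ext
    rw [pow_three]
    simp only [Matrix.SpecialLinearGroup.coe_mul, Matrix.SpecialLinearGroup.coe_neg,
      Matrix.SpecialLinearGroup.coe_one, coe_matA, coe_matU, coe_matL]
    simp [Matrix.one_fin_two, τ'_mul_pow_two, τ'_pow_two_mul]
  · rw [mul_assoc, inv_mul_eq_iff_eq_mul]
    refine key (matU * matL) (matL * matT) ?_
    apply SL_ext
    simp only [Matrix.SpecialLinearGroup.coe_mul, coe_matT, coe_matU, coe_matL]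
    simp [pow_two]
  · rw [mul_assoc, inv_mul_eq_iff_eq_mul, ← mul_assoc, eq_mul_inv_iff_mul_eq,
      eq_mul_inv_iff_mul_eq]
    refine key (matT * matL * matU * matT) matL ?_
    apply SL_ext
    simp only [Matrix.SpecialLinearGroup.coe_mul, coe_matT, coe_matU, coe_matL]
    simp [τ'_pow_two_mul]
    linear_combination h2

/-- The first coordinate of an Eisenstein integer in the basis `1, τ`. -/
def coordOne (x : O3) : ℤ := (O3_exists_coords x).choose

/-- The second coordinate of an Eisenstein integer in the basis `1, τ`. -/
def coordτ (x : O3) : ℤ := (O3_exists_coords x).choose_spec.choose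

theorem coords_spec (x : O3) : x = coordOne x + coordτ x * τ' :=
  (O3_exists_coords x).choose_spec.choose_spec

theorem coords_eq {x : O3} {m n : ℤ} (h : x = m + n * τ') : coordOne x = m ∧ coordτ x = n :=
  coords_injective ((coords_spec x).symm.trans h)

/-- The data for the Euclidean algorithm in a group whose elements satisfy Swan's relations. -/
def CuspData.ofSwan {G : Type*} [Group G] {T U A L : G} (h : SwanRelations T U A L) :
    CuspData G := by
  have hTU : Commute T U := by
    have := h.1
    rwa [mul_inv_eq_one, mul_inv_eq_iff_eq_mul] at this
  have hA : A * A = 1 := by rw [← pow_two, h.2.2.2.1]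
  have hLT : L * T * L⁻¹ = U := by rw [← h.2.2.2.2.2.2.1]; group
  have hLU : L * U * L⁻¹ = T⁻¹ * U⁻¹ := by
    have h8 := h.2.2.2.2.2.2.2
    have h7 := h.2.2.2.2.2.2.1
    have : U = L⁻¹ * (T⁻¹ * U⁻¹) * L := by
      calc U = (T⁻¹ * U⁻¹)⁻¹ * T⁻¹ := by rw [_root_.mul_inv_rev, inv_inv, inv_inv]; group
        _ = (L⁻¹ * T * L)⁻¹ * (L⁻¹ * U * L)⁻¹ := by rw [h8, h7]
        _ = L⁻¹ * (T⁻¹ * U⁻¹) * L := by group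
    calc L * U * L⁻¹ = L * (L⁻¹ * (T⁻¹ * U⁻¹) * L) * L⁻¹ := congrArg (fun x => L * x * L⁻¹) this
      _ = _ := by group
  exact
  { tr := fun x => T ^ coordOne x * U ^ coordτ x
    A := A
    L := L
    tr_add := by
      intro x y
      have e : x + y = (coordOne x + coordOne y : ℤ) + (coordτ x + coordτ y : ℤ) * τ' := by
        nth_rewrite 1 [coords_spec x, coords_spec y]
        push_cast
        ring
      obtain ⟨h1, h2⟩ := coords_eq e
      rw [h1, h2, _root_.zpow_add, _root_.zpow_add]
      have := (hTU.zpow_zpow (coordOne y) (coordτ x)).eq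
      rw [mul_assoc, mul_assoc, ← mul_assoc (T ^ coordOne y), this, mul_assoc]
    L_tr := by
      intro x
      have e : τ' * x = (-coordτ x : ℤ) + (coordOne x - coordτ x : ℤ) * τ' := by
        nth_rewrite 1 [coords_spec x]
        push_cast
        linear_combination (coordτ x : O3) * τ'_sq
      obtain ⟨h1, h2⟩ := coords_eq e
      rw [h1, h2, ← mul_inv_eq_iff_eq_mul]
      calc L * (T ^ coordOne x * U ^ coordτ x) * L⁻¹
          = (L * T ^ coordOne x * L⁻¹) * (L * U ^ coordτ x * L⁻¹) := by group
        _ = U ^ coordOne x * (T⁻¹ * U⁻¹) ^ coordτ x := by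
          rw [← conj_zpow, ← conj_zpow, hLT, hLU]
        _ = _ := by
          rw [(hTU.inv_inv).mul_zpow, _root_.inv_zpow', _root_.inv_zpow', ← mul_assoc,
            ← (hTU.zpow_zpow _ _).eq, mul_assoc, ← _root_.zpow_add, sub_eq_add_neg]
    A_sq := hA
    L_cube := h.2.1
    L_A_L := by
      have h3 := h.2.2.1
      rw [pow_two, mul_assoc, ← mul_assoc L] at h3
      rw [eq_inv_of_mul_eq_one_right h3, inv_eq_of_mul_eq_one_left hA]
    A_tr_one := by
      obtain ⟨h1, h2⟩ := coords_eq (show (1 : O3) = (1 : ℤ) + (0 : ℤ) * τ' by simp)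
      obtain ⟨h1', h2'⟩ := coords_eq (show (-1 : O3) = (-1 : ℤ) + (0 : ℤ) * τ' by simp)
      have h5 := h.2.2.2.2.1
      rw [h1, h2, h1', h2']
      simp only [zpow_one, zpow_zero, mul_one, _root_.zpow_neg]
      have hAi : A⁻¹ = A := inv_eq_of_mul_eq_one_left hA
      have : A * T * A = T⁻¹ * ((T * A) ^ 3) * A⁻¹ * T⁻¹ := by rw [pow_three]; group
      rw [this, h5, hAi, mul_one] }

theorem CuspData.ofSwan_tr {G : Type*} [Group G] {T U A L : G} (h : SwanRelations T U A L)
    (x : O3) : (CuspData.ofSwan h).tr x = T ^ coordOne x * U ^ coordτ x := rfl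

theorem CuspData.ofSwan_A {G : Type*} [Group G] {T U A L : G} (h : SwanRelations T U A L) :
    (CuspData.ofSwan h).A = A := rfl

theorem CuspData.ofSwan_L {G : Type*} [Group G] {T U A L : G} (h : SwanRelations T U A L) :
    (CuspData.ofSwan h).L = L := rfl

theorem SL2_mul_vec_ne_zero (M : SL(2, O3)) {a c : O3} (h : a ≠ 0 ∨ c ≠ 0) :
    M 0 0 * a + M 0 1 * c ≠ 0 ∨ M 1 0 * a + M 1 1 * c ≠ 0 := by
  by_contra! hcon
  obtain ⟨h1, h2⟩ := hcon
  have hdet := M.det_coe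
  rw [Matrix.det_fin_two] at hdet
  have ha : a = 0 := by linear_combination -a * hdet + M 1 1 * h1 - M 0 1 * h2
  have hc : c = 0 := by linear_combination -c * hdet + M 0 0 * h2 - M 1 0 * h1
  simp [ha, hc] at h

/-- The relations define `Bi(3)`: elements satisfying them are the images of the generators under
a homomorphism. -/
theorem exists_hom_of_swan {G : Type*} [Group G] {T U A L : G} (h : SwanRelations T U A L) :
    ∃ φ : Bi3 →* G, φ genT = T ∧ φ genU = U ∧ φ genA = A ∧ φ genL = L := by
  have hs := swan_gen
  -- The homomorphism is obtained through its graph: the relations hold for the pairs, and the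
  -- subgroup they generate will be shown to project isomorphically onto `Bi(3)`.
  have h' : SwanRelations (G := G × Bi3) (T, genT) (U, genU) (A, genA) (L, genL) := by
    obtain ⟨a1, a2, a3, a4, a5, a6, a7, a8⟩ := h
    obtain ⟨b1, b2, b3, b4, b5, b6, b7, b8⟩ := hs
    exact ⟨Prod.ext a1 b1, Prod.ext a2 b2, Prod.ext a3 b3, Prod.ext a4 b4, Prod.ext a5 b5,
      Prod.ext a6 b6, Prod.ext a7 b7, Prod.ext a8 b8⟩
  set d := CuspData.ofSwan h' with hd
  have trT : d.tr 1 = (T, genT) := by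
    obtain ⟨h1, h2⟩ := coords_eq (show (1 : O3) = (1 : ℤ) + (0 : ℤ) * τ' by simp)
    rw [hd, CuspData.ofSwan_tr, h1, h2, zpow_one, zpow_zero, mul_one]
  have trU : d.tr τ' = (U, genU) := by
    obtain ⟨h1, h2⟩ := coords_eq (show τ' = (0 : ℤ) + (1 : ℤ) * τ' by simp)
    rw [hd, CuspData.ofSwan_tr, h1, h2, zpow_one, zpow_zero, one_mul]
  have tr_snd : ∀ x, (d.tr x).2 = (matTr x : Bi3) := by
    intro x
    rw [hd, CuspData.ofSwan_tr]
    nth_rewrite 3 [coords_spec x]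
    rw [matTr_coords]
    rfl
  set S : Subgroup (G × Bi3) := Subgroup.closure {(T, genT), (U, genU), (A, genA), (L, genL)}
    with hS
  -- the cosets are permuted by `S` in the same way as the vectors by `SL(2, O₃)`
  have key : ∀ γ ∈ S, ∃ M : SL(2, O3), (M : Bi3) = γ.2 ∧ ∀ a c : O3, (a ≠ 0 ∨ c ≠ 0) →
      d.cosetOf (M 0 0 * a + M 0 1 * c) (M 1 0 * a + M 1 1 * c) = γ • d.cosetOf a c := by
    have htr : ∀ x a c, d.cosetOf (a + x * c) c = d.tr x • d.cosetOf a c := fun x a c =>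
      CuspData.cosetOf_add_mul (fun a => CuspData.equivariant a c) x
    intro γ hγ
    induction hγ using Subgroup.closure_induction with
    | mem γ hγ =>
      rcases hγ with rfl | rfl | rfl | rfl
      · refine ⟨matT, rfl, fun a c _ => ?_⟩
        rw [← trT, ← htr]
        simp [coe_matT]
      · refine ⟨matU, rfl, fun a c _ => ?_⟩
        rw [← trU, ← htr]
        simp [coe_matU]
      · refine ⟨matA, rfl, fun a c h0 => ?_⟩
        have := CuspData.A_smul_cosetOf (d := d) a c h0
        rw [← CuspData.ofSwan_A h', ← hd, this]
        simp [coe_matA]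
      · refine ⟨matL, rfl, fun a c h0 => ?_⟩
        have := (CuspData.equivariant (d := d) a c).rotate
        rw [← CuspData.ofSwan_L h', ← hd, ← this,
          ← (CuspData.equivariant (d := d) (τ' * a) c).scale _ nrm_τ']
        simp [coe_matL, pow_two, mul_assoc]
    | one =>
      refine ⟨1, rfl, fun a c _ => ?_⟩
      simp
    | mul γ γ' _ _ ih ih' =>
      obtain ⟨M, h1, h2⟩ := ih
      obtain ⟨M', h1', h2'⟩ := ih'
      refine ⟨M * M', by rw [QuotientGroup.mk_mul, h1, h1']; rfl, fun a c h0 => ?_⟩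
      rw [mul_smul, ← h2' a c h0, ← h2]
      · simp only [Matrix.SpecialLinearGroup.coe_mul, Matrix.mul_apply, Fin.sum_univ_two]
        congr 1 <;> ring
      · exact SL2_mul_vec_ne_zero M' h0
    | inv γ _ ih =>
      obtain ⟨M, h1, h2⟩ := ih
      refine ⟨M⁻¹, by rw [QuotientGroup.mk_inv, h1]; rfl, fun a c h0 => ?_⟩
      rw [eq_inv_smul_iff, ← h2 _ _ (SL2_mul_vec_ne_zero M⁻¹ h0)]
      have hdet := M.det_coe
      rw [Matrix.det_fin_two] at hdet
      rw [Matrix.SpecialLinearGroup.coe_inv, Matrix.adjugate_fin_two]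
      simp only [Matrix.of_apply, Matrix.cons_val_zero, Matrix.cons_val_one,
        Matrix.cons_val', Matrix.cons_val_fin_one]
      congr 1
      · linear_combination a * hdet
      · linear_combination c * hdet
  -- Over the identity the lift `M` is scalar, so `γ` fixes the coset of `(1, 0)` and lies in `B`.
  -- There it equals `tr x * L ^ k`, and its second component forces `x = 0` and `3 ∣ k`.
  have ker : ∀ γ ∈ S, γ.2 = 1 → γ = 1 := by
    intro γ hγ h1
    obtain ⟨M, hM, hc⟩ := key γ hγ
    have hM1 : M 1 0 = 0 := by
      rw [h1, QuotientGroup.eq_one_iff, Matrix.SpecialLinearGroup.mem_center_iff] at hM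
      obtain ⟨r, -, hr⟩ := hM
      rw [← hr]
      simp
    have hB : γ ∈ d.B := by
      have := hc 1 0 (Or.inl one_ne_zero)
      simp only [mul_one, mul_zero, add_zero, hM1, CuspData.cosetOf_zero] at this
      rw [MulAction.Quotient.smul_coe, smul_eq_mul, mul_one, QuotientGroup.eq, inv_one,
        one_mul] at this
      exact this
    obtain ⟨x, k, rfl⟩ := d.exists_of_mem_B hB
    have hL2 : d.L.2 = (matL : Bi3) := rfl
    rw [Prod.snd_mul, Prod.pow_snd, tr_snd, hL2, ← QuotientGroup.mk_pow, ← QuotientGroup.mk_mul,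
      QuotientGroup.eq_one_iff, Matrix.SpecialLinearGroup.mem_center_iff] at h1
    obtain ⟨r, -, hr⟩ := h1
    rw [Matrix.SpecialLinearGroup.coe_mul, matL_pow, coe_matTr] at hr
    have e00 := congrFun (congrFun hr 0) 0
    have e01 := congrFun (congrFun hr 0) 1
    have e11 := congrFun (congrFun hr 1) 1
    simp only [Matrix.scalar_apply, Matrix.diagonal_apply_eq, Matrix.mul_apply, Fin.sum_univ_two,
      Matrix.of_apply, Matrix.cons_val_zero, Matrix.cons_val_one, Matrix.cons_val',
      Matrix.cons_val_fin_one, one_mul, mul_zero, add_zero, zero_add,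
      Matrix.diagonal_apply_ne _ (show (0 : Fin 2) ≠ 1 by decide)] at e00 e01 e11
    have h3k : τ' ^ (3 * k) = 1 := by rw [pow_mul, τ'_cube, one_pow]
    have hx : x = 0 := by
      have h5 : x * τ' ^ (3 * k) = 0 := by
        rw [show 3 * k = k + 2 * k by ring, pow_add, ← mul_assoc, ← e01, zero_mul]
      rwa [h3k, mul_one] at h5
    have hk : τ' ^ k = 1 := by
      rw [show 3 * k = k + 2 * k by ring, pow_add, ← e00, e11] at h3k
      calc τ' ^ k = τ' ^ (2 * k) := by rw [← e00, e11]
        _ = τ' ^ k * τ' ^ k := by rw [two_mul, pow_add]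
        _ = 1 := h3k
    have hk' : τ ^ k = 1 := by
      have := congrArg (fun x : O3 => (x : ℂ)) hk
      simpa [coe_τ'] using this
    obtain ⟨l, rfl⟩ := τ_isPrimitiveRoot.dvd_of_pow_eq_one k hk'
    rw [hx, d.tr_zero, pow_mul, d.L_cube, one_pow, one_mul]
  let π : S →* Bi3 := (MonoidHom.snd G Bi3).comp S.subtype
  have hπ : Function.Bijective π := by
    constructor
    · rw [injective_iff_map_eq_one]
      exact fun γ hγ => Subtype.ext (ker γ.1 γ.2 hγ)
    · rw [← MonoidHom.range_eq_top, eq_top_iff, ← closure_gen_eq_top, Subgroup.closure_le]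
      have hmem : ∀ γ ∈ ({(T, genT), (U, genU), (A, genA), (L, genL)} : Set (G × Bi3)),
          γ.2 ∈ π.range := fun γ hγ => ⟨⟨γ, Subgroup.subset_closure hγ⟩, rfl⟩
      rintro x (rfl | rfl | rfl | rfl)
      · exact hmem (T, genT) (by simp)
      · exact hmem (U, genU) (by simp)
      · exact hmem (A, genA) (by simp)
      · exact hmem (L, genL) (by simp)
  let e := MulEquiv.ofBijective π hπ
  have he : ∀ γ ∈ ({(T, genT), (U, genU), (A, genA), (L, genL)} : Set (G × Bi3)),
      ((MonoidHom.fst G Bi3).comp (S.subtype.comp e.symm.toMonoidHom)) γ.2 = γ.1 := by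
    intro γ hγ
    have h1 : e.symm γ.2 = ⟨γ, Subgroup.subset_closure hγ⟩ := by
      rw [MulEquiv.symm_apply_eq]
      rfl
    change (e.symm γ.2).1.1 = γ.1
    rw [h1]
  exact ⟨(MonoidHom.fst G Bi3).comp (S.subtype.comp e.symm.toMonoidHom),
    he (T, genT) (by simp), he (U, genU) (by simp), he (A, genA) (by simp),
    he (L, genL) (by simp)⟩

end Bianchi
end

noncomputable section
namespace Bianchi

/-! ### The matrices `ρ_u` satisfy Swan's relations -/

section Relations

theorem one_add_ne_zero {u : ℂ} (h1 : u ≠ -1) : 1 + u ≠ 0 := fun h => h1 (by linear_combination h)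

theorem add_sq_eq (u : ℂ) : u + u ^ 2 = u * (1 + u) := by ring

theorem sq_add_cube_eq (u : ℂ) : u ^ 2 + u ^ 3 = u ^ 2 * (1 + u) := by ring

theorem det_rhoT (u : ℂ) : (rhoT u).det = 1 := by
  simp [rhoT, Matrix.det_succ_row_zero, Fin.sum_univ_succ, Fin.succAbove]

theorem det_rhoA (u : ℂ) : (rhoA u).det = 1 := by
  simp [rhoA, Matrix.det_succ_row_zero, Fin.sum_univ_succ, Fin.succAbove]

theorem rhoA_mul_rhoA (u : ℂ) : rhoA u * rhoA u = 1 := by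
  ext i j
  fin_cases i <;> fin_cases j <;> simp [rhoA, Matrix.mul_apply, Fin.sum_univ_four]

variable {u : ℂ}

theorem det_rhoU (h0 : u ≠ 0) (h1 : u ≠ -1) : (rhoU u).det = 1 := by
  have h2 := one_add_ne_zero h1
  simp [rhoU, Matrix.det_succ_row_zero, Fin.sum_univ_succ, Fin.succAbove]
  field_simp
  ring

theorem det_rhoL (h0 : u ≠ 0) (h1 : u ≠ -1) : (rhoL u).det = 1 := by
  have h2 := one_add_ne_zero h1
  simp [rhoL, Matrix.det_succ_row_zero, Fin.sum_univ_succ, Fin.succAbove]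
  field_simp
  ring

theorem rhoT_mul_rhoU (h0 : u ≠ 0) (h1 : u ≠ -1) : rhoT u * rhoU u = rhoU u * rhoT u := by
  have h2 := one_add_ne_zero h1
  ext i j
  fin_cases i <;> fin_cases j <;>
    simp [rhoT, rhoU, Matrix.mul_apply, Fin.sum_univ_four, add_sq_eq, sq_add_cube_eq] <;>
    field_simp <;> ring

/-- Intermediate products are tabulated in simplified form, so that each relation reduces to one
entrywise product of explicit matrices. -/
theorem rhoA_mul_rhoL (h0 : u ≠ 0) (h1 : u ≠ -1) : rhoA u * rhoL u =
    !![(-1 + u) / (1 + u), -(u ^ 2 / (1 + u)), u / (1 + u), -(u ^ 2 / (1 + u));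
       -(2 / (u * (1 + u))), -(u / (1 + u)), 1 / (1 + u), 1 / (1 + u);
       0, 0, 1, 0;
       -(2 / (u * (1 + u))), 1 / (1 + u), 1 / (1 + u), -(u / (1 + u))] := by
  have h2 := one_add_ne_zero h1
  ext i j
  fin_cases i <;> fin_cases j <;>
    simp [rhoL, rhoA, Matrix.mul_apply, Fin.sum_univ_four, add_sq_eq] <;> field_simp <;> ring

theorem rhoA_rhoL_rhoA_rhoL (h0 : u ≠ 0) (h1 : u ≠ -1) :
    rhoA u * rhoL u * (rhoA u * rhoL u) = 1 := by
  have h2 := one_add_ne_zero h1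
  rw [rhoA_mul_rhoL h0 h1]
  ext i j
  fin_cases i <;> fin_cases j <;>
    simp [Matrix.mul_apply, Fin.sum_univ_four] <;> field_simp <;> ring

theorem rhoL_mul_rhoL (h0 : u ≠ 0) (h1 : u ≠ -1) :
    rhoL u * rhoL u = rhoA u * rhoL u * rhoA u := by
  have h2 := one_add_ne_zero h1
  rw [rhoA_mul_rhoL h0 h1]
  ext i j
  fin_cases i <;> fin_cases j <;>
    simp [rhoL, rhoA, Matrix.mul_apply, Fin.sum_univ_four, add_sq_eq] <;> field_simp <;> ring

theorem rhoL_mul_rhoL_mul_rhoL (h0 : u ≠ 0) (h1 : u ≠ -1) : rhoL u * rhoL u * rhoL u = 1 := by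
  rw [rhoL_mul_rhoL h0 h1, mul_assoc, rhoA_rhoL_rhoA_rhoL h0 h1]

theorem rhoU_mul_rhoL (h0 : u ≠ 0) (h1 : u ≠ -1) : rhoU u * rhoL u = rhoL u * rhoT u := by
  have h2 := one_add_ne_zero h1
  ext i j
  fin_cases i <;> fin_cases j <;>
    simp [rhoL, rhoU, rhoT, Matrix.mul_apply, Fin.sum_univ_four, add_sq_eq, sq_add_cube_eq] <;>
    field_simp <;> ring

theorem rhoT_mul_rhoL_eq (h0 : u ≠ 0) (h1 : u ≠ -1) : rhoT u * rhoL u =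
    !![(-1 + u) / (1 + u), -(u ^ 2 / (1 + u)), u / (1 + u), -(u ^ 2 / (1 + u));
       0, 0, 1, 0;
       -(2 / (u * (1 + u))), 1 / (1 + u), 1 / (1 + u), -(u / (1 + u));
       -(2 / (u * (1 + u))), -(u / (1 + u)), 1 / (1 + u), 1 / (1 + u)] := by
  have h2 := one_add_ne_zero h1
  ext i j
  fin_cases i <;> fin_cases j <;>
    simp [rhoL, rhoT, Matrix.mul_apply, Fin.sum_univ_four, add_sq_eq] <;> field_simp <;> ring

theorem rhoU_mul_rhoT_eq (h0 : u ≠ 0) (h1 : u ≠ -1) : rhoU u * rhoT u =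
    !![1 + u, 0, 0, -u;
       -((2 + u + u ^ 2) / (u ^ 2 * (1 + u))), (1 + u + u ^ 2) / (u * (1 + u)), -(1 / (1 + u)),
         1 / (u * (1 + u));
       -(2 / (u * (1 + u))), 1 / (1 + u), 1 / (1 + u), -(u / (1 + u));
       1, 0, 0, 0] := by
  have h2 := one_add_ne_zero h1
  ext i j
  fin_cases i <;> fin_cases j <;>
    simp [rhoU, rhoT, Matrix.mul_apply, Fin.sum_univ_four, add_sq_eq, sq_add_cube_eq] <;>
    field_simp <;> ring

theorem rhoT_mul_rhoL (h0 : u ≠ 0) (h1 : u ≠ -1) :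
    rhoT u * rhoL u * (rhoU u * rhoT u) = rhoL u := by
  have h2 := one_add_ne_zero h1
  rw [rhoT_mul_rhoL_eq h0 h1, rhoU_mul_rhoT_eq h0 h1]
  ext i j
  fin_cases i <;> fin_cases j <;>
    simp [rhoL, Matrix.mul_apply, Fin.sum_univ_four, add_sq_eq] <;> field_simp <;> ring

theorem rhoT_mul_rhoA (u : ℂ) :
    rhoT u * rhoA u = !![1, 0, 0, 0; 0, 0, 1, 0; 0, 0, 0, 1; 0, 1, 0, 0] := by
  ext i j
  fin_cases i <;> fin_cases j <;> simp [rhoA, rhoT, Matrix.mul_apply, Fin.sum_univ_four]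

theorem rhoT_rhoA_rhoT (u : ℂ) :
    rhoT u * rhoA u * rhoT u * (rhoA u * rhoT u * rhoA u) = 1 := by
  have e : rhoT u * rhoA u * rhoT u * (rhoA u * rhoT u * rhoA u) =
      rhoT u * rhoA u * (rhoT u * rhoA u) * (rhoT u * rhoA u) := by simp only [mul_assoc]
  rw [e, rhoT_mul_rhoA]
  ext i j
  fin_cases i <;> fin_cases j <;> simp [Matrix.mul_apply, Fin.sum_univ_four]

end Relations

/-- The hypotheses are free of inverses, hence directly checkable on explicit matrices. The relation
`(U A L)³ = 1` is deduced from the others. -/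
theorem swan_of_relations {G : Type*} [Group G] {T U A L : G} (hTU : T * U = U * T)
    (hL : L * L * L = 1) (hAL : L * L = A * L * A) (hA : A * A = 1)
    (hTA : T * A * T * (A * T * A) = 1) (hUL : U * L = L * T) (hTL : T * L * (U * T) = L) :
    SwanRelations T U A L := by
  have hTA3 : (T * A) ^ 3 = 1 := by rw [← hTA, pow_three]; group
  have hAi : A⁻¹ = A := inv_eq_of_mul_eq_one_left hA
  have hLAL : L * A * L = A := by
    have : L * (A * L * A) * A = A := by rw [← hAL, ← mul_assoc, hL, one_mul]
    rwa [← mul_assoc, mul_assoc _ A A, hA, mul_one, ← mul_assoc] at this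
  have hUL' : L⁻¹ * U * L = T := by rw [mul_assoc, hUL, inv_mul_cancel_left]
  have hTL' : L⁻¹ * T * L = T⁻¹ * U⁻¹ := by
    rw [← _root_.mul_inv_rev, eq_inv_iff_mul_eq_one, mul_assoc, mul_assoc, ← mul_assoc T, hTL,
      inv_mul_cancel]
  refine ⟨?_, ?_, ?_, ?_, hTA3, ?_, hUL', hTL'⟩
  · rw [hTU]; group
  · rw [pow_three, ← mul_assoc, hL]
  · rw [pow_two, mul_assoc, ← mul_assoc L, hLAL, hA]
  · rw [pow_two, hA]
  · have hATA : A * T * A = T⁻¹ * A * T⁻¹ := by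
      have : A * T * A = (T * A * T)⁻¹ * (T * A * T * (A * T * A)) := by group
      rw [this, hTA, mul_one, _root_.mul_inv_rev, _root_.mul_inv_rev, hAi, ← mul_assoc]
    have hLA : A * L⁻¹ = L * A := by rw [mul_inv_eq_iff_eq_mul, hLAL]
    have hLi : L⁻¹ * L⁻¹ = L := by rw [← _root_.mul_inv_rev, inv_eq_iff_mul_eq_one, hL]
    have hU : U = L * T * L⁻¹ := by rw [← hUL]; group
    -- This is `A T A = T⁻¹ A T⁻¹` conjugated by `L`, which carries `T` to `U`.
    have e1 : A * (L⁻¹ * T * L) * A = U⁻¹ * (L * A * L⁻¹) * U⁻¹ := by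
      calc A * (L⁻¹ * T * L) * A = (A * L⁻¹) * T * (L * A) := by group
        _ = (L * A) * T * (A * L⁻¹) := by rw [hLA]
        _ = L * (A * T * A) * L⁻¹ := by group
        _ = _ := by rw [hATA, hU]; group
    have e2 : L * U * L⁻¹ = L⁻¹ * T * L := by
      calc L * U * L⁻¹ = (L⁻¹ * L⁻¹) * U * (L⁻¹ * L⁻¹)⁻¹ := by rw [hLi]
        _ = L⁻¹ * (L⁻¹ * (U * L)) * L := by simp only [_root_.mul_inv_rev, inv_inv, mul_assoc]
        _ = L⁻¹ * T * L := by rw [hUL]; group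
    calc (U * A * L) ^ 3 = U * A * (L * U * L⁻¹) * (L * A) * (L * U) * A * L := by
          rw [pow_three]; group
      _ = U * (A * (L⁻¹ * T * L) * A) * (L⁻¹ * L * U * A * L) := by rw [e2, ← hLA]; group
      _ = L * A * (L⁻¹ * A * L) := by rw [e1]; group
      _ = L * (A * L⁻¹) * (A * L) := by group
      _ = L * L * (A * A) * L := by rw [hLA]; group
      _ = 1 := by rw [hA, mul_one, hL]

theorem exists_swan {u : ℂ} (h0 : u ≠ 0) (h1 : u ≠ -1) : ∃ t v a l : SL(4, ℂ),
    (t : Matrix (Fin 4) (Fin 4) ℂ) = rhoT u ∧ (v : Matrix (Fin 4) (Fin 4) ℂ) = rhoU u ∧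
    (a : Matrix (Fin 4) (Fin 4) ℂ) = rhoA u ∧ (l : Matrix (Fin 4) (Fin 4) ℂ) = rhoL u ∧
    SwanRelations t v a l := by
  refine ⟨⟨rhoT u, det_rhoT u⟩, ⟨rhoU u, det_rhoU h0 h1⟩, ⟨rhoA u, det_rhoA u⟩,
    ⟨rhoL u, det_rhoL h0 h1⟩, rfl, rfl, rfl, rfl, swan_of_relations ?_ ?_ ?_ ?_ ?_ ?_ ?_⟩
  · exact SL_ext (rhoT_mul_rhoU h0 h1)
  · exact SL_ext (rhoL_mul_rhoL_mul_rhoL h0 h1)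
  · exact SL_ext (rhoL_mul_rhoL h0 h1)
  · exact SL_ext (rhoA_mul_rhoA u)
  · exact SL_ext (rhoT_rhoA_rhoT u)
  · exact SL_ext (rhoU_mul_rhoL h0 h1)
  · exact SL_ext (rhoT_mul_rhoL h0 h1)

theorem existsUnique_rho {u : ℂ} (h0 : u ≠ 0) (h1 : u ≠ -1) : ∃! ρ : Bi3 →* SL(4, ℂ), IsRho u ρ := by
  obtain ⟨t, v, a, l, ht, hv, ha, hl, hs⟩ := exists_swan h0 h1
  obtain ⟨φ, hT, hU, hA, hL⟩ := exists_hom_of_swan hs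
  refine ⟨φ, ⟨by rw [hT, ht], by rw [hU, hv], by rw [hA, ha], by rw [hL, hl]⟩, ?_⟩
  rintro ψ ⟨h2, h3, h4, h5⟩
  refine hom_ext (SL_ext ?_) (SL_ext ?_) (SL_ext ?_) (SL_ext ?_)
  · rw [h2, hT, ht]
  · rw [h3, hU, hv]
  · rw [h4, hA, ha]
  · rw [h5, hL, hl]

/-- The trace of `ρ_u(T)` is `2 + u + 1/u`, which determines `u` up to inversion. -/
theorem not_areConjugate {u u' : ℂ} (h0 : u ≠ 0) (h0' : u' ≠ 0) (hne : u' ≠ u)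
    (hne' : u' ≠ 1 / u) {ρ ρ' : Bi3 →* SL(4, ℂ)} (hρ : IsRho u ρ) (hρ' : IsRho u' ρ') :
    ¬ AreConjugate ρ ρ' := by
  rintro ⟨P, hP⟩
  have h := congrArg Matrix.trace (hP genT)
  rw [hρ.1, hρ'.1, Matrix.trace_mul_comm, ← mul_assoc, ← Units.val_mul, inv_mul_cancel,
    Units.val_one, one_mul] at h
  simp [Matrix.trace, Fin.sum_univ_four, rhoT] at h
  have h3 : (u' - u) * (u' * u - 1) = 0 := by
    field_simp at h
    linear_combination -h
  rcases mul_eq_zero.1 h3 with h4 | h4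
  · exact hne (by linear_combination h4)
  · exact hne' (by field_simp; linear_combination h4)

end Bianchi
end

noncomputable section
namespace Bianchi

/-! ### A common eigenbasis of `ρ_u(T)` and `ρ_u(U)` -/

/-- Columns: a basis of common eigenvectors of `ρ_u(T)` and `ρ_u(U)`. -/
def eigQ (u : ℂ) : Matrix (Fin 4) (Fin 4) ℂ :=
  !![u ^ 2 / (u - 1), 0, 0, u * (1 - u);
     -(u * (2 + u ^ 2)) / (u - 1) ^ 2, u, u, 1;
     -(u * (2 + u ^ 2)) / (u - 1) ^ 2, 1, u ^ 2, 1;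
     u ^ 2 / (u - 1), 0, 0, 1 - u]

/-- `ρ_u(T)` in the eigenbasis. -/
def eigT (u : ℂ) : Fin 4 → ℂ := ![1, u, u⁻¹, 1]

/-- `ρ_u(U)` in the eigenbasis. -/
def eigU (u : ℂ) : Fin 4 → ℂ := ![1, u⁻¹, 1, u]

/-- `ρ_u(L)` in the eigenbasis. -/
def eigL : Matrix (Fin 4) (Fin 4) ℂ := !![1, 0, 0, 0; 0, 0, 1, 0; 0, 0, 0, 1; 0, 1, 0, 0]

/-- `ρ_u(A)` in the eigenbasis, for `a = -(u² + u + 1) / (u - 1)²`. -/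
def eigA (a : ℂ) : Matrix (Fin 4) (Fin 4) ℂ :=
  !![a, 1, 1, 1;
     (1 - a ^ 2) / 3, -(a + 1) / 3, (2 - a) / 3, -(a + 1) / 3;
     (1 - a ^ 2) / 3, (2 - a) / 3, -(a + 1) / 3, -(a + 1) / 3;
     (1 - a ^ 2) / 3, -(a + 1) / 3, -(a + 1) / 3, (2 - a) / 3]

section Eigenbasis

variable {u : ℂ}

theorem det_eigQ (h1' : u ≠ 1) : (eigQ u).det = u ^ 3 * (u - 1) ^ 2 * (1 + u) := by
  have h3 : u - 1 ≠ 0 := sub_ne_zero.2 h1'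
  simp [eigQ, Matrix.det_succ_row_zero, Fin.sum_univ_succ, Fin.succAbove]
  field_simp
  ring

theorem det_eigQ_ne_zero (h0 : u ≠ 0) (h1 : u ≠ -1) (h1' : u ≠ 1) : (eigQ u).det ≠ 0 := by
  have h2 := one_add_ne_zero h1
  have h3 : u - 1 ≠ 0 := sub_ne_zero.2 h1'
  rw [det_eigQ h1']
  positivity

theorem rhoT_mul_eigQ (h0 : u ≠ 0) (h1' : u ≠ 1) :
    rhoT u * eigQ u = eigQ u * Matrix.diagonal (eigT u) := by
  have h3 : u - 1 ≠ 0 := sub_ne_zero.2 h1'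
  ext i j
  rw [Matrix.mul_diagonal]
  fin_cases i <;> fin_cases j <;>
    simp [rhoT, eigQ, eigT, Matrix.mul_apply, Fin.sum_univ_four] <;> field_simp <;> ring

theorem rhoU_mul_eigQ (h0 : u ≠ 0) (h1 : u ≠ -1) (h1' : u ≠ 1) :
    rhoU u * eigQ u = eigQ u * Matrix.diagonal (eigU u) := by
  have h2 := one_add_ne_zero h1
  have h3 : u - 1 ≠ 0 := sub_ne_zero.2 h1'
  ext i j
  rw [Matrix.mul_diagonal]
  fin_cases i <;> fin_cases j <;>
    simp [rhoU, eigQ, eigU, Matrix.mul_apply, Fin.sum_univ_four, add_sq_eq, sq_add_cube_eq] <;>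
    field_simp <;> ring

theorem rhoL_mul_eigQ (h0 : u ≠ 0) (h1 : u ≠ -1) (h1' : u ≠ 1) :
    rhoL u * eigQ u = eigQ u * eigL := by
  have h2 := one_add_ne_zero h1
  have h3 : u - 1 ≠ 0 := sub_ne_zero.2 h1'
  ext i j
  fin_cases i <;> fin_cases j <;>
    simp [rhoL, eigQ, eigL, Matrix.mul_apply, Fin.sum_univ_four, add_sq_eq] <;>
    field_simp <;> ring

theorem rhoA_mul_eigQ (h0 : u ≠ 0) (h1' : u ≠ 1) :
    rhoA u * eigQ u = eigQ u * eigA (-(u ^ 2 + u + 1) / (u - 1) ^ 2) := by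
  have h3 : u - 1 ≠ 0 := sub_ne_zero.2 h1'
  ext i j
  fin_cases i <;> fin_cases j <;>
    simp [rhoA, eigQ, eigA, Matrix.mul_apply, Fin.sum_univ_four] <;>
    field_simp <;> ring

end Eigenbasis

/-! ### Unimodular parameters -/

theorem conj_eq_inv {u : ℂ} (hu : ‖u‖ = 1) : star u = u⁻¹ := by
  rw [Complex.inv_def, Complex.normSq_eq_norm_sq, hu]
  simp

theorem ne_zero_of_norm_eq_one {u : ℂ} (hu : ‖u‖ = 1) : u ≠ 0 := by
  rintro rfl
  simp at hu

theorem sq_add_one_eq {u : ℂ} (hu : ‖u‖ = 1) : u ^ 2 + 1 = 2 * (u.re : ℂ) * u := by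
  have h0 := ne_zero_of_norm_eq_one hu
  have h := Complex.add_conj u
  rw [show (starRingEnd ℂ) u = star u from rfl, conj_eq_inv hu] at h
  field_simp at h
  push_cast at h
  linear_combination h

theorem re_lt_one_of_norm_eq_one {u : ℂ} (hu : ‖u‖ = 1) (h1 : u ≠ 1) : u.re < 1 := by
  have h := Complex.normSq_eq_norm_sq u
  rw [hu, Complex.normSq_apply] at h
  by_contra hcon
  have h2 : u.im = 0 := by nlinarith [mul_self_nonneg u.im]
  have h3 : u.re = 1 := by nlinarith
  exact h1 (Complex.ext (by simpa using h3) (by simpa using h2))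

theorem neg_one_lt_re_of_norm_eq_one {u : ℂ} (hu : ‖u‖ = 1) (h1 : u ≠ -1) : -1 < u.re := by
  have := re_lt_one_of_norm_eq_one (u := -u) (by simpa using hu) (fun h => h1 (by
    linear_combination -h))
  simp at this
  linarith

/-- The `(0, 0)` entry of `ρ_u(A)` in the eigenbasis, as a real number. -/
def eigParam (u : ℂ) : ℝ := (1 + 2 * u.re) / (2 - 2 * u.re)

theorem eigParam_eq {u : ℂ} (hu : ‖u‖ = 1) (h1 : u ≠ 1) :
    -(u ^ 2 + u + 1) / (u - 1) ^ 2 = (eigParam u : ℂ) := by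
  have h3 : u - 1 ≠ 0 := sub_ne_zero.2 h1
  have h2 : (2 - 2 * u.re : ℂ) ≠ 0 := by
    have := re_lt_one_of_norm_eq_one hu h1
    have h4 : (2 - 2 * u.re : ℝ) ≠ 0 := by linarith
    exact_mod_cast h4
  rw [eigParam]
  push_cast
  rw [div_eq_div_iff (pow_ne_zero 2 h3) h2]
  linear_combination (-3 : ℂ) * sq_add_one_eq hu

/-- The value `Re u = 1/4` is where `eigParam u = 1`; beyond it the entry `(1 - a²)/3` of the
invariant diagonal form is negative. -/
theorem one_lt_eigParam {u : ℂ} (hu : ‖u‖ = 1) (h1 : u ≠ 1) (h : 1 / 4 < u.re) :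
    1 < eigParam u := by
  have := re_lt_one_of_norm_eq_one hu h1
  rw [eigParam, lt_div_iff₀ (by linarith)]
  linarith

theorem eigParam_sq_lt_one {u : ℂ} (hu : ‖u‖ = 1) (h1 : u ≠ -1) (h : u.re < 1 / 4) :
    eigParam u ^ 2 < 1 := by
  have := neg_one_lt_re_of_norm_eq_one hu h1
  rw [sq_lt_one_iff_abs_lt_one, abs_lt, eigParam]
  constructor
  · rw [lt_div_iff₀ (by linarith)]; linarith
  · rw [div_lt_iff₀ (by linarith)]; linarith

/-! ### Invariant Hermitian forms -/

theorem one_mem_SU (H : Matrix (Fin 4) (Fin 4) ℂ) : (1 : SL(4, ℂ)) ∈ SU H := by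
  simp [SU]

theorem mul_mem_SU {H : Matrix (Fin 4) (Fin 4) ℂ} {g h : SL(4, ℂ)} (hg : g ∈ SU H)
    (hh : h ∈ SU H) : g * h ∈ SU H := by
  simp only [SU, Set.mem_ofPred_eq, Matrix.SpecialLinearGroup.coe_mul,
    Matrix.conjTranspose_mul] at *
  calc _ = (h : Matrix (Fin 4) (Fin 4) ℂ)ᴴ * ((g : Matrix (Fin 4) (Fin 4) ℂ)ᴴ * H * g) * h := by
        simp only [mul_assoc]
    _ = H := by rw [hg, hh]

theorem inv_mem_SU {H : Matrix (Fin 4) (Fin 4) ℂ} {g : SL(4, ℂ)} (hg : g ∈ SU H) :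
    g⁻¹ ∈ SU H := by
  have e : (g : Matrix (Fin 4) (Fin 4) ℂ) * ((g⁻¹ : SL(4, ℂ)) : Matrix (Fin 4) (Fin 4) ℂ) = 1 := by
    rw [← Matrix.SpecialLinearGroup.coe_mul, mul_inv_cancel, Matrix.SpecialLinearGroup.coe_one]
  simp only [SU, Set.mem_ofPred_eq] at *
  nth_rewrite 1 [← hg]
  calc _ = ((g : Matrix (Fin 4) (Fin 4) ℂ) *
          ((g⁻¹ : SL(4, ℂ)) : Matrix (Fin 4) (Fin 4) ℂ))ᴴ * H *
        ((g : Matrix (Fin 4) (Fin 4) ℂ) * ((g⁻¹ : SL(4, ℂ)) : Matrix (Fin 4) (Fin 4) ℂ)) := by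
        rw [Matrix.conjTranspose_mul]
        simp only [mul_assoc]
    _ = H := by rw [e]; simp

theorem preservesForm_of_generators {ρ : Bi3 →* SL(4, ℂ)} {H : Matrix (Fin 4) (Fin 4) ℂ}
    (hH : H.IsHermitian) (hT : ρ genT ∈ SU H) (hU : ρ genU ∈ SU H) (hA : ρ genA ∈ SU H)
    (hL : ρ genL ∈ SU H) : PreservesForm ρ H := by
  refine ⟨hH, gen_induction hT hU hA hL ?_ ?_ ?_⟩
  · rw [map_one]; exact one_mem_SU H
  · intro x y hx hy
    rw [map_mul]
    exact mul_mem_SU hx hy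
  · intro x hx
    rw [map_inv]
    exact inv_mem_SU hx

theorem form_conj {M M' D : Matrix (Fin 4) (Fin 4) ℂ} (Q : GL (Fin 4) ℂ)
    (h : M * (Q : Matrix (Fin 4) (Fin 4) ℂ) = Q * M') (hD : M'ᴴ * D * M' = D) :
    Mᴴ * (((Q⁻¹ : GL (Fin 4) ℂ) : Matrix (Fin 4) (Fin 4) ℂ)ᴴ * D *
      ((Q⁻¹ : GL (Fin 4) ℂ) : Matrix (Fin 4) (Fin 4) ℂ)) * M =
      ((Q⁻¹ : GL (Fin 4) ℂ) : Matrix (Fin 4) (Fin 4) ℂ)ᴴ * D *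
      ((Q⁻¹ : GL (Fin 4) ℂ) : Matrix (Fin 4) (Fin 4) ℂ) := by
  set R := ((Q⁻¹ : GL (Fin 4) ℂ) : Matrix (Fin 4) (Fin 4) ℂ) with hR
  have e1 : R * (Q : Matrix (Fin 4) (Fin 4) ℂ) = 1 := by
    rw [hR, ← Units.val_mul, inv_mul_cancel, Units.val_one]
  have e2 : (Q : Matrix (Fin 4) (Fin 4) ℂ) * R = 1 := by
    rw [hR, ← Units.val_mul, mul_inv_cancel, Units.val_one]
  have e3 : R * M = M' * R := by
    calc R * M = R * (M * ((Q : Matrix (Fin 4) (Fin 4) ℂ) * R)) := by rw [e2, mul_one]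
      _ = R * (M * Q) * R := by simp only [mul_assoc]
      _ = (R * Q) * M' * R := by rw [h]; simp only [mul_assoc]
      _ = M' * R := by rw [e1, one_mul]
  calc Mᴴ * (Rᴴ * D * R) * M = (R * M)ᴴ * D * (R * M) := by
        rw [Matrix.conjTranspose_mul]; simp only [mul_assoc]
    _ = Rᴴ * (M'ᴴ * D * M') * R := by
        rw [e3, Matrix.conjTranspose_mul]; simp only [mul_assoc]
    _ = _ := by rw [hD]

theorem form_conj_restore (Q : GL (Fin 4) ℂ) (D : Matrix (Fin 4) (Fin 4) ℂ) :
    (Q : Matrix (Fin 4) (Fin 4) ℂ)ᴴ * (((Q⁻¹ : GL (Fin 4) ℂ) : Matrix (Fin 4) (Fin 4) ℂ)ᴴ * D *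
      ((Q⁻¹ : GL (Fin 4) ℂ) : Matrix (Fin 4) (Fin 4) ℂ)) * Q = D := by
  have e1 : ((Q⁻¹ : GL (Fin 4) ℂ) : Matrix (Fin 4) (Fin 4) ℂ) *
      (Q : Matrix (Fin 4) (Fin 4) ℂ) = 1 := by
    rw [← Units.val_mul, inv_mul_cancel, Units.val_one]
  calc _ = (((Q⁻¹ : GL (Fin 4) ℂ) : Matrix (Fin 4) (Fin 4) ℂ) *
          (Q : Matrix (Fin 4) (Fin 4) ℂ))ᴴ * D *
        (((Q⁻¹ : GL (Fin 4) ℂ) : Matrix (Fin 4) (Fin 4) ℂ) *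
          (Q : Matrix (Fin 4) (Fin 4) ℂ)) := by
        rw [Matrix.conjTranspose_mul]; simp only [mul_assoc]
    _ = D := by rw [e1]; simp

theorem isHermitian_form_conj (R : Matrix (Fin 4) (Fin 4) ℂ) {D : Matrix (Fin 4) (Fin 4) ℂ}
    (hD : D.IsHermitian) : (Rᴴ * D * R).IsHermitian := by
  rw [Matrix.IsHermitian, Matrix.conjTranspose_mul, Matrix.conjTranspose_mul,
    Matrix.conjTranspose_conjTranspose, hD.eq, mul_assoc]

theorem inv_sqrt_sq_mul {x : ℝ} (hx : 0 < x) : (√x)⁻¹ * x * (√x)⁻¹ = 1 := by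
  have h := Real.sqrt_pos.2 hx
  have h2 := Real.mul_self_sqrt hx.le
  field_simp
  rw [sq, h2]

theorem hasSignature_four_zero {H : Matrix (Fin 4) (Fin 4) ℂ} (R : GL (Fin 4) ℂ) {d : Fin 4 → ℝ}
    (h : (R : Matrix (Fin 4) (Fin 4) ℂ)ᴴ * H * R = Matrix.diagonal fun i => (d i : ℂ))
    (hd : ∀ i, 0 < d i) : HasSignature H 4 0 := by
  refine ⟨rfl, ?_⟩
  have hdet : (Matrix.diagonal fun i => (((√(d i))⁻¹ : ℝ) : ℂ)).det ≠ 0 := by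
    rw [Matrix.det_diagonal, Finset.prod_ne_zero_iff]
    intro i _
    have := Real.sqrt_pos.2 (hd i)
    exact_mod_cast (inv_pos.2 this).ne'
  refine ⟨R * Matrix.GeneralLinearGroup.mkOfDetNeZero _ hdet, ?_⟩
  have e : ((R * Matrix.GeneralLinearGroup.mkOfDetNeZero _ hdet : GL (Fin 4) ℂ) :
      Matrix (Fin 4) (Fin 4) ℂ) = R * Matrix.diagonal fun i => (((√(d i))⁻¹ : ℝ) : ℂ) := rfl
  rw [e, Matrix.conjTranspose_mul]
  calc _ = (Matrix.diagonal fun i => (((√(d i))⁻¹ : ℝ) : ℂ))ᴴ *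
        ((R : Matrix (Fin 4) (Fin 4) ℂ)ᴴ * H * R) *
        (Matrix.diagonal fun i => (((√(d i))⁻¹ : ℝ) : ℂ)) := by simp only [mul_assoc]
    _ = _ := by
      rw [h, Matrix.diagonal_conjTranspose, Matrix.diagonal_mul_diagonal,
        Matrix.diagonal_mul_diagonal]
      congr 1
      ext i
      simp only [Pi.star_apply, Complex.star_def, Complex.conj_ofReal, i.2, if_true]
      rw [← Complex.ofReal_mul, ← Complex.ofReal_mul, inv_sqrt_sq_mul (hd i), Complex.ofReal_one]

theorem hasSignature_three_one {H : Matrix (Fin 4) (Fin 4) ℂ} (R : GL (Fin 4) ℂ) {d : Fin 4 → ℝ}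
    (h : (R : Matrix (Fin 4) (Fin 4) ℂ)ᴴ * H * R = Matrix.diagonal fun i => (d i : ℂ))
    (h0 : d 0 < 0) (h1 : 0 < d 1) (h2 : 0 < d 2) (h3 : 0 < d 3) : HasSignature H 3 1 := by
  refine ⟨rfl, ?_⟩
  set s : Fin 4 → ℝ := fun i => (√|d i|)⁻¹ with hs
  have hdne : ∀ i, d i ≠ 0 := by
    intro i
    fin_cases i
    exacts [h0.ne, h1.ne', h2.ne', h3.ne']
  have hspos : ∀ i, (s i : ℂ) ≠ 0 := fun i => by
    have := Real.sqrt_pos.2 (abs_pos.2 (hdne i))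
    exact_mod_cast (inv_pos.2 this).ne'
  have hsd : ∀ i, s i * |d i| * s i = 1 := fun i => inv_sqrt_sq_mul (abs_pos.2 (hdne i))
  -- `HasSignature` lists the negative sign last, whereas the negative entry of `d` comes first; the
  -- rescaling therefore also exchanges coordinates `0` and `3`.
  set S : Matrix (Fin 4) (Fin 4) ℂ :=
    !![0, 0, 0, (s 0 : ℂ); 0, s 1, 0, 0; 0, 0, s 2, 0; s 3, 0, 0, 0] with hS
  have hdet : S.det ≠ 0 := by
    have : S.det = -((s 0 : ℂ) * s 1 * s 2 * s 3) := by
      simp [hS, Matrix.det_succ_row_zero, Fin.sum_univ_succ, Fin.succAbove]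
      ring
    rw [this, neg_ne_zero]
    exact mul_ne_zero (mul_ne_zero (mul_ne_zero (hspos 0) (hspos 1)) (hspos 2)) (hspos 3)
  refine ⟨R * Matrix.GeneralLinearGroup.mkOfDetNeZero _ hdet, ?_⟩
  have e : ((R * Matrix.GeneralLinearGroup.mkOfDetNeZero _ hdet : GL (Fin 4) ℂ) :
      Matrix (Fin 4) (Fin 4) ℂ) = R * S := rfl
  have k0 : (s 0 : ℂ) * d 0 * s 0 = -1 := by
    have := hsd 0
    rw [abs_of_neg h0] at this
    have : s 0 * d 0 * s 0 = -1 := by linarith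
    exact_mod_cast this
  have k1 : (s 1 : ℂ) * d 1 * s 1 = 1 := by
    have := hsd 1
    rw [abs_of_pos h1] at this
    exact_mod_cast this
  have k2 : (s 2 : ℂ) * d 2 * s 2 = 1 := by
    have := hsd 2
    rw [abs_of_pos h2] at this
    exact_mod_cast this
  have k3 : (s 3 : ℂ) * d 3 * s 3 = 1 := by
    have := hsd 3
    rw [abs_of_pos h3] at this
    exact_mod_cast this
  rw [e, Matrix.conjTranspose_mul]
  calc _ = Sᴴ * ((R : Matrix (Fin 4) (Fin 4) ℂ)ᴴ * H * R) * S := by simp only [mul_assoc]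
    _ = _ := by
      rw [h]
      ext i j
      rw [Matrix.mul_apply]
      simp only [Matrix.mul_diagonal, Fin.sum_univ_four, Matrix.conjTranspose_apply]
      fin_cases i <;> fin_cases j <;> simp [hS, k0, k1, k2, k3]

end Bianchi
end

/-! ### The invariant form and ellipticity, computed in the eigenbasis. -/

noncomputable section
namespace Bianchi

/-- The eigenbasis as an invertible matrix. -/
def eigGL {u : ℂ} (h0 : u ≠ 0) (h1 : u ≠ -1) (h1' : u ≠ 1) : GL (Fin 4) ℂ :=
  Matrix.GeneralLinearGroup.mkOfDetNeZero (eigQ u) (det_eigQ_ne_zero h0 h1 h1')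

theorem coe_eigGL {u : ℂ} (h0 : u ≠ 0) (h1 : u ≠ -1) (h1' : u ≠ 1) :
    (eigGL h0 h1 h1' : Matrix (Fin 4) (Fin 4) ℂ) = eigQ u := rfl

theorem eq_conj_of_mul_eq {M N : Matrix (Fin 4) (Fin 4) ℂ} {Q : GL (Fin 4) ℂ}
    (h : M * (Q : Matrix (Fin 4) (Fin 4) ℂ) = Q * N) :
    M = Q * N * ((Q⁻¹ : GL (Fin 4) ℂ) : Matrix (Fin 4) (Fin 4) ℂ) := by
  rw [← h, mul_assoc, ← Units.val_mul, mul_inv_cancel, Units.val_one, mul_one]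

theorem diagonal_form_invariant {c d : Fin 4 → ℂ} (hc : ∀ i, ‖c i‖ = 1) :
    (Matrix.diagonal c)ᴴ * Matrix.diagonal d * Matrix.diagonal c = Matrix.diagonal d := by
  rw [Matrix.diagonal_conjTranspose, Matrix.diagonal_mul_diagonal, Matrix.diagonal_mul_diagonal]
  congr 1
  ext i
  have h : star (c i) * c i = 1 := by
    rw [conj_eq_inv (hc i), inv_mul_cancel₀ (ne_zero_of_norm_eq_one (hc i))]
  simp only [Pi.star_apply]
  linear_combination d i * h

theorem norm_eigT {u : ℂ} (hu : ‖u‖ = 1) (i : Fin 4) : ‖eigT u i‖ = 1 := by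
  fin_cases i <;> simp [eigT, hu]

theorem norm_eigU {u : ℂ} (hu : ‖u‖ = 1) (i : Fin 4) : ‖eigU u i‖ = 1 := by
  fin_cases i <;> simp [eigU, hu]

/-- The diagonal of the invariant form in the eigenbasis. -/
def eigForm (a : ℝ) : Fin 4 → ℝ := ![(1 - a ^ 2) / 3, 1, 1, 1]

theorem eigL_form_invariant (a : ℝ) :
    eigLᴴ * Matrix.diagonal (fun i => (eigForm a i : ℂ)) * eigL =
      Matrix.diagonal (fun i => (eigForm a i : ℂ)) := by
  ext i j
  rw [Matrix.mul_apply]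
  simp only [Matrix.mul_diagonal, Fin.sum_univ_four, Matrix.conjTranspose_apply]
  fin_cases i <;> fin_cases j <;> simp [eigL, eigForm]

theorem eigA_form_invariant (a : ℝ) :
    (eigA a)ᴴ * Matrix.diagonal (fun i => (eigForm a i : ℂ)) * eigA a =
      Matrix.diagonal (fun i => (eigForm a i : ℂ)) := by
  ext i j
  rw [Matrix.mul_apply]
  simp only [Matrix.mul_diagonal, Fin.sum_univ_four, Matrix.conjTranspose_apply]
  fin_cases i <;> fin_cases j <;> simp [eigA, eigForm] <;> ring

theorem exists_form_of_ne_one {u : ℂ} (hu : ‖u‖ = 1) (h1 : u ≠ -1) (h1' : u ≠ 1)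
    {ρ : Bi3 →* SL(4, ℂ)} (hρ : IsRho u ρ) :
    ∃ H : Matrix (Fin 4) (Fin 4) ℂ, H ≠ 0 ∧ PreservesForm ρ H ∧
      (1 / 4 < u.re → HasSignature H 3 1) ∧ (u.re < 1 / 4 → HasSignature H 4 0) := by
  have h0 := ne_zero_of_norm_eq_one hu
  set Q := eigGL h0 h1 h1' with hQ
  set a := eigParam u with ha
  set D : Matrix (Fin 4) (Fin 4) ℂ := Matrix.diagonal (fun i => (eigForm a i : ℂ)) with hD
  set H := ((Q⁻¹ : GL (Fin 4) ℂ) : Matrix (Fin 4) (Fin 4) ℂ)ᴴ * D *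
      ((Q⁻¹ : GL (Fin 4) ℂ) : Matrix (Fin 4) (Fin 4) ℂ) with hH
  have hDH : (Q : Matrix (Fin 4) (Fin 4) ℂ)ᴴ * H * Q = D := form_conj_restore Q D
  obtain ⟨hT, hU, hA, hL⟩ := hρ
  refine ⟨H, ?_, preservesForm_of_generators (isHermitian_form_conj _ ?_) ?_ ?_ ?_ ?_, ?_, ?_⟩
  · intro h
    rw [h, mul_zero, zero_mul] at hDH
    have := congrFun (congrFun hDH 1) 1
    simp [hD, eigForm] at this
  · rw [hD, Matrix.isHermitian_diagonal_iff]
    intro i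
    simp [isSelfAdjoint_iff]
  · change _ᴴ * H * _ = H
    rw [hT]
    exact form_conj Q (rhoT_mul_eigQ h0 h1') (diagonal_form_invariant (norm_eigT hu))
  · change _ᴴ * H * _ = H
    rw [hU]
    exact form_conj Q (rhoU_mul_eigQ h0 h1 h1') (diagonal_form_invariant (norm_eigU hu))
  · change _ᴴ * H * _ = H
    rw [hA]
    have e := rhoA_mul_eigQ h0 h1'
    rw [eigParam_eq hu h1'] at e
    exact form_conj Q e (eigA_form_invariant a)
  · change _ᴴ * H * _ = H
    rw [hL]
    exact form_conj Q (rhoL_mul_eigQ h0 h1 h1') (eigL_form_invariant a)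
  · intro h
    refine hasSignature_three_one Q hDH ?_ ?_ ?_ ?_
    · have := one_lt_eigParam hu h1' h
      simp only [eigForm, Matrix.cons_val_zero]
      nlinarith
    all_goals simp [eigForm]
  · intro h
    refine hasSignature_four_zero Q hDH ?_
    have := eigParam_sq_lt_one hu h1 h
    intro i
    fin_cases i
    · simp only [eigForm, Fin.zero_eta, Matrix.cons_val_zero]
      linarith
    all_goals simp [eigForm]

/-! ### Ellipticity -/

theorem isElliptic_of_diagonal {g : SL(4, ℂ)} {d : Fin 4 → ℂ} (Q : GL (Fin 4) ℂ)
    (hd : ∀ i, ‖d i‖ = 1)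
    (h : (g : Matrix (Fin 4) (Fin 4) ℂ) * (Q : Matrix (Fin 4) (Fin 4) ℂ) =
      Q * Matrix.diagonal d) : IsElliptic g :=
  ⟨Q, d, hd, eq_conj_of_mul_eq h⟩

theorem conj_form_invariant {M N H : Matrix (Fin 4) (Fin 4) ℂ} {Q : Matrix (Fin 4) (Fin 4) ℂ}
    (h : M * Q = Q * N) (hM : Mᴴ * H * M = H) : Nᴴ * (Qᴴ * H * Q) * N = Qᴴ * H * Q := by
  calc Nᴴ * (Qᴴ * H * Q) * N = (Q * N)ᴴ * H * (Q * N) := by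
        rw [Matrix.conjTranspose_mul]; simp only [mul_assoc]
    _ = Qᴴ * (Mᴴ * H * M) * Q := by
        rw [← h, Matrix.conjTranspose_mul]; simp only [mul_assoc]
    _ = _ := by rw [hM]

theorem apply_eq_zero_of_diagonal_invariant {F : Matrix (Fin 4) (Fin 4) ℂ} {c : Fin 4 → ℂ}
    (h : (Matrix.diagonal c)ᴴ * F * Matrix.diagonal c = F) {i j : Fin 4}
    (hij : star (c i) * c j ≠ 1) : F i j = 0 := by
  have := congrFun (congrFun h i) j
  rw [Matrix.mul_diagonal, Matrix.diagonal_conjTranspose, Matrix.diagonal_mul] at this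
  simp only [Pi.star_apply] at this
  have h2 : (star (c i) * c j - 1) * F i j = 0 := by linear_combination this
  exact (mul_eq_zero.1 h2).resolve_left (sub_ne_zero.2 hij)

/-- An invariant form is diagonal in the eigenbasis. -/
theorem eigenbasis_orthogonal {u : ℂ} (hu : ‖u‖ = 1) (h1 : u ≠ -1) (h1' : u ≠ 1)
    {ρ : Bi3 →* SL(4, ℂ)} (hρ : IsRho u ρ) {H : Matrix (Fin 4) (Fin 4) ℂ}
    (hH : PreservesForm ρ H) {i j : Fin 4} (hij : i ≠ j) : ((eigQ u)ᴴ * H * eigQ u) i j = 0 := by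
  have h0 := ne_zero_of_norm_eq_one hu
  have hT := conj_form_invariant (H := H) (rhoT_mul_eigQ h0 h1')
    (by have := hH.2 genT; rw [← hρ.1]; exact this)
  have hU := conj_form_invariant (H := H) (rhoU_mul_eigQ h0 h1 h1')
    (by have := hH.2 genU; rw [← hρ.2.1]; exact this)
  have hi : u⁻¹ ≠ 1 := by simpa using h1'
  have hs : star (u⁻¹) = u := by rw [star_inv₀, conj_eq_inv hu, inv_inv]
  have hs' := conj_eq_inv hu
  by_cases hc : star (eigT u i) * eigT u j ≠ 1
  · exact apply_eq_zero_of_diagonal_invariant hT hc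
  · refine apply_eq_zero_of_diagonal_invariant hU ?_
    revert hc
    simp only [not_ne_iff]
    fin_cases i <;> fin_cases j <;>
      simp [eigT, eigU, h1', hi, -Complex.star_def, -star_inv₀, hs, hs'] at hij ⊢

theorem exists_neg_of_hasSignature {H : Matrix (Fin 4) (Fin 4) ℂ} (h : HasSignature H 3 1) :
    ∃ v : Fin 4 → ℂ, (star v ⬝ᵥ (H *ᵥ v)).re < 0 := by
  obtain ⟨-, P, hP⟩ := h
  refine ⟨(P : Matrix (Fin 4) (Fin 4) ℂ) *ᵥ Pi.single 3 1, ?_⟩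
  rw [Matrix.star_mulVec, ← Matrix.dotProduct_mulVec, Matrix.mulVec_mulVec, Matrix.mulVec_mulVec, hP]
  simp

/-- The form is diagonal in the eigenbasis; with non-negative diagonal entries it would be positive
semidefinite, which a negative vector excludes. -/
theorem exists_neg_eigenvector {u : ℂ} (hu : ‖u‖ = 1) (h1 : u ≠ -1) (h1' : u ≠ 1)
    {ρ : Bi3 →* SL(4, ℂ)} (hρ : IsRho u ρ) {H : Matrix (Fin 4) (Fin 4) ℂ}
    (hH : PreservesForm ρ H) (hs : HasSignature H 3 1) :
    ∃ i : Fin 4, (((eigQ u)ᴴ * H * eigQ u) i i).re < 0 := by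
  have h0 := ne_zero_of_norm_eq_one hu
  by_contra! hcon
  obtain ⟨v, hv⟩ := exists_neg_of_hasSignature hs
  set Q := eigGL h0 h1 h1'
  set w := ((Q⁻¹ : GL (Fin 4) ℂ) : Matrix (Fin 4) (Fin 4) ℂ) *ᵥ v with hw
  have hvw : v = eigQ u *ᵥ w := by
    rw [hw, Matrix.mulVec_mulVec, ← coe_eigGL h0 h1 h1', ← Units.val_mul, mul_inv_cancel,
      Units.val_one, Matrix.one_mulVec]
  set F := (eigQ u)ᴴ * H * eigQ u with hF
  have hdiag : F = Matrix.diagonal fun i => F i i := by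
    ext i j
    by_cases hij : i = j
    · subst hij; simp
    · rw [Matrix.diagonal_apply_ne _ hij]
      exact eigenbasis_orthogonal hu h1 h1' hρ hH hij
  have e : star v ⬝ᵥ (H *ᵥ v) = ∑ i, star (w i) * (F i i * w i) := by
    rw [hvw, Matrix.star_mulVec, ← Matrix.dotProduct_mulVec, Matrix.mulVec_mulVec,
      Matrix.mulVec_mulVec, ← hF]
    nth_rewrite 1 [hdiag]
    simp [dotProduct, Matrix.mulVec_diagonal]
  rw [e, Complex.re_sum] at hv
  refine absurd hv (not_lt.2 (Finset.sum_nonneg fun i _ => ?_))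
  have e2 : star (w i) * (F i i * w i) = ((Complex.normSq (w i) : ℝ) : ℂ) * F i i := by
    rw [Complex.normSq_eq_conj_mul_self]
    simp only [Complex.star_def]
    ring
  rw [e2, Complex.re_ofReal_mul]
  exact mul_nonneg (Complex.normSq_nonneg _) (hcon i)

theorem fixesHyperbolicPoint {u : ℂ} (hu : ‖u‖ = 1) (h1 : u ≠ -1) (h1' : u ≠ 1)
    {ρ : Bi3 →* SL(4, ℂ)} (hρ : IsRho u ρ) {H : Matrix (Fin 4) (Fin 4) ℂ}
    (hH : PreservesForm ρ H) (hs : HasSignature H 3 1) :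
    FixesHyperbolicPoint H (ρ genT) ∧ FixesHyperbolicPoint H (ρ genU) := by
  have h0 := ne_zero_of_norm_eq_one hu
  obtain ⟨i, hi⟩ := exists_neg_eigenvector hu h1 h1' hρ hH hs
  have hv : (star (eigQ u *ᵥ Pi.single i 1) ⬝ᵥ (H *ᵥ (eigQ u *ᵥ Pi.single i 1))).re < 0 := by
    rw [Matrix.star_mulVec, ← Matrix.dotProduct_mulVec, Matrix.mulVec_mulVec,
      Matrix.mulVec_mulVec]
    simpa [← Pi.single_star] using hi
  have key : ∀ (M : Matrix (Fin 4) (Fin 4) ℂ) (d : Fin 4 → ℂ),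
      M * eigQ u = eigQ u * Matrix.diagonal d →
      M *ᵥ (eigQ u *ᵥ Pi.single i 1) = d i • (eigQ u *ᵥ Pi.single i 1) := by
    intro M d h
    rw [Matrix.mulVec_mulVec, h, ← Matrix.mulVec_mulVec, ← Matrix.mulVec_smul]
    congr 1
    ext j
    rw [Matrix.mulVec_diagonal]
    by_cases hj : j = i
    · subst hj; simp
    · simp [hj]
  refine ⟨⟨_, hv, eigT u i, ?_⟩, ⟨_, hv, eigU u i, ?_⟩⟩
  · rw [hρ.1]; exact key _ _ (rhoT_mul_eigQ h0 h1')
  · rw [hρ.2.1]; exact key _ _ (rhoU_mul_eigQ h0 h1 h1')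

/-! ### `ρ_u` is not both faithful and discrete -/

theorem genT_pow_ne_one {n : ℕ} (hn : 0 < n) : genT ^ n ≠ 1 := by
  intro h
  have h2 : ((matT ^ n : SL(2, O3)) : Bi3) = 1 := by rw [QuotientGroup.mk_pow]; exact h
  have h3 : matT ^ n = matTr n := by
    have := matTr_coords n 0
    simpa using this.symm
  rw [h3, QuotientGroup.eq_one_iff, Matrix.SpecialLinearGroup.mem_center_iff] at h2
  obtain ⟨r, -, hr⟩ := h2
  have := congrFun (congrFun hr 0) 1
  simp [coe_matTr] at this
  exact hn.ne' (by exact_mod_cast this.symm)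

/-- On the compact circle some subsequence of the powers of `u` converges; the quotient of two close
terms is a positive power of `u` close to `1`. -/
theorem exists_pow_near_one {u : ℂ} (hu : ‖u‖ = 1) {ε : ℝ} (hε : 0 < ε) :
    ∃ n : ℕ, 0 < n ∧ ‖u ^ n - 1‖ < ε := by
  obtain ⟨x, -, φ, hφ, hlim⟩ := (isCompact_sphere (0 : ℂ) 1).tendsto_subseq
    (x := fun n : ℕ => u ^ n) (fun n => by simp [hu])
  obtain ⟨N, hN⟩ := Metric.cauchySeq_iff'.1 hlim.cauchySeq ε hε
  refine ⟨φ (N + 1) - φ N, Nat.sub_pos_of_lt (hφ (Nat.lt_succ_self N)), ?_⟩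
  have h := hN (N + 1) (Nat.le_succ N)
  rw [dist_eq_norm] at h
  have hlt := (hφ (Nat.lt_succ_self N)).le
  have e : (fun n : ℕ => u ^ n) (φ (N + 1)) - (fun n : ℕ => u ^ n) (φ N) =
      u ^ φ N * (u ^ (φ (N + 1) - φ N) - 1) := by
    rw [mul_sub, ← pow_add, Nat.add_sub_cancel' hlt, mul_one]
  simp only [Function.comp] at h
  rw [e, norm_mul, norm_pow, hu, one_pow, one_mul] at h
  exact h

/-- Along exponents with `u ^ n` close to `1`, the matrices `ρ(T) ^ n` approach the identity.
Discreteness would make one of them equal to it, and injectivity would then give `T` finite order.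
-/
theorem not_discrete_and_injective {u : ℂ} (hu : ‖u‖ = 1) (h1 : u ≠ -1) (h1' : u ≠ 1)
    {ρ : Bi3 →* SL(4, ℂ)} (hρ : IsRho u ρ) :
    ¬ (DiscreteTopology ρ.range ∧ Function.Injective ρ) := by
  rintro ⟨hd, hinj⟩
  have h0 := ne_zero_of_norm_eq_one hu
  set Q := eigGL h0 h1 h1'
  -- the closure of the powers of `ρ(T)`
  set φ : ℂ → Matrix (Fin 4) (Fin 4) ℂ := fun z =>
    (Q : Matrix (Fin 4) (Fin 4) ℂ) * Matrix.diagonal ![1, z, star z, 1] *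
      ((Q⁻¹ : GL (Fin 4) ℂ) : Matrix (Fin 4) (Fin 4) ℂ) with hφ
  have hφc : Continuous φ := by
    refine (continuous_const.matrix_mul (Continuous.matrix_diagonal ?_)).matrix_mul
      continuous_const
    refine continuous_pi fun i => ?_
    fin_cases i
    · exact continuous_const
    · exact continuous_id
    · exact continuous_star
    · exact continuous_const
  have hφ1 : φ 1 = 1 := by
    have : (![1, 1, star 1, 1] : Fin 4 → ℂ) = fun _ => 1 := by
      ext i; fin_cases i <;> simp
    simp only [hφ, this, Matrix.diagonal_one, mul_one]
    rw [← Units.val_mul, mul_inv_cancel, Units.val_one]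
  have hpow : ∀ n : ℕ, ((ρ (genT ^ n) : SL(4, ℂ)) : Matrix (Fin 4) (Fin 4) ℂ) = φ (u ^ n) := by
    intro n
    have e : rhoT u ^ n * (Q : Matrix (Fin 4) (Fin 4) ℂ) =
        Q * Matrix.diagonal (eigT u) ^ n := by
      induction n with
      | zero => simp
      | succ n ih =>
        rw [pow_succ, mul_assoc, show rhoT u * (Q : Matrix (Fin 4) (Fin 4) ℂ) = _ from
          rhoT_mul_eigQ h0 h1', ← mul_assoc, show rhoT u ^ n * eigQ u = _ from ih, mul_assoc,
          ← pow_succ]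
    rw [map_pow, Matrix.SpecialLinearGroup.coe_pow, hρ.1, eq_conj_of_mul_eq e,
      Matrix.diagonal_pow]
    simp only [hφ]
    congr 3
    ext i
    fin_cases i <;> simp [eigT, -Complex.star_def, conj_eq_inv hu]
  have hopen : IsOpen ({1} : Set ρ.range) := isOpen_discrete _
  obtain ⟨V, hV, hV1⟩ := isOpen_induced_iff.1 hopen
  obtain ⟨W, hW, hW1⟩ := isOpen_induced_iff.1 hV
  have hmem : ∀ g : Bi3, ((ρ g : SL(4, ℂ)) : Matrix (Fin 4) (Fin 4) ℂ) ∈ W ↔ g = 1 := by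
    intro g
    have h2 : (⟨ρ g, g, rfl⟩ : ρ.range) ∈ ({1} : Set ρ.range) ↔ g = 1 := by
      rw [Set.mem_singleton_iff, Subtype.ext_iff]
      change ρ g = 1 ↔ g = 1
      rw [map_eq_one_iff ρ hinj]
    rw [← h2, ← hV1, ← hW1]
    rfl
  have h1W : φ 1 ∈ W := by
    rw [hφ1]
    have := (hmem 1).2 rfl
    rwa [map_one, Matrix.SpecialLinearGroup.coe_one] at this
  obtain ⟨ε, hε, hball⟩ := Metric.isOpen_iff.1 (hW.preimage hφc) 1 h1W
  obtain ⟨n, hn, hnear⟩ := exists_pow_near_one hu hε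
  have : u ^ n ∈ φ ⁻¹' W := hball (by rw [Metric.mem_ball, dist_eq_norm]; exact hnear)
  rw [Set.mem_preimage, ← hpow, hmem] at this
  exact genT_pow_ne_one hn this

end Bianchi
end

noncomputable section
namespace Bianchi

/-! ### The hyperbolic representation -/

theorem hermitian_eq_sum {X : Matrix (Fin 2) (Fin 2) ℂ} (hX : X.IsHermitian) :
    X = ∑ k, (((Matrix.trace (hermBasis k * X)).re / 2 : ℝ) : ℂ) • hermBasis k := by
  have h00 : (X 0 0).im = 0 := by
    have := congrArg Complex.im (hX.apply 0 0)
    simp at this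
    linarith
  have h11 : (X 1 1).im = 0 := by
    have := congrArg Complex.im (hX.apply 1 1)
    simp at this
    linarith
  have hre : (X 1 0).re = (X 0 1).re := by
    have := congrArg Complex.re (hX.apply 0 1)
    simpa using this
  have him : (X 1 0).im = -(X 0 1).im := by
    have := congrArg Complex.im (hX.apply 0 1)
    simp at this
    linarith
  ext i j
  fin_cases i <;> fin_cases j <;>
    simp [Fin.sum_univ_four, hermBasis, Matrix.trace_fin_two, Matrix.vecHead, Matrix.vecTail,
      Matrix.vecMul_eq_sum, Fin.sum_univ_two] <;>
    apply Complex.ext <;> simp <;> linarith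

theorem isHermitian_hermBasis (k : Fin 4) : (hermBasis k).IsHermitian := by
  ext i j
  fin_cases k <;> fin_cases i <;> fin_cases j <;> simp [hermBasis]

/-- `h X h*` is again Hermitian, hence expands in `hermBasis` with the entries of `lorentz h` as its
real coefficients; applying `g` to the expansion gives the matrix product. -/
theorem lorentz_mul (g h : Matrix (Fin 2) (Fin 2) ℂ) :
    lorentz (g * h) = lorentz g * lorentz h := by
  ext i j
  have hX : (h * hermBasis j * hᴴ).IsHermitian := by
    rw [Matrix.IsHermitian, Matrix.conjTranspose_mul, Matrix.conjTranspose_mul,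
      Matrix.conjTranspose_conjTranspose, (isHermitian_hermBasis j).eq, mul_assoc]
  have e : g * h * hermBasis j * (g * h)ᴴ = ∑ k, ((lorentz h k j : ℝ) : ℂ) •
      (g * hermBasis k * gᴴ) := by
    calc _ = g * (h * hermBasis j * hᴴ) * gᴴ := by
          rw [Matrix.conjTranspose_mul]; simp only [mul_assoc]
      _ = _ := by
        nth_rewrite 1 [hermitian_eq_sum hX]
        rw [Finset.mul_sum, Finset.sum_mul]
        simp only [Matrix.mul_smul, Matrix.smul_mul]
        rfl
  rw [Matrix.mul_apply]
  conv_lhs => rw [lorentz, Matrix.of_apply, e]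
  rw [Finset.mul_sum, Matrix.trace_sum, Complex.re_sum, Finset.sum_div]
  refine Finset.sum_congr rfl fun k _ => ?_
  rw [Matrix.mul_smul, Matrix.trace_smul, smul_eq_mul, Complex.re_ofReal_mul]
  simp only [lorentz, Matrix.of_apply]
  ring

theorem lorentz_one : lorentz 1 = 1 := by
  ext i j
  fin_cases i <;> fin_cases j <;>
    simp [lorentz, hermBasis, Matrix.trace_fin_two, Matrix.vecHead, Matrix.vecTail]

theorem rhoHyp_mul (g h : SL(2, O3)) : rhoHyp (g * h) = rhoHyp g * rhoHyp h := by
  have e : ((g * h : SL(2, O3)) : Matrix (Fin 2) (Fin 2) O3).map (fun x => (x : ℂ)) =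
      (g : Matrix (Fin 2) (Fin 2) O3).map (fun x => (x : ℂ)) *
        (h : Matrix (Fin 2) (Fin 2) O3).map (fun x => (x : ℂ)) := by
    rw [Matrix.SpecialLinearGroup.coe_mul]
    exact Matrix.map_mul (f := O3.val.toRingHom)
  rw [rhoHyp, e, lorentz_mul]
  exact Matrix.map_mul (f := Complex.ofRealHom)

theorem rhoHyp_one : rhoHyp 1 = 1 := by
  have e : ((1 : SL(2, O3)) : Matrix (Fin 2) (Fin 2) O3).map (fun x => (x : ℂ)) = 1 := by
    rw [Matrix.SpecialLinearGroup.coe_one]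
    exact Matrix.map_one _ rfl rfl
  rw [rhoHyp, e, lorentz_one]
  exact Matrix.map_one _ rfl rfl

theorem sqrt_three_sq : ((√3 : ℝ) : ℂ) ^ 2 = 3 := by
  rw [← Complex.ofReal_pow, Real.sq_sqrt (by norm_num)]
  norm_num

theorem rhoHyp_matT : rhoHyp matT =
    !![3 / 2, -1 / 2, 1, 0; 1 / 2, 1 / 2, 1, 0; 1, -1, 1, 0; 0, 0, 0, 1] := by
  have e : (matT : Matrix (Fin 2) (Fin 2) O3).map (fun x => (x : ℂ)) = !![1, 1; 0, 1] := by
    ext i j; fin_cases i <;> fin_cases j <;> simp [coe_matT]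
  rw [rhoHyp, e]
  ext i j
  fin_cases i <;> fin_cases j <;>
    simp [lorentz, hermBasis, Matrix.trace_fin_two,
      Matrix.vecMul_eq_sum, Fin.sum_univ_two] <;> norm_num

theorem rhoHyp_matU : rhoHyp matU =
    !![3 / 2, -1 / 2, -1 / 2, (√3 : ℂ) / 2; 1 / 2, 1 / 2, -1 / 2, (√3 : ℂ) / 2;
      -1 / 2, 1 / 2, 1, 0; (√3 : ℂ) / 2, -(√3 : ℂ) / 2, 0, 1] := by
  have e : (matU : Matrix (Fin 2) (Fin 2) O3).map (fun x => (x : ℂ)) = !![1, τ; 0, 1] := by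
    ext i j; fin_cases i <;> fin_cases j <;> simp [coe_matU, coe_τ']
  rw [rhoHyp, e]
  ext i j
  fin_cases i <;> fin_cases j <;>
    simp [lorentz, hermBasis, Matrix.trace_fin_two,
      Matrix.vecMul_eq_sum, Fin.sum_univ_two, τ_re, τ_im] <;> ring_nf <;>
    (rw [sqrt_three_sq]; norm_num)

theorem rhoHyp_matA : rhoHyp matA = Matrix.diagonal ![1, -1, -1, 1] := by
  have e : (matA : Matrix (Fin 2) (Fin 2) O3).map (fun x => (x : ℂ)) = !![0, -1; 1, 0] := by
    ext i j; fin_cases i <;> fin_cases j <;> simp [coe_matA]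
  rw [rhoHyp, e]
  ext i j
  fin_cases i <;> fin_cases j <;>
    simp [lorentz, hermBasis, Matrix.trace_fin_two,
      Matrix.vecMul_eq_sum, Fin.sum_univ_two]

theorem rhoHyp_matL : rhoHyp matL =
    !![1, 0, 0, 0; 0, 1, 0, 0; 0, 0, -1 / 2, -(√3 : ℂ) / 2; 0, 0, (√3 : ℂ) / 2, -1 / 2] := by
  have e : (matL : Matrix (Fin 2) (Fin 2) O3).map (fun x => (x : ℂ)) = !![τ ^ 2, 0; 0, τ] := by
    ext i j; fin_cases i <;> fin_cases j <;> simp [coe_matL, coe_τ']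
  have h2 : τ ^ 2 = -1 - τ := by linear_combination τ_sq
  rw [rhoHyp, e, h2]
  ext i j
  fin_cases i <;> fin_cases j <;>
    simp [lorentz, hermBasis, Matrix.trace_fin_two,
      Matrix.vecMul_eq_sum, Fin.sum_univ_two, τ_re, τ_im] <;> ring_nf <;>
    (rw [sqrt_three_sq]; norm_num)

/-- The change of basis between `ρ_1` and `ρ_hyp`. -/
def hypP : Matrix (Fin 4) (Fin 4) ℂ :=
  !![2, -1, 0, -1; 0, -1, 0, 1; 1, -1, 1, -1; (√3 : ℂ), 0, 0, 0]

theorem ofReal_sqrt_three_ne_zero : ((√3 : ℝ) : ℂ) ≠ 0 := by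
  have : (√3 : ℝ) ≠ 0 := (Real.sqrt_pos.2 (by norm_num)).ne'
  exact_mod_cast this

theorem det_hypP_ne_zero : hypP.det ≠ 0 := by
  have : hypP.det = -(2 * (√3 : ℂ)) := by
    simp [hypP, Matrix.det_succ_row_zero, Fin.sum_univ_succ, Fin.succAbove]
    ring
  rw [this, neg_ne_zero]
  exact mul_ne_zero two_ne_zero ofReal_sqrt_three_ne_zero

theorem hypP_mul_rhoT : hypP * rhoT 1 = rhoHyp matT * hypP := by
  rw [rhoHyp_matT]
  ext i j
  fin_cases i <;> fin_cases j <;>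
    simp [hypP, rhoT, Matrix.mul_apply, Fin.sum_univ_four] <;> ring

theorem hypP_mul_rhoU : hypP * rhoU 1 = rhoHyp matU * hypP := by
  rw [rhoHyp_matU]
  ext i j
  fin_cases i <;> fin_cases j <;>
    simp [hypP, rhoU, Matrix.mul_apply, Fin.sum_univ_four] <;> ring_nf <;>
    (rw [sqrt_three_sq]; norm_num)

theorem hypP_mul_rhoA : hypP * rhoA 1 = rhoHyp matA * hypP := by
  rw [rhoHyp_matA]
  ext i j
  rw [Matrix.diagonal_mul]
  fin_cases i <;> fin_cases j <;>
    simp [hypP, rhoA, Matrix.mul_apply, Fin.sum_univ_four] <;> ring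

theorem hypP_mul_rhoL : hypP * rhoL 1 = rhoHyp matL * hypP := by
  rw [rhoHyp_matL]
  ext i j
  fin_cases i <;> fin_cases j <;>
    simp [hypP, rhoL, Matrix.mul_apply, Fin.sum_univ_four] <;> ring_nf <;>
    (rw [sqrt_three_sq]; norm_num)

theorem hypP_mul_rho {ρ : Bi3 →* SL(4, ℂ)} (hρ : IsRho 1 ρ) (g : SL(2, O3)) :
    hypP * (ρ (QuotientGroup.mk g) : Matrix (Fin 4) (Fin 4) ℂ) = rhoHyp g * hypP := by
  have hg : g ∈ Subgroup.closure {matT, matU, matA, matL} := by rw [closure_eq_top]; trivial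
  obtain ⟨hT, hU, hA, hL⟩ := hρ
  induction hg using Subgroup.closure_induction with
  | mem x hx =>
    rcases hx with rfl | rfl | rfl | rfl
    · rw [← hypP_mul_rhoT, ← hT]; rfl
    · rw [← hypP_mul_rhoU, ← hU]; rfl
    · rw [← hypP_mul_rhoA, ← hA]; rfl
    · rw [← hypP_mul_rhoL, ← hL]; rfl
  | one => simp [rhoHyp_one]
  | mul x y _ _ hx hy =>
    rw [QuotientGroup.mk_mul, map_mul, Matrix.SpecialLinearGroup.coe_mul, rhoHyp_mul, ← mul_assoc,
      hx, mul_assoc, hy, mul_assoc]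
  | inv x _ hx =>
    have e1 : rhoHyp x⁻¹ * rhoHyp x = 1 := by rw [← rhoHyp_mul, inv_mul_cancel, rhoHyp_one]
    have e2 : (ρ (QuotientGroup.mk x) : Matrix (Fin 4) (Fin 4) ℂ) *
        (ρ (QuotientGroup.mk x⁻¹) : Matrix (Fin 4) (Fin 4) ℂ) = 1 := by
      rw [← Matrix.SpecialLinearGroup.coe_mul, ← map_mul, ← QuotientGroup.mk_mul, mul_inv_cancel,
        QuotientGroup.mk_one, map_one, Matrix.SpecialLinearGroup.coe_one]
    calc _ = rhoHyp x⁻¹ * (rhoHyp x * hypP) *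
          (ρ (QuotientGroup.mk x⁻¹) : Matrix (Fin 4) (Fin 4) ℂ) := by
          rw [← mul_assoc, e1, one_mul]
      _ = rhoHyp x⁻¹ * hypP := by rw [← hx, mul_assoc, mul_assoc, e2, mul_one]

theorem isConjugateToHyp {ρ : Bi3 →* SL(4, ℂ)} (hρ : IsRho 1 ρ) : IsConjugateToHyp ρ := by
  refine ⟨Matrix.GeneralLinearGroup.mkOfDetNeZero hypP det_hypP_ne_zero, fun g => ?_⟩
  have e := hypP_mul_rho hρ g
  set P := Matrix.GeneralLinearGroup.mkOfDetNeZero hypP det_hypP_ne_zero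
  rw [show (P : Matrix (Fin 4) (Fin 4) ℂ) = hypP from rfl, e, mul_assoc,
    show hypP = (P : Matrix (Fin 4) (Fin 4) ℂ) from rfl, ← Units.val_mul, mul_inv_cancel,
    Units.val_one, mul_one]

/-- The diagonal of the Lorentz form. -/
def lorentzForm : Fin 4 → ℝ := ![-1, 1, 1, 1]

/-- The matrix of the form preserved by `ρ_1`. -/
def formOne : Matrix (Fin 4) (Fin 4) ℂ :=
  !![0, 1, 1, 1; 1, 1, -1, -1; 1, -1, 1, -1; 1, -1, -1, 1]

theorem formOne_eq : formOne = hypPᴴ * Matrix.diagonal (fun i => (lorentzForm i : ℂ)) * hypP := by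
  ext i j
  rw [Matrix.mul_apply]
  simp only [Matrix.mul_diagonal, Fin.sum_univ_four, Matrix.conjTranspose_apply]
  fin_cases i <;> fin_cases j <;> simp [formOne, hypP, lorentzForm, ← sq, sqrt_three_sq] <;> norm_num

/-- At `u = 1` the eigenbasis is unavailable; the form is the pullback of `-det` under the
intertwiner `hypP`. -/
theorem exists_form_one {ρ : Bi3 →* SL(4, ℂ)} (hρ : IsRho 1 ρ) :
    ∃ H : Matrix (Fin 4) (Fin 4) ℂ, H ≠ 0 ∧ PreservesForm ρ H ∧ HasSignature H 3 1 := by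
  obtain ⟨hT, hU, hA, hL⟩ := hρ
  refine ⟨formOne, ?_, preservesForm_of_generators ?_ ?_ ?_ ?_ ?_, ?_⟩
  · intro h
    have := congrFun (congrFun h 0) 1
    simp [formOne] at this
  · ext i j
    fin_cases i <;> fin_cases j <;> simp [formOne]
  · change _ᴴ * formOne * _ = formOne
    rw [hT]
    ext i j
    fin_cases i <;> fin_cases j <;>
      simp [formOne, rhoT, Matrix.mul_apply, Fin.sum_univ_four, Complex.conj_ofNat] <;> norm_num
  · change _ᴴ * formOne * _ = formOne
    rw [hU]
    ext i j
    fin_cases i <;> fin_cases j <;>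
      simp [formOne, rhoU, Matrix.mul_apply, Fin.sum_univ_four, Complex.conj_ofNat] <;> norm_num
  · change _ᴴ * formOne * _ = formOne
    rw [hA]
    ext i j
    fin_cases i <;> fin_cases j <;>
      simp [formOne, rhoA, Matrix.mul_apply, Fin.sum_univ_four, Complex.conj_ofNat] <;> norm_num
  · change _ᴴ * formOne * _ = formOne
    rw [hL]
    ext i j
    fin_cases i <;> fin_cases j <;>
      simp [formOne, rhoL, Matrix.mul_apply, Fin.sum_univ_four, Complex.conj_ofNat] <;> norm_num
  · set P := Matrix.GeneralLinearGroup.mkOfDetNeZero hypP det_hypP_ne_zero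
    refine hasSignature_three_one P⁻¹ (d := lorentzForm) ?_ ?_ ?_ ?_ ?_
    · rw [formOne_eq]
      have := form_conj_restore P⁻¹ (Matrix.diagonal (fun i => (lorentzForm i : ℂ)))
      rwa [inv_inv] at this
    all_goals simp [lorentzForm]

theorem exists_form {u : ℂ} (hu : ‖u‖ = 1) (h1 : u ≠ -1) {ρ : Bi3 →* SL(4, ℂ)}
    (hρ : IsRho u ρ) : ∃ H : Matrix (Fin 4) (Fin 4) ℂ, H ≠ 0 ∧ PreservesForm ρ H ∧
      (1 / 4 < u.re → HasSignature H 3 1) ∧ (u.re < 1 / 4 → HasSignature H 4 0) := by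
  by_cases h : u = 1
  · subst h
    obtain ⟨H, h2, h3, h4⟩ := exists_form_one hρ
    refine ⟨H, h2, h3, fun _ => h4, fun h5 => ?_⟩
    norm_num at h5
  · exact exists_form_of_ne_one hu h1 h hρ

end Bianchi
end

noncomputable section
namespace Bianchi

/-! ### Real polynomial functions on a real algebra -/

section PolyFun

variable {R : Type*} [Ring R] [Algebra ℝ R]

/-- The algebra of real polynomial functions on `R`. -/
def polyFun (R : Type*) [Ring R] [Algebra ℝ R] : Subalgebra ℝ (R → ℝ) :=
  Algebra.adjoin ℝ {f | ∃ ℓ : R →ₗ[ℝ] ℝ, f = ⇑ℓ}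

theorem linear_mem_polyFun (ℓ : R →ₗ[ℝ] ℝ) : ⇑ℓ ∈ polyFun R :=
  Algebra.subset_adjoin ⟨ℓ, rfl⟩

theorem polyFun_comp {f : R → ℝ} (hf : f ∈ polyFun R) (φ : R →ₗ[ℝ] R) :
    (fun M => f (φ M)) ∈ polyFun R := by
  induction hf using Algebra.adjoin_induction with
  | mem f h =>
    obtain ⟨ℓ, rfl⟩ := h
    exact linear_mem_polyFun (ℓ ∘ₗ φ)
  | algebraMap r => exact (polyFun R).algebraMap_mem r
  | add f g _ _ h₁ h₂ => exact add_mem h₁ h₂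
  | mul f g _ _ h₁ h₂ => exact mul_mem h₁ h₂

/-- Serves to express the isometry condition `g* J g = J` by polynomial functions. -/
theorem bilinear_mem_polyFun [FiniteDimensional ℝ R] (B : R →ₗ[ℝ] R →ₗ[ℝ] ℝ) :
    (fun M => B M M) ∈ polyFun R := by
  let b := Module.finBasis ℝ R
  have h : (fun M => B M M) =
      ∑ i, ⇑(b.coord i) * ⇑(B (b i)) := by
    funext M
    have e : B M = ∑ i, b.repr M i • B (b i) := by
      conv_lhs => rw [← b.sum_repr M]
      simp only [map_sum, map_smul]
    rw [e]
    simp [LinearMap.sum_apply]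
  rw [h]
  exact sum_mem fun i _ => mul_mem (linear_mem_polyFun _) (linear_mem_polyFun _)

/-- The curve `γ` has derivative `V` at `t`, tested against linear functionals. -/
def HasWeakDerivAt (γ : ℝ → R) (V : R) (t : ℝ) : Prop :=
  ∀ ℓ : R →ₗ[ℝ] ℝ, HasDerivAt (fun s => ℓ (γ s)) (ℓ V) t

theorem HasWeakDerivAt.map {γ : ℝ → R} {V : R} {t : ℝ} (h : HasWeakDerivAt γ V t)
    (φ : R →ₗ[ℝ] R) : HasWeakDerivAt (fun s => φ (γ s)) (φ V) t := fun ℓ => h (ℓ ∘ₗ φ)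

theorem HasWeakDerivAt.mul_const {γ : ℝ → R} {V : R} {t : ℝ} (h : HasWeakDerivAt γ V t)
    (M : R) : HasWeakDerivAt (fun s => γ s * M) (V * M) t :=
  h.map (LinearMap.mulRight ℝ M)

theorem hasWeakDerivAt_add {γ δ : ℝ → R} {V W : R} {t : ℝ} (h : HasWeakDerivAt γ V t)
    (h' : HasWeakDerivAt δ W t) : HasWeakDerivAt (fun s => γ s + δ s) (V + W) t := by
  intro ℓ
  simp only [map_add]
  exact (h ℓ).add (h' ℓ)

theorem hasWeakDerivAt_smul {φ : ℝ → ℝ} {φ' t : ℝ} (h : HasDerivAt φ φ' t) (N : R) :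
    HasWeakDerivAt (fun s => φ s • N) (φ' • N) t := by
  intro ℓ
  simpa only [map_smul, smul_eq_mul] using h.mul_const (ℓ N)

theorem hasWeakDerivAt_const (N : R) (t : ℝ) : HasWeakDerivAt (fun _ => N) 0 t := by
  intro ℓ
  simpa using hasDerivAt_const t (ℓ N)

theorem hasWeakDerivAt_line (M V : R) : HasWeakDerivAt (fun t : ℝ => M + t • V) V 0 := by
  simpa using hasWeakDerivAt_add (hasWeakDerivAt_const M 0)
    (hasWeakDerivAt_smul (hasDerivAt_id (0 : ℝ)) V)

/-- A polynomial function is differentiable, and its directional derivatives are polynomial. -/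
theorem exists_differential {f : R → ℝ} (hf : f ∈ polyFun R) :
    ∃ F : R → R →ₗ[ℝ] ℝ, (∀ φ : R →ₗ[ℝ] R, (fun M => F M (φ M)) ∈ polyFun R) ∧
      ∀ (γ : ℝ → R) (V : R) (t : ℝ), HasWeakDerivAt γ V t →
        HasDerivAt (fun s => f (γ s)) (F (γ t) V) t := by
  induction hf using Algebra.adjoin_induction with
  | mem f h =>
    obtain ⟨ℓ, rfl⟩ := h
    exact ⟨fun _ => ℓ, fun φ => linear_mem_polyFun (ℓ ∘ₗ φ), fun γ V t h => h ℓ⟩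
  | algebraMap r =>
    refine ⟨fun _ => 0, fun φ => ?_, fun γ V t _ => ?_⟩
    · exact zero_mem (polyFun R)
    · simpa using hasDerivAt_const t r
  | add f g _ _ h₁ h₂ =>
    obtain ⟨F, hF, hF'⟩ := h₁
    obtain ⟨G, hG, hG'⟩ := h₂
    exact ⟨fun M => F M + G M, fun φ => add_mem (hF φ) (hG φ),
      fun γ V t h => (hF' γ V t h).add (hG' γ V t h)⟩
  | mul f g hf hg h₁ h₂ =>
    obtain ⟨F, hF, hF'⟩ := h₁
    obtain ⟨G, hG, hG'⟩ := h₂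
    refine ⟨fun M => g M • F M + f M • G M, fun φ => ?_, fun γ V t h => ?_⟩
    · exact add_mem (mul_mem hg (hF φ)) (mul_mem hf (hG φ))
    · have := (hF' γ V t h).mul (hG' γ V t h)
      refine this.congr_deriv ?_
      simp
      ring

theorem polyFun_analyticAt {f : R → ℝ} (hf : f ∈ polyFun R) {γ : ℝ → R} {t : ℝ}
    (hγ : ∀ ℓ : R →ₗ[ℝ] ℝ, AnalyticAt ℝ (fun s => ℓ (γ s)) t) :
    AnalyticAt ℝ (fun s => f (γ s)) t := by
  induction hf using Algebra.adjoin_induction with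
  | mem f h =>
    obtain ⟨ℓ, rfl⟩ := h
    exact hγ ℓ
  | algebraMap r => exact analyticAt_const
  | add f g _ _ h₁ h₂ => exact h₁.add h₂
  | mul f g _ _ h₁ h₂ => exact h₁.mul h₂

/-! ### Zariski closures and their Lie algebras -/

/-- The Zariski closure of `S`. -/
def zariskiClosure (S : Set R) : Set R :=
  {M | ∀ f ∈ polyFun R, (∀ g ∈ S, f g = 0) → f M = 0}

theorem subset_zariskiClosure (S : Set R) : S ⊆ zariskiClosure S := fun _ hg _ _ h => h _ hg

/-- The Lie algebra of the Zariski closure of `S`: those `X` such that the vector field `M ↦ X M`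
is tangent to the closure at the points of `S`. -/
def zariskiLie (S : Set R) : Submodule ℝ R where
  carrier := {X | ∀ f ∈ polyFun R, (∀ g ∈ S, f g = 0) → ∀ g ∈ S,
    HasDerivAt (fun t : ℝ => f (g + t • (X * g))) 0 0}
  zero_mem' := by
    intro f _ _ g _
    simpa using hasDerivAt_const (0 : ℝ) (f g)
  add_mem' := by
    intro X Y hX hY f hf hS g hg
    obtain ⟨F, -, hF⟩ := exists_differential hf
    have h := fun V => hF _ V 0 (hasWeakDerivAt_line g V)
    simp only [zero_smul, add_zero] at h
    have e₁ := (h (X * g)).unique (hX f hf hS g hg)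
    have e₂ := (h (Y * g)).unique (hY f hf hS g hg)
    refine (h ((X + Y) * g)).congr_deriv ?_
    rw [add_mul, map_add, e₁, e₂, add_zero]
  smul_mem' := by
    intro c X hX f hf hS g hg
    obtain ⟨F, -, hF⟩ := exists_differential hf
    have h := fun V => hF _ V 0 (hasWeakDerivAt_line g V)
    simp only [zero_smul, add_zero] at h
    have e₁ := (h (X * g)).unique (hX f hf hS g hg)
    refine (h ((c • X) * g)).congr_deriv ?_
    rw [smul_mul_assoc, map_smul, e₁, smul_zero]

variable {S : Set R}

/-- Left multiplication by `h` preserves `S` and sends polynomial functions to polynomial functions;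
testing `X` on `M ↦ f (h * M)` at `h' * g` tests its conjugate on `f` at `g`. -/
theorem conj_mem_zariskiLie (hmul : ∀ g ∈ S, ∀ h ∈ S, g * h ∈ S) {X h h' : R}
    (hX : X ∈ zariskiLie S) (hh : h ∈ S) (hh' : h' ∈ S) (hinv : h * h' = 1) :
    h * X * h' ∈ zariskiLie S := by
  intro f hf hS g hg
  have := hX (fun M => f (h * M)) (polyFun_comp hf (LinearMap.mulLeft ℝ h))
    (fun M hM => hS _ (hmul _ hh _ hM)) (h' * g) (hmul _ hh' _ hg)
  refine this.congr_of_eventuallyEq (Filter.Eventually.of_forall fun t => ?_)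
  simp only [mul_add, ← mul_assoc, hinv, one_mul, mul_smul_comm]

theorem mem_zariskiLie_of_curve {X : R} {η : ℝ → R} (h0 : η 0 = 1)
    (hd : HasWeakDerivAt η X 0) (hη : ∀ t, ∀ h ∈ S, η t * h ∈ zariskiClosure S) :
    X ∈ zariskiLie S := by
  intro f hf hS g hg
  obtain ⟨F, -, hF⟩ := exists_differential hf
  have h := hF _ _ 0 (hasWeakDerivAt_line g (X * g))
  simp only [zero_smul, add_zero] at h
  have h' := hF _ _ 0 (hd.mul_const g)
  simp only [h0, one_mul] at h'
  have h'' : HasDerivAt (fun s => f (η s * g)) 0 0 := by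
    have e : (fun s => f (η s * g)) = fun _ => 0 := funext fun s => hη s g hg f hf hS
    rw [e]
    exact hasDerivAt_const _ _
  exact h.congr_deriv (h'.unique h'')

/-- Flows of elements of the Lie algebra preserve the Zariski closure. -/
theorem flow_mul_mem_zariskiClosure {X : R} (hX : X ∈ zariskiLie S) {η : ℝ → R} (h0 : η 0 = 1)
    (hd : ∀ t, HasWeakDerivAt η (X * η t) t)
    (ha : ∀ (ℓ : R →ₗ[ℝ] ℝ) (t : ℝ), AnalyticAt ℝ (fun s => ℓ (η s)) t) {M : R}
    (hM : M ∈ zariskiClosure S) (t : ℝ) : η t * M ∈ zariskiClosure S := by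
  -- Differentiating along the flow replaces `f` by `N ↦ F N (X * N)`, which is polynomial and
  -- vanishes on `S` because `X` is tangent there. So all derivatives at `0` vanish, and analyticity
  -- finishes the proof.
  have key : ∀ (n : ℕ) (f : R → ℝ), f ∈ polyFun R → (∀ g ∈ S, f g = 0) →
      iteratedDeriv n (fun t => f (η t * M)) 0 = 0 := by
    intro n
    induction n with
    | zero =>
      intro f hf hS
      simpa [h0] using hM f hf hS
    | succ n ih =>
      intro f hf hS
      obtain ⟨F, hF, hF'⟩ := exists_differential hf
      rw [iteratedDeriv_succ']
      have e : deriv (fun t => f (η t * M)) = fun t => F (η t * M) (X * (η t * M)) := by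
        funext t
        rw [← mul_assoc]
        exact (hF' _ _ t ((hd t).mul_const M)).deriv
      rw [e]
      refine ih (fun N => F N (X * N)) (hF (LinearMap.mulLeft ℝ X)) fun g hg => ?_
      have h := hF' _ _ 0 (hasWeakDerivAt_line g (X * g))
      simp only [zero_smul, add_zero] at h
      exact h.unique (hX f hf hS g hg)
  intro f hf hS
  have han : ∀ t, AnalyticAt ℝ (fun s => f (η s * M)) t := fun t =>
    polyFun_analyticAt hf fun ℓ => ha (ℓ ∘ₗ LinearMap.mulRight ℝ M) t
  have hord : analyticOrderAt (fun s => f (η s * M)) 0 = ⊤ := by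
    refine ENat.eq_top_iff_forall_ge.2 fun n => ?_
    rw [natCast_le_analyticOrderAt_iff_iteratedDeriv_eq_zero (han 0)]
    exact fun i _ => key i f hf hS
  rw [analyticOrderAt_eq_top] at hord
  have : (fun s => f (η s * M)) = fun _ => 0 :=
    AnalyticOnNhd.eq_of_eventuallyEq (fun t _ => han t) analyticOnNhd_const hord
  exact congrFun this t

/-- A polynomial function along a curve that is a Laurent polynomial in the parameter vanishes as
soon as it has infinitely many zeros. -/
theorem polyFun_eq_zero_of_infinite {f : R → ℝ} (hf : f ∈ polyFun R) {C : Set ℂ} (hC : (0 : ℂ) ∉ C)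
    {γ : ℂ → R}
    (hγ : ∀ ℓ : R →ₗ[ℝ] ℝ, ∃ a b c : ℂ, ∀ z ∈ C, (ℓ (γ z) : ℂ) = a * z + b * z⁻¹ + c)
    (hinf : {z ∈ C | f (γ z) = 0}.Infinite) {z : ℂ} (hz : z ∈ C) : f (γ z) = 0 := by
  -- Along the curve `f` is a Laurent polynomial in `z`; a power of `z` clears the denominators, and
  -- a polynomial with infinitely many roots is zero.
  have key : ∃ (N : ℕ) (p : Polynomial ℂ), ∀ z ∈ C, (f (γ z) : ℂ) * z ^ N = p.eval z := by
    clear hinf hz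
    induction hf using Algebra.adjoin_induction with
    | mem f h =>
      obtain ⟨ℓ, rfl⟩ := h
      obtain ⟨a, b, c, h⟩ := hγ ℓ
      refine ⟨1, .C a * .X ^ 2 + .C b + .C c * .X, fun z hz => ?_⟩
      have : z ≠ 0 := fun h => hC (h ▸ hz)
      rw [h z hz]
      simp
      field_simp
    | algebraMap r => exact ⟨0, .C (r : ℂ), fun z _ => by simp⟩
    | add f g _ _ h₁ h₂ =>
      obtain ⟨N, p, hp⟩ := h₁
      obtain ⟨N', q, hq⟩ := h₂
      refine ⟨N + N', p * .X ^ N' + q * .X ^ N, fun z hz => ?_⟩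
      simp only [Pi.add_apply, Complex.ofReal_add, Polynomial.eval_add, Polynomial.eval_mul,
        Polynomial.eval_pow, Polynomial.eval_X, ← hp z hz, ← hq z hz]
      ring
    | mul f g _ _ h₁ h₂ =>
      obtain ⟨N, p, hp⟩ := h₁
      obtain ⟨N', q, hq⟩ := h₂
      refine ⟨N + N', p * q, fun z hz => ?_⟩
      simp only [Pi.mul_apply, Complex.ofReal_mul, Polynomial.eval_mul, ← hp z hz, ← hq z hz]
      ring
  obtain ⟨N, p, hp⟩ := key
  have hp0 : p = 0 := by
    refine Polynomial.eq_zero_of_infinite_isRoot p (hinf.mono fun z hz => ?_)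
    change p.eval z = 0
    rw [← hp z hz.1, hz.2]
    simp
  have := hp z hz
  rw [hp0, Polynomial.eval_zero] at this
  have hz0 : z ≠ 0 := fun h => hC (h ▸ hz)
  simpa [hz0] using this

end PolyFun

end Bianchi
end

noncomputable section
namespace Bianchi

theorem curve_mul_mem_zariskiClosure {R : Type*} [Ring R] [Algebra ℝ R] {S : Set R} {C : Set ℂ}
    (hC : (0 : ℂ) ∉ C) {γ : ℂ → R}
    (hγ : ∀ ℓ : R →ₗ[ℝ] ℝ, ∃ a b c : ℂ, ∀ z ∈ C, (ℓ (γ z) : ℂ) = a * z + b * z⁻¹ + c)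
    (hmul : ∀ g ∈ S, ∀ h ∈ S, g * h ∈ S) (hinf : {z ∈ C | γ z ∈ S}.Infinite) {z : ℂ}
    (hz : z ∈ C) {h : R} (hh : h ∈ S) : γ z * h ∈ zariskiClosure S := by
  intro f hf hS
  refine polyFun_eq_zero_of_infinite (polyFun_comp hf (LinearMap.mulRight ℝ h)) hC hγ
    (hinf.mono fun w hw => ⟨hw.1, hS _ (hmul _ hw.2 _ hh)⟩) hz

/-! ### The normalized image -/

/-- The matrix of the invariant form in the normalized eigenbasis. -/
def formJ : Matrix (Fin 4) (Fin 4) ℂ := Matrix.diagonal ![-1, 1, 1, 1]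

/-- `ρ_u(A)` in the normalized eigenbasis. -/
def stdA (a b : ℝ) : Matrix (Fin 4) (Fin 4) ℂ :=
  !![(a : ℂ), b, b, b;
     -b, -(a + 1) / 3, (2 - a) / 3, -(a + 1) / 3;
     -b, (2 - a) / 3, -(a + 1) / 3, -(a + 1) / 3;
     -b, -(a + 1) / 3, -(a + 1) / 3, (2 - a) / 3]

/-- `S` is a group of isometries of `formJ` that contains the generators of the image of `ρ_u`,
written in the normalized eigenbasis. -/
structure IsNormalizedGroup (u : ℂ) (b : ℝ) (S : Set (Matrix (Fin 4) (Fin 4) ℂ)) : Prop where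
  norm_eq : ‖u‖ = 1
  lt_re : 1 / 4 < u.re
  re_lt : u.re < 1
  b_pos : 0 < b
  b_sq : b ^ 2 = (eigParam u ^ 2 - 1) / 3
  one_mem : 1 ∈ S
  mul_mem : ∀ g ∈ S, ∀ h ∈ S, g * h ∈ S
  exists_inv : ∀ g ∈ S, ∃ h ∈ S, g * h = 1
  T_mem : Matrix.diagonal (eigT u) ∈ S
  U_mem : Matrix.diagonal (eigU u) ∈ S
  A_mem : stdA (eigParam u) b ∈ S
  form : ∀ g ∈ S, gᴴ * formJ * g = formJ

theorem stdA_mul_self {a b : ℝ} (hb : b ^ 2 = (a ^ 2 - 1) / 3) : stdA a b * stdA a b = 1 := by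
  have hb' : (b : ℂ) ^ 2 = ((a : ℂ) ^ 2 - 1) / 3 := by exact_mod_cast congrArg Complex.ofReal hb
  ext i j
  fin_cases i <;> fin_cases j <;>
    simp [stdA, Matrix.mul_apply, Fin.sum_univ_four] <;>
    first | ring1 | linear_combination (-3 : ℂ) * hb' | linear_combination -hb'

section Normalized

variable {u : ℂ} {b : ℝ} {S : Set (Matrix (Fin 4) (Fin 4) ℂ)}

theorem IsNormalizedGroup.ne_one (hS : IsNormalizedGroup u b S) : u ≠ 1 := by
  rintro rfl
  have := hS.re_lt
  simp at this

theorem IsNormalizedGroup.ne_zero (hS : IsNormalizedGroup u b S) : u ≠ 0 :=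
  ne_zero_of_norm_eq_one hS.norm_eq

theorem IsNormalizedGroup.pow_mem (hS : IsNormalizedGroup u b S)
    {g : Matrix (Fin 4) (Fin 4) ℂ} (hg : g ∈ S) (n : ℕ) : g ^ n ∈ S := by
  induction n with
  | zero => simpa using hS.one_mem
  | succ n ih => rw [pow_succ]; exact hS.mul_mem _ ih _ hg

/-- Apart from `1`, the roots of unity of order at most `4` have non-positive real part. The bound
`4` is the largest difference between the exponents of `u` by which `T` or `U` acts on two matrix
entries. -/
theorem IsNormalizedGroup.pow_ne_one (hS : IsNormalizedGroup u b S) {n : ℕ} (hn : 0 < n)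
    (hn' : n ≤ 4) : u ^ n ≠ 1 := by
  have h := sq_add_one_eq hS.norm_eq
  have h0 := hS.ne_zero
  have hre := hS.lt_re
  have h1 := hS.ne_one
  have hx : ∀ {x : ℝ}, (x : ℂ) = 0 → x = 0 := fun h => by exact_mod_cast h
  intro hu
  interval_cases n
  · exact h1 (by simpa using hu)
  · have e : (u - 1) * (u + 1) = 0 := by linear_combination hu
    have e' := (mul_eq_zero.1 e).resolve_left (sub_ne_zero.2 h1)
    have := congrArg Complex.re e'
    simp at this
    linarith
  · have e : (u - 1) * (u ^ 2 + u + 1) = 0 := by linear_combination hu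
    have e' := (mul_eq_zero.1 e).resolve_left (sub_ne_zero.2 h1)
    have e2 : ((2 * u.re + 1 : ℝ) : ℂ) * u = 0 := by push_cast; linear_combination e' - h
    have := hx ((mul_eq_zero.1 e2).resolve_right h0)
    linarith
  · have e : (u - 1) * ((u + 1) * (u ^ 2 + 1)) = 0 := by linear_combination hu
    rcases mul_eq_zero.1 ((mul_eq_zero.1 e).resolve_left (sub_ne_zero.2 h1)) with e' | e'
    · have := congrArg Complex.re e'
      simp at this
      linarith
    · rw [e'] at h
      have e2 : ((2 * u.re : ℝ) : ℂ) * u = 0 := by push_cast; exact h.symm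
      have := hx ((mul_eq_zero.1 e2).resolve_right h0)
      linarith

theorem IsNormalizedGroup.one_lt (hS : IsNormalizedGroup u b S) : 1 < eigParam u :=
  one_lt_eigParam hS.norm_eq hS.ne_one hS.lt_re

/-- The Lie algebra of the closure consists of skew-Hermitian matrices for `formJ`. -/
theorem IsNormalizedGroup.skew (hS : IsNormalizedGroup u b S) {X : Matrix (Fin 4) (Fin 4) ℂ}
    (hX : X ∈ zariskiLie S) : Xᴴ * formJ + formJ * X = 0 := by
  have key : ∀ ℓ : Matrix (Fin 4) (Fin 4) ℂ →ₗ[ℝ] ℝ, ℓ (Xᴴ * formJ + formJ * X) = 0 := by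
    intro ℓ
    let B : Matrix (Fin 4) (Fin 4) ℂ →ₗ[ℝ] Matrix (Fin 4) (Fin 4) ℂ →ₗ[ℝ] ℝ :=
      LinearMap.mk₂ ℝ (fun M N => ℓ (Mᴴ * formJ * N))
        (by intro M M' N; simp [Matrix.conjTranspose_add, add_mul])
        (by intro c M N; simp [Matrix.conjTranspose_smul])
        (by intro M N N'; simp [mul_add])
        (by intro c M N; simp)
    have hf : (fun M : Matrix (Fin 4) (Fin 4) ℂ => B M M - ℓ formJ) ∈
        polyFun (Matrix (Fin 4) (Fin 4) ℂ) :=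
      sub_mem (bilinear_mem_polyFun B) ((polyFun _).algebraMap_mem (ℓ formJ))
    have hd := hX _ hf (fun g hg => by simp [B, hS.form g hg]) 1 hS.one_mem
    have hd' : HasDerivAt (fun t : ℝ => t * ℓ (Xᴴ * formJ + formJ * X) +
        t ^ 2 * ℓ (Xᴴ * formJ * X)) (ℓ (Xᴴ * formJ + formJ * X)) 0 := by
      refine (((hasDerivAt_id (0 : ℝ)).mul_const (ℓ (Xᴴ * formJ + formJ * X))).add
        ((hasDerivAt_pow 2 (0 : ℝ)).mul_const (ℓ (Xᴴ * formJ * X)))).congr_deriv ?_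
      simp
    refine hd'.unique (hd.congr_of_eventuallyEq (Filter.Eventually.of_forall fun t => ?_))
    simp [B, mul_add]
    ring
  ext i j
  apply Complex.ext
  · exact key (Complex.reLm ∘ₗ (Matrix.entryLinearMap ℂ ℂ i j).restrictScalars ℝ)
  · exact key (Complex.imLm ∘ₗ (Matrix.entryLinearMap ℂ ℂ i j).restrictScalars ℝ)

/-- The complexification of the Lie algebra. -/
def complexLie (S : Set (Matrix (Fin 4) (Fin 4) ℂ)) : Submodule ℂ (Matrix (Fin 4) (Fin 4) ℂ) :=
  Submodule.span ℂ (zariskiLie S)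

theorem exists_of_mem_complexLie {X : Matrix (Fin 4) (Fin 4) ℂ} (hX : X ∈ complexLie S) :
    ∃ Y ∈ zariskiLie S, ∃ Z ∈ zariskiLie S, X = Y + Complex.I • Z := by
  induction hX using Submodule.span_induction with
  | mem x h => exact ⟨x, h, 0, zero_mem _, by simp⟩
  | zero => exact ⟨0, zero_mem _, 0, zero_mem _, by simp⟩
  | add x y _ _ hx hy =>
    obtain ⟨Y, hY, Z, hZ, rfl⟩ := hx
    obtain ⟨Y', hY', Z', hZ', rfl⟩ := hy
    exact ⟨Y + Y', add_mem hY hY', Z + Z', add_mem hZ hZ', by module⟩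
  | smul c x _ hx =>
    obtain ⟨Y, hY, Z, hZ, rfl⟩ := hx
    refine ⟨c.re • Y - c.im • Z, sub_mem (Submodule.smul_mem _ _ hY) (Submodule.smul_mem _ _ hZ),
      c.im • Y + c.re • Z, add_mem (Submodule.smul_mem _ _ hY) (Submodule.smul_mem _ _ hZ), ?_⟩
    ext i j
    simp only [Matrix.smul_apply, Matrix.add_apply, Matrix.sub_apply, smul_eq_mul,
      Complex.real_smul]
    conv_lhs => rw [← Complex.re_add_im c]
    linear_combination (c.im : ℂ) * Z i j * Complex.I_sq

theorem formJ_mul_self : formJ * formJ = 1 := by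
  rw [formJ, Matrix.diagonal_mul_diagonal, ← Matrix.diagonal_one]
  congr 1
  ext i
  fin_cases i <;> simp

/-- The skew elements form a real form: if `Y`, `Z` and `Y + iZ` are all skew for `J = formJ`, then
`2i J Z = 0`, so `Z = 0`. -/
theorem IsNormalizedGroup.mem_zariskiLie (hS : IsNormalizedGroup u b S)
    {X : Matrix (Fin 4) (Fin 4) ℂ} (hX : X ∈ complexLie S) (hsk : Xᴴ * formJ + formJ * X = 0) :
    X ∈ zariskiLie S := by
  obtain ⟨Y, hY, Z, hZ, rfl⟩ := exists_of_mem_complexLie hX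
  have hY' := hS.skew hY
  have hZ' := hS.skew hZ
  have e : (2 : ℂ) • (formJ * Z) = 0 := by
    have e₁ : Zᴴ * formJ = - (formJ * Z) := eq_neg_of_add_eq_zero_left hZ'
    have e₂ : Yᴴ * formJ = - (formJ * Y) := eq_neg_of_add_eq_zero_left hY'
    simp only [Matrix.conjTranspose_add, Matrix.conjTranspose_smul, add_mul, mul_add,
      smul_mul_assoc, mul_smul_comm, e₁, e₂, Complex.star_def, Complex.conj_I] at hsk
    have e₃ : Complex.I • ((2 : ℂ) • (formJ * Z)) = 0 := by
      rw [← hsk]; module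
    exact (smul_eq_zero.1 e₃).resolve_left Complex.I_ne_zero
  have e' : formJ * Z = 0 := (smul_eq_zero.1 e).resolve_left two_ne_zero
  have e'' : Z = 0 := by
    rw [← one_mul Z, ← formJ_mul_self, mul_assoc, e', mul_zero]
  simpa [e''] using hY

theorem IsNormalizedGroup.conj_mem (hS : IsNormalizedGroup u b S)
    {X h h' : Matrix (Fin 4) (Fin 4) ℂ} (hX : X ∈ complexLie S) (hh : h ∈ S) (hinv : h * h' = 1) :
    h * X * h' ∈ complexLie S := by
  have hh' : h' ∈ S := by
    obtain ⟨k, hk, e⟩ := hS.exists_inv h hh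
    have e' : k * h = 1 := mul_eq_one_comm.1 e
    rwa [show h' = k by rw [← one_mul h', ← e', mul_assoc, hinv, mul_one]]
  induction hX using Submodule.span_induction with
  | mem x hx => exact Submodule.subset_span (conj_mem_zariskiLie hS.mul_mem hx hh hh' hinv)
  | zero => simp
  | add x y _ _ hx hy => rw [mul_add, add_mul]; exact add_mem hx hy
  | smul c x _ hx =>
    rw [mul_smul_comm, smul_mul_assoc]
    exact Submodule.smul_mem _ _ hx

/-! ### Root spaces -/

theorem IsNormalizedGroup.scale_mem (hS : IsNormalizedGroup u b S) {d : Fin 4 → ℂ}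
    (hd : Matrix.diagonal d ∈ S) (hd0 : ∀ i, d i ≠ 0) {X : Matrix (Fin 4) (Fin 4) ℂ}
    (hX : X ∈ complexLie S) : (Matrix.of fun i j => d i * (d j)⁻¹ * X i j) ∈ complexLie S := by
  have h := hS.conj_mem (h' := Matrix.diagonal fun i => (d i)⁻¹) hX hd (by
    rw [Matrix.diagonal_mul_diagonal, ← Matrix.diagonal_one]
    congr 1
    ext i
    exact mul_inv_cancel₀ (hd0 i))
  convert h using 1
  ext i j
  rw [Matrix.mul_diagonal, Matrix.diagonal_mul, Matrix.of_apply]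
  ring

/-- The exponents of `u` on the basis vectors under `(T, U)` are `(0,0)`, `(1,-1)`, `(-1,0)`,
`(0,1)`. Their differences for distinct ordered pairs of indices are pairwise different and
non-zero, and differ by at most `4` in each coordinate, a range in which powers of `u` are distinct.
-/
theorem IsNormalizedGroup.exists_separating (hS : IsNormalizedGroup u b S) {i j k l : Fin 4}
    (hij : i ≠ j) (hne : (k, l) ≠ (i, j)) :
    eigT u i * (eigT u j)⁻¹ ≠ eigT u k * (eigT u l)⁻¹ ∨
      eigU u i * (eigU u j)⁻¹ ≠ eigU u k * (eigU u l)⁻¹ := by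
  let t : Fin 4 → ℤ := ![0, 1, -1, 0]
  let v : Fin 4 → ℤ := ![0, -1, 0, 1]
  have h0 := hS.ne_zero
  have ht : ∀ i, eigT u i = u ^ t i := by
    intro i; fin_cases i <;> simp [eigT, t]
  have hv : ∀ i, eigU u i = u ^ v i := by
    intro i; fin_cases i <;> simp [eigU, v]
  have hd : ∀ m n : ℤ, m < n → n ≤ m + 4 → u ^ m ≠ u ^ n := by
    intro m n hmn hmn' e
    refine hS.pow_ne_one (n := (n - m).toNat) (by omega) (by omega) ?_
    rw [← zpow_natCast, Int.toNat_of_nonneg (by omega), zpow_sub₀ h0, e, div_self]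
    exact zpow_ne_zero _ h0
  have hd' : ∀ m n : ℤ, m ≠ n → n ≤ m + 4 → m ≤ n + 4 → u ^ m ≠ u ^ n := by
    intro m n h h1 h2
    rcases lt_or_gt_of_ne h with h | h
    · exact hd m n h h1
    · exact (hd n m h h2).symm
  have hcomb : ∀ i j k l : Fin 4, i ≠ j → (k, l) ≠ (i, j) →
      t i - t j ≠ t k - t l ∨ v i - v j ≠ v k - v l := by decide
  have hbt : ∀ i j k l : Fin 4, t k - t l ≤ t i - t j + 4 ∧ v k - v l ≤ v i - v j + 4 := by
    decide
  simp only [ht, hv, ← _root_.zpow_neg, ← zpow_add₀ h0, ← sub_eq_add_neg]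
  rcases hcomb i j k l hij hne with h | h
  · exact Or.inl (hd' _ _ h (hbt i j k l).1 (hbt k l i j).1)
  · exact Or.inr (hd' _ _ h (hbt i j k l).2 (hbt k l i j).2)

/-- Each unwanted entry is killed by conjugation with a separating diagonal element minus the
character of that entry; dividing by the difference of characters keeps the `(i, j)` entry
unchanged. -/
theorem IsNormalizedGroup.exists_vanishing (hS : IsNormalizedGroup u b S)
    {X : Matrix (Fin 4) (Fin 4) ℂ} (hX : X ∈ complexLie S) {i j : Fin 4} (hij : i ≠ j)
    (s : Finset (Fin 4 × Fin 4)) (hs : (i, j) ∉ s) :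
    ∃ Y ∈ complexLie S, Y i j = X i j ∧ ∀ p ∈ s, Y p.1 p.2 = 0 := by
  induction s using Finset.induction_on with
  | empty => exact ⟨X, hX, rfl, by simp⟩
  | insert p s hp ih =>
    obtain ⟨Y, hY, hYX, hYs⟩ := ih fun h => hs (Finset.mem_insert_of_mem h)
    have hpne : (p.1, p.2) ≠ (i, j) := by
      rintro h
      exact hs (by rw [← h]; exact Finset.mem_insert_self _ _)
    obtain ⟨d, hd, hd0, hne⟩ : ∃ d : Fin 4 → ℂ, Matrix.diagonal d ∈ S ∧ (∀ i, d i ≠ 0) ∧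
        d i * (d j)⁻¹ ≠ d p.1 * (d p.2)⁻¹ := by
      rcases hS.exists_separating hij hpne with h | h
      · exact ⟨eigT u, hS.T_mem, fun i => ne_zero_of_norm_eq_one (norm_eigT hS.norm_eq i), h⟩
      · exact ⟨eigU u, hS.U_mem, fun i => ne_zero_of_norm_eq_one (norm_eigU hS.norm_eq i), h⟩
    have hne' := sub_ne_zero.2 hne
    refine ⟨(d i * (d j)⁻¹ - d p.1 * (d p.2)⁻¹)⁻¹ •
      ((Matrix.of fun i j => d i * (d j)⁻¹ * Y i j) - (d p.1 * (d p.2)⁻¹) • Y),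
      Submodule.smul_mem _ _ (sub_mem (hS.scale_mem hd hd0 hY) (Submodule.smul_mem _ _ hY)),
      ?_, fun q hq => ?_⟩
    · simp only [Matrix.smul_apply, Matrix.sub_apply, Matrix.of_apply, smul_eq_mul, ← sub_mul, hYX]
      rw [inv_mul_cancel_left₀ hne']
    · simp only [Matrix.smul_apply, Matrix.sub_apply, Matrix.of_apply, smul_eq_mul, ← sub_mul]
      rcases Finset.mem_insert.1 hq with rfl | hq
      · simp
      · simp [hYs q hq]

theorem IsNormalizedGroup.single_mem (hS : IsNormalizedGroup u b S)
    {X : Matrix (Fin 4) (Fin 4) ℂ} (hX : X ∈ complexLie S) {i j : Fin 4} (hij : i ≠ j)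
    (h : X i j ≠ 0) : Matrix.single i j (1 : ℂ) ∈ complexLie S := by
  obtain ⟨Y, hY, hYX, hYs⟩ := hS.exists_vanishing hX hij (Finset.univ.erase (i, j)) (by simp)
  have e : Matrix.single i j (1 : ℂ) = (X i j)⁻¹ • Y := by
    ext k l
    rw [Matrix.single_apply, Matrix.smul_apply, smul_eq_mul]
    split_ifs with hkl
    · obtain ⟨rfl, rfl⟩ := hkl
      rw [hYX, inv_mul_cancel₀ h]
    · rw [hYs (k, l) (by simpa using fun h1 h2 => hkl ⟨h1.symm, h2.symm⟩), mul_zero]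
  rw [e]
  exact Submodule.smul_mem _ _ hY

end Normalized

end Bianchi
end

/-! ### From one non-scalar element to all generators of the Lie algebra. -/

noncomputable section
namespace Bianchi

section Normalized

variable {u : ℂ} {b : ℝ} {S : Set (Matrix (Fin 4) (Fin 4) ℂ)}

/-- The entries of `stdA a b` that cannot vanish. -/
def stdSupp (i j : Fin 4) : Bool :=
  !((i == 1 && j == 2) || (i == 2 && j == 1) || (i == 3 && j == 3))

theorem stdA_apply_ne_zero {a b : ℝ} (ha : 1 < a) (hb : 0 < b) {i j : Fin 4}
    (h : stdSupp i j = true) : stdA a b i j ≠ 0 := by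
  have h1 : (a : ℂ) ≠ 0 := by exact_mod_cast (by linarith : a ≠ 0)
  have h2 : (b : ℂ) ≠ 0 := by exact_mod_cast hb.ne'
  have h3 : (-1 + -(a : ℂ)) ≠ 0 := by exact_mod_cast (by linarith : -1 + -a ≠ 0)
  fin_cases i <;> fin_cases j <;> simp [stdA, stdSupp, h1, h2, h3] at h ⊢

theorem IsNormalizedGroup.A_conj_mem (hS : IsNormalizedGroup u b S)
    {X : Matrix (Fin 4) (Fin 4) ℂ} (hX : X ∈ complexLie S) :
    stdA (eigParam u) b * X * stdA (eigParam u) b ∈ complexLie S :=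
  hS.conj_mem hX hS.A_mem (stdA_mul_self hS.b_sq)

/-- Otherwise every element of the complexified algebra is diagonal, since a non-zero off-diagonal
entry would split off. Then both `X` and `A X A` are diagonal, which forces `X` to be scalar. -/
theorem IsNormalizedGroup.exists_single_mem (hS : IsNormalizedGroup u b S)
    {X : Matrix (Fin 4) (Fin 4) ℂ} (hX : X ∈ complexLie S) (hns : ∀ c : ℂ, X ≠ c • 1) :
    ∃ i j : Fin 4, i ≠ j ∧ Matrix.single i j (1 : ℂ) ∈ complexLie S := by
  by_contra! hcon
  have hdiag : ∀ {Y : Matrix (Fin 4) (Fin 4) ℂ}, Y ∈ complexLie S →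
      Matrix.diagonal (fun i => Y i i) = Y := by
    intro Y hY
    ext i j
    rcases eq_or_ne i j with rfl | hij
    · simp
    · rw [Matrix.diagonal_apply_ne _ hij]
      by_contra hne
      exact hcon i j hij (hS.single_mem hY hij (Ne.symm hne))
  have h₁ := hdiag hX
  have h₂ := hdiag (hS.A_conj_mem hX)
  set A := stdA (eigParam u) b with hA
  have hAA : A * A = 1 := stdA_mul_self hS.b_sq
  set d := fun i => (A * X * A) i i with hd
  have e : A * X = Matrix.diagonal d * A := by
    rw [h₂, mul_assoc (A * X), hAA, mul_one]
  rw [← h₁] at e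
  refine hns (d 0) ?_
  rw [← h₁, Matrix.smul_one_eq_diagonal]
  congr 1
  funext i
  -- Row `0` of `A` has no zero entry, so row `0` of `A X = diag(d) A` gives `X i i = d 0` for every
  -- `i`.
  have := congrFun (congrFun e 0) i
  rw [Matrix.mul_diagonal, Matrix.diagonal_mul, mul_comm] at this
  refine mul_right_cancel₀ (stdA_apply_ne_zero (i := 0) (j := i) hS.one_lt hS.b_pos ?_) this
  clear this
  revert i
  decide

theorem mul_single_mul_apply (A B : Matrix (Fin 4) (Fin 4) ℂ) (i j k l : Fin 4) :
    (A * Matrix.single i j (1 : ℂ) * B) k l = A k i * B j l := by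
  simp [Matrix.mul_apply, Matrix.single_apply, ite_and]

/-- The `(k, l)` entry of `A E_ij A` is `A_ki A_jl`; when it is non-zero, `E_kl` splits off. -/
theorem IsNormalizedGroup.single_mem_step (hS : IsNormalizedGroup u b S) {i j k l : Fin 4}
    (h : Matrix.single i j (1 : ℂ) ∈ complexLie S) (hkl : k ≠ l)
    (h₁ : stdSupp k i = true)
    (h₂ : stdSupp j l = true) :
    Matrix.single k l (1 : ℂ) ∈ complexLie S := by
  refine hS.single_mem (hS.A_conj_mem h) hkl ?_
  rw [mul_single_mul_apply]
  exact mul_ne_zero (stdA_apply_ne_zero hS.one_lt hS.b_pos h₁)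
    (stdA_apply_ne_zero hS.one_lt hS.b_pos h₂)

/-- Two conjugations by `A` connect any two off-diagonal positions without using the entries `(2 -
a)/3`, which vanish when `Re u = 1/2`. -/
theorem exists_intermediate_pair : ∀ i j k l : Fin 4, i ≠ j → k ≠ l → ∃ m n : Fin 4, m ≠ n ∧
    stdSupp m i = true ∧
    stdSupp j n = true ∧
    stdSupp k m = true ∧
    stdSupp n l = true := by
  decide

theorem IsNormalizedGroup.single_mem_of_ne_scalar (hS : IsNormalizedGroup u b S)
    {X : Matrix (Fin 4) (Fin 4) ℂ} (hX : X ∈ complexLie S) (hns : ∀ c : ℂ, X ≠ c • 1)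
    {k l : Fin 4} (hkl : k ≠ l) : Matrix.single k l (1 : ℂ) ∈ complexLie S := by
  obtain ⟨i, j, hij, h⟩ := hS.exists_single_mem hX hns
  obtain ⟨m, n, hmn, h₁, h₂, h₃, h₄⟩ := exists_intermediate_pair i j k l hij hkl
  exact hS.single_mem_step (hS.single_mem_step h hmn h₁ h₂) hkl h₃ h₄

/-- The diagonal parts of `A E₁₂ A`, `A E₂₃ A` and `A E₃₁ A` add up to `-b² diag(3, -1, -1, -1)`.
This supplies the central phase needed in the elimination. -/
theorem IsNormalizedGroup.diagonal_mem (hS : IsNormalizedGroup u b S)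
    (hE : ∀ {k l : Fin 4}, k ≠ l → Matrix.single k l (1 : ℂ) ∈ complexLie S) :
    Matrix.diagonal ![3, -1, -1, -1] ∈ complexLie S := by
  have hoff : ∀ {Y : Matrix (Fin 4) (Fin 4) ℂ}, Y ∈ complexLie S →
      Matrix.diagonal (fun i => Y i i) ∈ complexLie S := by
    intro Y hY
    have e : Matrix.diagonal (fun i => Y i i) =
        Y - ∑ i, ∑ j, if i = j then 0 else Y i j • Matrix.single i j (1 : ℂ) := by
      ext k l
      simp only [Matrix.sub_apply, Fin.sum_univ_four]
      fin_cases k <;> fin_cases l <;> simp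
    rw [e]
    refine sub_mem hY (sum_mem fun i _ => sum_mem fun j _ => ?_)
    split_ifs with h
    · exact zero_mem _
    · exact Submodule.smul_mem _ _ (hE h)
  have h12 := hoff (hS.A_conj_mem (hE (k := 1) (l := 2) (by decide)))
  have h23 := hoff (hS.A_conj_mem (hE (k := 2) (l := 3) (by decide)))
  have h31 := hoff (hS.A_conj_mem (hE (k := 3) (l := 1) (by decide)))
  have hb : (b : ℂ) ^ 2 = ((eigParam u : ℂ) ^ 2 - 1) / 3 := by
    exact_mod_cast congrArg Complex.ofReal hS.b_sq
  have hb0 : (b : ℂ) ≠ 0 := by exact_mod_cast hS.b_pos.ne'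
  have key := Submodule.smul_mem _ (-(b : ℂ) ^ 2)⁻¹ (add_mem (add_mem h12 h23) h31)
  rw [Matrix.diagonal_add, Matrix.diagonal_add, ← Matrix.diagonal_smul] at key
  refine (congrArg (· ∈ complexLie S) (congrArg Matrix.diagonal (funext fun i => ?_))).mpr key
  have hb2 : -(b : ℂ) ^ 2 ≠ 0 := neg_ne_zero.2 (pow_ne_zero 2 hb0)
  rw [Pi.smul_apply, smul_eq_mul, eq_inv_mul_iff_mul_eq₀ hb2]
  simp only [mul_single_mul_apply]
  fin_cases i <;> simp [stdA] <;> first | ring1 | linear_combination hb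

/-- Infinitesimal rotation in the plane of `e_i` and `e_j`. -/
def rotGen (i j : Fin 4) (w : ℂ) : Matrix (Fin 4) (Fin 4) ℂ :=
  Matrix.single i j w - Matrix.single j i (star w)

/-- Infinitesimal boost in the plane of `e₀` and `e₁`. -/
def boostGen (w : ℂ) : Matrix (Fin 4) (Fin 4) ℂ :=
  Matrix.single 1 0 w + Matrix.single 0 1 (star w)

/-- Infinitesimal central rotation of the stabilizer of `e₀`. -/
def phaseGen : Matrix (Fin 4) (Fin 4) ℂ := Complex.I • Matrix.diagonal ![3, -1, -1, -1]

theorem single_eq_smul (i j : Fin 4) (w : ℂ) :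
    Matrix.single i j w = w • Matrix.single i j (1 : ℂ) := by
  simp

theorem IsNormalizedGroup.rotGen_mem (hS : IsNormalizedGroup u b S)
    (hE : ∀ {k l : Fin 4}, k ≠ l → Matrix.single k l (1 : ℂ) ∈ complexLie S) {i j : Fin 4}
    (hij : i ≠ j) (hi : i ≠ 0) (hj : j ≠ 0) (w : ℂ) : rotGen i j w ∈ zariskiLie S := by
  refine hS.mem_zariskiLie ?_ ?_
  · rw [rotGen, single_eq_smul i j, single_eq_smul j i]
    exact sub_mem (Submodule.smul_mem _ _ (hE hij)) (Submodule.smul_mem _ _ (hE hij.symm))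
  · have h : ∀ k : Fin 4, k ≠ 0 → (![-1, 1, 1, 1] : Fin 4 → ℂ) k = 1 := by
      intro k hk; fin_cases k <;> simp at hk ⊢
    ext k l
    rw [formJ, Matrix.add_apply, Matrix.mul_diagonal, Matrix.diagonal_mul]
    simp only [rotGen, Matrix.conjTranspose_sub, Matrix.conjTranspose_single, star_star,
      Matrix.sub_apply, Matrix.single_apply, Matrix.zero_apply]
    by_cases h₁ : i = k ∧ j = l
    · obtain ⟨rfl, rfl⟩ := h₁
      simp [h i hi, h j hj, hij, hij.symm]
    · by_cases h₂ : j = k ∧ i = l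
      · obtain ⟨rfl, rfl⟩ := h₂
        simp [h i hi, h j hj, hij, hij.symm]
      · simp [h₁, h₂]

theorem IsNormalizedGroup.boostGen_mem (hS : IsNormalizedGroup u b S)
    (hE : ∀ {k l : Fin 4}, k ≠ l → Matrix.single k l (1 : ℂ) ∈ complexLie S) (w : ℂ) :
    boostGen w ∈ zariskiLie S := by
  refine hS.mem_zariskiLie ?_ ?_
  · rw [boostGen, single_eq_smul 1 0, single_eq_smul 0 1]
    exact add_mem (Submodule.smul_mem _ _ (hE (by decide)))
      (Submodule.smul_mem _ _ (hE (by decide)))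
  · ext i j
    fin_cases i <;> fin_cases j <;> simp [boostGen, formJ]

theorem IsNormalizedGroup.phaseGen_mem (hS : IsNormalizedGroup u b S)
    (hE : ∀ {k l : Fin 4}, k ≠ l → Matrix.single k l (1 : ℂ) ∈ complexLie S) :
    phaseGen ∈ zariskiLie S := by
  refine hS.mem_zariskiLie (Submodule.smul_mem _ _ (hS.diagonal_mem hE)) ?_
  ext i j
  fin_cases i <;> fin_cases j <;> simp [phaseGen, formJ, Complex.conj_ofNat]

end Normalized

end Bianchi
end

/-! ### A non-scalar element of the Lie algebra. -/

noncomputable section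
namespace Bianchi

section OneParameter

variable {R : Type*} [Ring R] [Algebra ℝ R] {S : Set R}

/-- An infinite subset of the circle is Zariski dense in it, so the whole circle, also translated by
`S`, lies in the closure; `N₂` is its tangent at the identity. -/
theorem mem_zariskiLie_of_circle (hmul : ∀ g ∈ S, ∀ h ∈ S, g * h ∈ S) {N₀ N₁ N₂ : R}
    (h1 : N₀ + N₁ = 1)
    (hinf : {z ∈ {z : ℂ | ‖z‖ = 1} | N₀ + z.re • N₁ + z.im • N₂ ∈ S}.Infinite) :
    N₂ ∈ zariskiLie S := by
  have key := @curve_mul_mem_zariskiClosure R _ _ S {z : ℂ | ‖z‖ = 1} (by simp)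
    (fun z => N₀ + z.re • N₁ + z.im • N₂) ?_ hmul hinf
  · refine mem_zariskiLie_of_curve
      (η := fun t => N₀ + Real.cos t • N₁ + Real.sin t • N₂) (by simp [h1]) ?_ ?_
    · have := hasWeakDerivAt_add (hasWeakDerivAt_add (hasWeakDerivAt_const N₀ 0)
        (hasWeakDerivAt_smul (Real.hasDerivAt_cos 0) N₁))
        (hasWeakDerivAt_smul (Real.hasDerivAt_sin 0) N₂)
      simpa using this
    · intro t h hh
      have := key (z := Complex.exp (t * Complex.I)) (by simp [Complex.norm_exp_ofReal_mul_I]) hh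
      simpa [Complex.exp_ofReal_mul_I_re, Complex.exp_ofReal_mul_I_im] using this
  · intro ℓ
    refine ⟨ℓ N₁ / 2 + ℓ N₂ / (2 * Complex.I), ℓ N₁ / 2 - ℓ N₂ / (2 * Complex.I), ℓ N₀,
      fun z hz => ?_⟩
    have hz' : z⁻¹ = star z := (conj_eq_inv hz).symm
    have e₁ : (z.re : ℂ) = (z + z⁻¹) / 2 := by
      rw [hz', Complex.star_def, Complex.re_eq_add_conj]
    have e₂ : (z.im : ℂ) = (z - z⁻¹) / (2 * Complex.I) := by
      rw [hz', Complex.star_def, Complex.im_eq_sub_conj]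
    simp only [map_add, map_smul, smul_eq_mul, Complex.ofReal_add, Complex.ofReal_mul, e₁, e₂]
    ring

/-- The same argument on a branch of the hyperbola `x ↦ (x, x⁻¹)`, parametrized by `x = exp t`. -/
theorem mem_zariskiLie_of_hyperbola (hmul : ∀ g ∈ S, ∀ h ∈ S, g * h ∈ S) {N₀ N₁ N₂ : R}
    (h1 : N₀ + N₁ + N₂ = 1)
    (hinf : {x : ℝ | 0 < x ∧ N₀ + x • N₁ + x⁻¹ • N₂ ∈ S}.Infinite) :
    N₁ - N₂ ∈ zariskiLie S := by
  have key := @curve_mul_mem_zariskiClosure R _ _ S {z : ℂ | 0 < z.re ∧ z.im = 0} (by simp)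
    (fun z => N₀ + z.re • N₁ + z.re⁻¹ • N₂) ?_ hmul ?_
  · refine mem_zariskiLie_of_curve
      (η := fun t => N₀ + Real.exp t • N₁ + Real.exp (-t) • N₂) (by simp [h1]) ?_ ?_
    · have := hasWeakDerivAt_add (hasWeakDerivAt_add (hasWeakDerivAt_const N₀ 0)
        (hasWeakDerivAt_smul (Real.hasDerivAt_exp 0) N₁))
        (hasWeakDerivAt_smul (hasDerivAt_neg (0 : ℝ)).exp N₂)
      simpa [sub_eq_add_neg] using this
    · intro t h hh
      have := key (z := (Real.exp t : ℝ)) ⟨by rw [Complex.ofReal_re]; exact Real.exp_pos t,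
        Complex.ofReal_im _⟩ hh
      simpa only [Complex.ofReal_re, Real.exp_neg] using this
  · intro ℓ
    refine ⟨ℓ N₁, ℓ N₂, ℓ N₀, fun z hz => ?_⟩
    have e : z = (z.re : ℂ) := Complex.ext rfl (by simpa using hz.2)
    rw [e]
    simp only [map_add, map_smul, smul_eq_mul, Complex.ofReal_add, Complex.ofReal_mul,
      Complex.ofReal_re, Complex.ofReal_inv]
    ring
  · refine (hinf.image (f := fun x : ℝ => (x : ℂ)) Complex.ofReal_injective.injOn).mono ?_
    rintro _ ⟨x, hx, rfl⟩
    exact ⟨⟨by simpa using hx.1, Complex.ofReal_im x⟩, by simpa using hx.2⟩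

end OneParameter

section Normalized

variable {u : ℂ} {b : ℝ} {S : Set (Matrix (Fin 4) (Fin 4) ℂ)}

/-- The powers of `diag(1, u, u⁻¹, 1)` are then infinitely many points of a circle whose tangent at
the identity is `diag(0, i, -i, 0)`. -/
theorem IsNormalizedGroup.exists_ne_scalar_of_infinite (hS : IsNormalizedGroup u b S)
    (hu : ∀ n : ℕ, 0 < n → u ^ n ≠ 1) : ∃ X ∈ zariskiLie S, ∀ c : ℂ, X ≠ c • 1 := by
  refine ⟨Matrix.diagonal ![0, Complex.I, -Complex.I, 0],
    mem_zariskiLie_of_circle hS.mul_mem (N₀ := Matrix.diagonal ![1, 0, 0, 1])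
      (N₁ := Matrix.diagonal ![0, 1, 1, 0]) ?_ ?_, ?_⟩
  · rw [Matrix.diagonal_add, ← Matrix.diagonal_one]
    congr 1
    funext i
    fin_cases i <;> simp
  · have hinj : ∀ m n : ℕ, m < n → u ^ m ≠ u ^ n := by
      intro m n hmn e
      refine hu (n - m) (by omega) (mul_left_cancel₀ (pow_ne_zero m hS.ne_zero) ?_)
      rw [← pow_add, Nat.add_sub_cancel' hmn.le, e, mul_one]
    have hinj' : Function.Injective fun n : ℕ => u ^ n := by
      intro m n e
      rcases lt_trichotomy m n with h | h | h
      · exact absurd e (hinj m n h)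
      · exact h
      · exact absurd e.symm (hinj n m h)
    refine (Set.infinite_range_of_injective hinj').mono ?_
    rintro _ ⟨n, rfl⟩
    have hn : ‖u ^ n‖ = 1 := by rw [norm_pow, hS.norm_eq, one_pow]
    refine ⟨hn, ?_⟩
    have := hS.pow_mem hS.T_mem n
    rw [Matrix.diagonal_pow] at this
    convert this using 1
    have e' : ∀ z : ℂ, ‖z‖ = 1 → z⁻¹ = z.re - z.im * Complex.I := by
      intro z hz
      rw [← conj_eq_inv hz, Complex.star_def]
      apply Complex.ext <;> simp
    have e := e' _ hn
    ext i j
    rw [Matrix.add_apply, Matrix.add_apply, Matrix.smul_apply, Matrix.smul_apply]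
    by_cases hij : i = j
    · subst hij
      simp only [Matrix.diagonal_apply_eq]
      fin_cases i <;> simp [eigT, e, Complex.re_add_im, sub_eq_add_neg]
    · simp [hij]
  · intro c hc
    have h₀ := congrFun (congrFun hc 0) 0
    have h₁ := congrFun (congrFun hc 1) 1
    simp at h₀ h₁
    exact Complex.I_ne_zero (h₁.trans h₀.symm)

/-! ### A loxodromic element -/

/-- Columns: two eigenvectors and a basis of an invariant plane of a loxodromic element. -/
def loxV (u : ℂ) : Matrix (Fin 4) (Fin 4) ℂ :=
  !![(u - 1) ^ 2, 0, u * (u - 1) ^ 2, 2 * (u - 1) ^ 2;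
     u ^ 2, -u, 0, u * (2 * u ^ 2 - u + 2);
     1, 0, 2 * u ^ 2 - u + 2, 0;
     u, 1, 0, 2 * u ^ 2 - u + 2]

/-- The loxodromic element in the basis `loxV u`. -/
def loxB (u : ℂ) : Matrix (Fin 4) (Fin 4) ℂ :=
  !![-u, 0, 0, 0;
     0, -u⁻¹, 0, 0;
     0, 0, 2 * u ^ 2 + 3 * u + 4 * u / (u - 1), -2 * (u + 1) / (u * (u - 1));
     0, 0, u ^ 2 + 2 * u + 3 + 4 / (u - 1), -1 / u - 2 / u ^ 2 - 4 / (u ^ 2 * (u - 1))]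

/-- Eigenvectors of `loxB u`. -/
def loxE (u s t : ℂ) : Matrix (Fin 4) (Fin 4) ℂ :=
  !![1, 0, 0, 0;
     0, 1, 0, 0;
     0, 0, -2 * (u + 1) / (u * (u - 1)), -2 * (u + 1) / (u * (u - 1));
     0, 0, s - (2 * u ^ 2 + 3 * u + 4 * u / (u - 1)), t - (2 * u ^ 2 + 3 * u + 4 * u / (u - 1))]

theorem eigA_mul_self (a : ℂ) : eigA a * eigA a = 1 := by
  ext i j
  fin_cases i <;> fin_cases j <;> simp [eigA, Matrix.mul_apply, Fin.sum_univ_four] <;> ring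

/-- This is `A K₁ A K₂ V = V B` with one factor `A` moved across by `A² = 1`, which keeps the
entries manageable. -/
theorem lox_mul_loxV (h0 : u ≠ 0) (h1 : u ≠ 1) :
    Matrix.diagonal ![1, 1, u ^ 2, (u ^ 2)⁻¹] * (eigA (-(u ^ 2 + u + 1) / (u - 1) ^ 2) *
      (Matrix.diagonal ![1, (u ^ 2)⁻¹, u ^ 2, 1] * loxV u)) =
      eigA (-(u ^ 2 + u + 1) / (u - 1) ^ 2) * (loxV u * loxB u) := by
  have h3 : u - 1 ≠ 0 := sub_ne_zero.2 h1
  ext i j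
  rw [Matrix.diagonal_mul, Matrix.mul_apply, Matrix.mul_apply]
  simp only [Matrix.mul_apply, Fin.sum_univ_four]
  fin_cases i <;> fin_cases j <;> simp [eigA, loxV, loxB] <;> field_simp <;> ring

/-- The lower block of `loxB u` has determinant `1` and trace `2(u + u⁻¹)² + 3(u + u⁻¹)`, so `s` and
`t` are its eigenvalues. -/
theorem loxB_mul_loxE (h0 : u ≠ 0) (h1 : u ≠ 1) {s t : ℂ} (hst : s * t = 1)
    (hsum : s + t = 2 * (u + u⁻¹) ^ 2 + 3 * (u + u⁻¹)) :
    loxB u * loxE u s t = loxE u s t * Matrix.diagonal ![-u, -u⁻¹, s, t] := by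
  have h3 : u - 1 ≠ 0 := sub_ne_zero.2 h1
  have tr : s + t = (2 * u ^ 2 + 3 * u + 4 * u / (u - 1)) +
      (-1 / u - 2 / u ^ 2 - 4 / (u ^ 2 * (u - 1))) := by
    rw [hsum]; field_simp; ring
  have dt : (2 * u ^ 2 + 3 * u + 4 * u / (u - 1)) *
      (-1 / u - 2 / u ^ 2 - 4 / (u ^ 2 * (u - 1))) -
      (-2 * (u + 1) / (u * (u - 1))) * (u ^ 2 + 2 * u + 3 + 4 / (u - 1)) = 1 := by
    field_simp; ring
  have hs : s ^ 2 - (s + t) * s + 1 = 0 := by linear_combination -hst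
  have ht : t ^ 2 - (s + t) * t + 1 = 0 := by linear_combination -hst
  rw [tr] at hs ht
  simp only [loxB, loxE]
  generalize (2 * u ^ 2 + 3 * u + 4 * u / (u - 1)) = α at *
  generalize (-1 / u - 2 / u ^ 2 - 4 / (u ^ 2 * (u - 1))) = δ at *
  generalize (u ^ 2 + 2 * u + 3 + 4 / (u - 1)) = γ at *
  generalize (-2 * (u + 1) / (u * (u - 1))) = β at *
  ext i j
  rw [Matrix.mul_diagonal, Matrix.mul_apply, Fin.sum_univ_four]
  fin_cases i <;> fin_cases j <;> simp <;>
    first | ring1 | linear_combination -dt - hs | linear_combination -dt - ht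

theorem det_loxV : (loxV u).det = -4 * u * (u - 1) ^ 4 * (2 * u ^ 2 - u + 2) := by
  simp [loxV, Matrix.det_succ_row_zero, Fin.sum_univ_succ, Fin.succAbove]
  ring

theorem det_loxE (s t : ℂ) : (loxE u s t).det = -2 * (u + 1) / (u * (u - 1)) * (t - s) := by
  simp [loxE, Matrix.det_succ_row_zero, Fin.sum_univ_succ, Fin.succAbove]
  ring

theorem IsNormalizedGroup.diagonal_inv_mem (hS : IsNormalizedGroup u b S) {d e : Fin 4 → ℂ}
    (hd : Matrix.diagonal d ∈ S) (hde : ∀ i, e i * d i = 1) : Matrix.diagonal e ∈ S := by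
  obtain ⟨k, hk, h⟩ := hS.exists_inv _ hd
  have h' : Matrix.diagonal e * Matrix.diagonal d = 1 := by
    rw [Matrix.diagonal_mul_diagonal, ← Matrix.diagonal_one]
    exact congrArg _ (funext hde)
  rwa [← mul_one (Matrix.diagonal e), ← h, ← mul_assoc, h', one_mul]

theorem eigA_mul_scale {a b : ℝ} (hb : b ^ 2 = (a ^ 2 - 1) / 3) (hb0 : b ≠ 0) :
    eigA a * Matrix.diagonal ![(b : ℂ)⁻¹, 1, 1, 1] =
      Matrix.diagonal ![(b : ℂ)⁻¹, 1, 1, 1] * stdA a b := by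
  have hb' : (b : ℂ) ^ 2 = ((a : ℂ) ^ 2 - 1) / 3 := by exact_mod_cast congrArg Complex.ofReal hb
  have hb0' : (b : ℂ) ≠ 0 := by exact_mod_cast hb0
  ext i j
  rw [Matrix.mul_diagonal, Matrix.diagonal_mul]
  fin_cases i <;> fin_cases j <;> simp [eigA, stdA, hb0', mul_comm] <;> field_simp <;>
    linear_combination (3 : ℂ) * hb'

/-- A diagonalizable element of `S` with two real eigenvalues `s > 1` and `s⁻¹`. -/
theorem IsNormalizedGroup.exists_loxodromic (hS : IsNormalizedGroup u b S) :
    ∃ M ∈ S, ∃ (P : GL (Fin 4) ℂ) (s : ℝ), 1 < s ∧ M = (P : Matrix (Fin 4) (Fin 4) ℂ) *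
      Matrix.diagonal ![-u, -u⁻¹, (s : ℂ), (s : ℂ)⁻¹] *
      ((P⁻¹ : GL (Fin 4) ℂ) : Matrix (Fin 4) (Fin 4) ℂ) := by
  have h0 := hS.ne_zero
  have h1 := hS.ne_one
  have h3 : u - 1 ≠ 0 := sub_ne_zero.2 h1
  have hre := hS.lt_re
  have hz : u + u⁻¹ = ((2 * u.re : ℝ) : ℂ) := by
    have := sq_add_one_eq hS.norm_eq
    field_simp
    push_cast
    linear_combination this
  obtain ⟨s, hs1, hs⟩ : ∃ s : ℝ, 1 < s ∧ s + s⁻¹ = 2 * (2 * u.re) ^ 2 + 3 * (2 * u.re) := by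
    set y : ℝ := 2 * (2 * u.re) ^ 2 + 3 * (2 * u.re) with hy
    -- With `x = 2 Re u` one has `y - 2 = (2x - 1)(x + 2)`, positive because `Re u > 1/4`; hence the
    -- roots of `s² - ys + 1` are real and distinct.
    have hy2 : 2 < y := by nlinarith
    have hsq : 0 < y ^ 2 - 4 := by nlinarith
    have hr := Real.sq_sqrt hsq.le
    have hr0 := Real.sqrt_pos.2 hsq
    refine ⟨(y + Real.sqrt (y ^ 2 - 4)) / 2, by linarith, ?_⟩
    have hne : y + Real.sqrt (y ^ 2 - 4) ≠ 0 := by linarith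
    field_simp
    linear_combination hr
  have hs0 : (s : ℂ) ≠ 0 := by exact_mod_cast (by linarith : s ≠ 0)
  have hts : (s : ℂ)⁻¹ - s ≠ 0 := by
    have : s⁻¹ - s ≠ 0 := by
      have := inv_lt_one_of_one_lt₀ hs1
      linarith
    exact_mod_cast this
  have hsum : (s : ℂ) + (s : ℂ)⁻¹ = 2 * (u + u⁻¹) ^ 2 + 3 * (u + u⁻¹) := by
    rw [hz]; exact_mod_cast congrArg Complex.ofReal hs
  have hq : 2 * u ^ 2 - u + 2 ≠ 0 := by
    have e : 2 * u ^ 2 - u + 2 = ((4 * u.re - 1 : ℝ) : ℂ) * u := by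
      push_cast
      linear_combination (2 : ℂ) * sq_add_one_eq hS.norm_eq
    rw [e]
    refine mul_ne_zero ?_ h0
    exact_mod_cast (by linarith : 4 * u.re - 1 ≠ 0)
  have hu1 : u + 1 ≠ 0 := by
    intro h
    have := congrArg Complex.re h
    simp at this
    linarith
  have hb0 : (b : ℂ) ≠ 0 := by exact_mod_cast hS.b_pos.ne'
  set a := eigParam u with ha
  have haA : eigA (-(u ^ 2 + u + 1) / (u - 1) ^ 2) = eigA a := by
    rw [eigParam_eq hS.norm_eq h1]
  set D := Matrix.diagonal ![(b : ℂ)⁻¹, 1, 1, 1] with hD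
  set D' := Matrix.diagonal ![(b : ℂ), 1, 1, 1] with hD'
  have hDD : D' * D = 1 := by
    rw [hD, hD', Matrix.diagonal_mul_diagonal, ← Matrix.diagonal_one]
    congr 1
    funext i
    fin_cases i <;> simp [hb0]
  have hDD' : D * D' = 1 := mul_eq_one_comm.1 hDD
  set K₁ := Matrix.diagonal ![1, 1, u ^ 2, (u ^ 2)⁻¹] with hK₁
  set K₂ := Matrix.diagonal ![1, (u ^ 2)⁻¹, u ^ 2, 1] with hK₂
  have hAD := eigA_mul_scale hS.b_sq hS.b_pos.ne'
  rw [← ha, ← hD] at hAD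
  set Λ := Matrix.diagonal ![-u, -u⁻¹, (s : ℂ), (s : ℂ)⁻¹] with hΛ
  have hV := lox_mul_loxV h0 h1
  rw [haA, ← hK₁, ← hK₂] at hV
  have hE := loxB_mul_loxE h0 h1 (mul_inv_cancel₀ hs0) hsum
  rw [← hΛ] at hE
  set V := loxV u * loxE u s (s : ℂ)⁻¹ with hVdef
  have hMV : eigA a * K₁ * eigA a * K₂ * V = V * Λ := by
    calc eigA a * K₁ * eigA a * K₂ * V
        = eigA a * (K₁ * (eigA a * (K₂ * loxV u))) * loxE u s (s : ℂ)⁻¹ := by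
          rw [hVdef]; simp only [mul_assoc]
      _ = eigA a * eigA a * loxV u * (loxB u * loxE u s (s : ℂ)⁻¹) := by
          rw [hV]; simp only [mul_assoc]
      _ = V * Λ := by rw [eigA_mul_self, one_mul, hE, hVdef]; simp only [mul_assoc]
  have hcomm₁ : D' * K₁ = K₁ * D' := by
    rw [hD', hK₁, Matrix.diagonal_mul_diagonal, Matrix.diagonal_mul_diagonal]
    simp only [mul_comm]
  have hcomm₂ : D * K₂ = K₂ * D := by
    rw [hD, hK₂, Matrix.diagonal_mul_diagonal, Matrix.diagonal_mul_diagonal]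
    simp only [mul_comm]
  have hstd : stdA a b = D' * eigA a * D := by
    rw [mul_assoc, hAD, ← mul_assoc, hDD, one_mul]
  have hdet : (D' * V).det ≠ 0 := by
    rw [Matrix.det_mul, hVdef, Matrix.det_mul, det_loxV, det_loxE, hD', Matrix.det_diagonal,
      Fin.prod_univ_four]
    simp only [Matrix.cons_val]
    refine mul_ne_zero (by simpa using hb0) (mul_ne_zero ?_ (mul_ne_zero ?_ hts))
    · simp [h0, h3, hq]
    · simp [h0, h3, hu1]
  -- `K₂` is the image of `T⁻²` and `K₁` that of `(T U)⁻²`; the loxodromic word is `A (T U)⁻² A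
  -- T⁻²`.
  have hK₂S : K₂ ∈ S := by
    refine hS.diagonal_inv_mem (d := eigT u ^ 2)
      (by rw [← Matrix.diagonal_pow]; exact hS.pow_mem hS.T_mem 2) fun i => ?_
    fin_cases i <;> simp [eigT, h0]
  have hK₁S : K₁ ∈ S := by
    refine hS.diagonal_inv_mem (d := fun i => (eigT u ^ 2) i * (eigU u ^ 2) i)
      (by
        rw [← Matrix.diagonal_mul_diagonal, ← Matrix.diagonal_pow, ← Matrix.diagonal_pow]
        exact hS.mul_mem _ (hS.pow_mem hS.T_mem 2) _ (hS.pow_mem hS.U_mem 2)) fun i => ?_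
    fin_cases i <;> simp [eigT, eigU, h0]
  let P := Matrix.GeneralLinearGroup.mkOfDetNeZero (D' * V) hdet
  refine ⟨stdA a b * K₁ * stdA a b * K₂,
    hS.mul_mem _ (hS.mul_mem _ (hS.mul_mem _ hS.A_mem _ hK₁S) _ hS.A_mem) _ hK₂S, P, s, hs1,
    eq_conj_of_mul_eq ?_⟩
  change _ * (D' * V) = D' * V * Λ
  calc stdA a b * K₁ * stdA a b * K₂ * (D' * V)
      = D' * eigA a * (D * (K₁ * D')) * eigA a * (D * K₂) * D' * V := by
        rw [hstd]; simp only [mul_assoc]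
    _ = D' * eigA a * ((D * D') * K₁) * eigA a * K₂ * (D * D') * V := by
        rw [← hcomm₁, hcomm₂]; simp only [mul_assoc]
    _ = D' * (eigA a * K₁ * eigA a * K₂ * V) := by
        rw [hDD']; simp only [mul_assoc, one_mul]
    _ = D' * V * Λ := by rw [hMV]; exact (mul_assoc _ _ _).symm

/-- Powers of the loxodromic element with exponent divisible by `2n` have eigenvalues `1, 1, x,
x⁻¹`: the factor `n` kills `u` and the factor `2` kills the sign. They give infinitely many points
of a hyperbola. -/
theorem IsNormalizedGroup.exists_ne_scalar_of_pow_eq_one (hS : IsNormalizedGroup u b S) {n : ℕ}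
    (hn : 0 < n) (hu : u ^ n = 1) : ∃ X ∈ zariskiLie S, ∀ c : ℂ, X ≠ c • 1 := by
  obtain ⟨M, hM, P, s, hs, rfl⟩ := hS.exists_loxodromic
  set V : Matrix (Fin 4) (Fin 4) ℂ := (P : Matrix (Fin 4) (Fin 4) ℂ) with hV
  set V' : Matrix (Fin 4) (Fin 4) ℂ := ((P⁻¹ : GL (Fin 4) ℂ) : Matrix (Fin 4) (Fin 4) ℂ) with hV'
  have hVV : V * V' = 1 := by rw [hV, hV', ← Units.val_mul, mul_inv_cancel, Units.val_one]
  have hVV' : V' * V = 1 := mul_eq_one_comm.1 hVV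
  have hs0 : 0 < s := by linarith
  let N : (Fin 4 → ℂ) → Matrix (Fin 4) (Fin 4) ℂ := fun d => V * Matrix.diagonal d * V'
  have hN : ∀ (x y : ℝ), N ![1, 1, 0, 0] + x • N ![0, 0, 1, 0] + y • N ![0, 0, 0, 1] =
      N ![1, 1, (x : ℂ), y] := by
    intro x y
    have e : Matrix.diagonal ![1, 1, (x : ℂ), y] = Matrix.diagonal ![1, 1, 0, 0] +
        x • Matrix.diagonal ![0, 0, 1, 0] + y • Matrix.diagonal ![0, 0, 0, 1] := by
      ext i j
      fin_cases i <;> fin_cases j <;> simp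
    simp only [N, e, mul_add, add_mul, mul_smul_comm, smul_mul_assoc]
  refine ⟨N ![0, 0, 1, 0] - N ![0, 0, 0, 1], mem_zariskiLie_of_hyperbola hS.mul_mem
    (N₀ := N ![1, 1, 0, 0]) ?_ ?_, ?_⟩
  · have := hN 1 1
    simp only [one_smul] at this
    rw [this]
    have e : Matrix.diagonal ![1, 1, ((1 : ℝ) : ℂ), ((1 : ℝ) : ℂ)] = 1 := by
      rw [← Matrix.diagonal_one]
      congr 1
      funext i
      fin_cases i <;> simp
    simp only [N, e, mul_one, hVV]
  · have hinj : Function.Injective fun k : ℕ => (s ^ (2 * n)) ^ k :=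
      (pow_right_strictMono₀ (one_lt_pow₀ hs (by omega))).injective
    refine (Set.infinite_range_of_injective hinj).mono ?_
    rintro _ ⟨k, rfl⟩
    refine ⟨by positivity, ?_⟩
    rw [hN]
    have hp : ∀ (d : Fin 4 → ℂ) (m : ℕ), N d ^ m = N (d ^ m) := by
      intro d m
      induction m with
      | zero =>
        change 1 = V * Matrix.diagonal 1 * V'
        rw [show Matrix.diagonal (1 : Fin 4 → ℂ) = 1 from Matrix.diagonal_one, mul_one, hVV]
      | succ m ih =>
        rw [pow_succ, ih]
        calc V * Matrix.diagonal (d ^ m) * V' * (V * Matrix.diagonal d * V')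
            = V * Matrix.diagonal (d ^ m) * (V' * V) * Matrix.diagonal d * V' := by
              simp only [mul_assoc]
          _ = V * (Matrix.diagonal (d ^ m) * Matrix.diagonal d) * V' := by
              rw [hVV']; simp only [mul_assoc, one_mul]
          _ = N (d ^ (m + 1)) := by rw [Matrix.diagonal_mul_diagonal, pow_succ]; rfl
    have := hS.pow_mem hM (2 * n * k)
    change N _ ^ _ ∈ S at this
    rw [hp] at this
    convert this using 2
    have h₁ : (-u) ^ (2 * n * k) = 1 := by
      rw [pow_mul, mul_comm 2 n, pow_mul, neg_pow, hu]
      simp only [mul_one, ← pow_mul]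
      rw [mul_comm n 2, mul_assoc, pow_mul]
      simp
    funext i
    fin_cases i
    · simpa using h₁.symm
    · have : (-u⁻¹) ^ (2 * n * k) = 1 := by
        rw [← inv_neg, inv_pow, h₁, inv_one]
      simpa using this.symm
    · simp [pow_mul]
    · simp [pow_mul]
  · intro c hc
    have e : N ![0, 0, 1, 0] - N ![0, 0, 0, 1] = N ![0, 0, 1, -1] := by
      simp only [N, ← sub_mul, ← mul_sub]
      congr 2
      ext i j
      fin_cases i <;> fin_cases j <;> simp
    have e' : Matrix.diagonal ![0, 0, 1, -1] = c • (1 : Matrix (Fin 4) (Fin 4) ℂ) := by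
      calc Matrix.diagonal ![0, 0, 1, -1] = V' * N ![0, 0, 1, -1] * V := by
            simp only [N]
            rw [← mul_assoc, ← mul_assoc, hVV', one_mul, mul_assoc, hVV', mul_one]
        _ = c • 1 := by rw [← e, hc, mul_smul_comm, mul_one, smul_mul_assoc, hVV']
    have h₀ := congrFun (congrFun e' 0) 0
    have h₂ := congrFun (congrFun e' 2) 2
    simp at h₀ h₂
    exact one_ne_zero (h₂.trans h₀.symm)

theorem IsNormalizedGroup.single_mem_complexLie (hS : IsNormalizedGroup u b S)
    {k l : Fin 4} (hkl : k ≠ l) : Matrix.single k l (1 : ℂ) ∈ complexLie S := by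
  obtain ⟨X, hX, hns⟩ : ∃ X ∈ zariskiLie S, ∀ c : ℂ, X ≠ c • 1 := by
    by_cases h : ∀ n : ℕ, 0 < n → u ^ n ≠ 1
    · exact hS.exists_ne_scalar_of_infinite h
    · push Not at h
      obtain ⟨n, hn, hu⟩ := h
      exact hS.exists_ne_scalar_of_pow_eq_one hn hu
  exact hS.single_mem_of_ne_scalar (Submodule.subset_span hX) hns hkl

end Normalized

end Bianchi
end

noncomputable section
namespace Bianchi

/-! ### One-parameter groups -/

section Stabilizer

variable {R : Type*} [Ring R] [Algebra ℝ R] {S : Set R}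

/-- The elements whose left multiplication preserves the Zariski closure of `S`. -/
def closureStab (S : Set R) : Submonoid R where
  carrier := {k | ∀ M ∈ zariskiClosure S, k * M ∈ zariskiClosure S}
  one_mem' := fun M hM => by rwa [one_mul]
  mul_mem' := fun {k l} hk hl M hM => by rw [mul_assoc]; exact hk _ (hl _ hM)

/-- By the relations on `X` and `N`, the displayed element is `exp(tX)`. -/
theorem rotation_mem_closureStab {X N : R} (hX : X ∈ zariskiLie S) (h₁ : X * X = -N)
    (h₂ : X * N = X) (t : ℝ) :
    1 + Real.sin t • X + (Real.cos t - 1) • N ∈ closureStab S := by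
  intro M hM
  refine flow_mul_mem_zariskiClosure hX (η := fun t => 1 + Real.sin t • X + (Real.cos t - 1) • N)
    (by simp) (fun t => ?_) (fun ℓ t => ?_) hM t
  · have := hasWeakDerivAt_add (hasWeakDerivAt_add (hasWeakDerivAt_const 1 t)
      (hasWeakDerivAt_smul (Real.hasDerivAt_sin t) X))
      (hasWeakDerivAt_smul ((Real.hasDerivAt_cos t).sub_const 1) N)
    convert this using 1
    simp only [mul_add, mul_smul_comm, h₁, h₂, mul_one]
    module
  · simp only [map_add, map_smul, smul_eq_mul]
    fun_prop

theorem boost_mem_closureStab {X N : R} (hX : X ∈ zariskiLie S) (h₁ : X * X = N)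
    (h₂ : X * N = X) (t : ℝ) :
    1 + Real.sinh t • X + (Real.cosh t - 1) • N ∈ closureStab S := by
  intro M hM
  refine flow_mul_mem_zariskiClosure hX
    (η := fun t => 1 + Real.sinh t • X + (Real.cosh t - 1) • N)
    (by simp) (fun t => ?_) (fun ℓ t => ?_) hM t
  · have := hasWeakDerivAt_add (hasWeakDerivAt_add (hasWeakDerivAt_const 1 t)
      (hasWeakDerivAt_smul (Real.hasDerivAt_sinh t) X))
      (hasWeakDerivAt_smul ((Real.hasDerivAt_cosh t).sub_const 1) N)
    convert this using 1
    simp only [mul_add, mul_smul_comm, h₁, h₂, mul_one]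
    module
  · simp only [map_add, map_smul, smul_eq_mul]
    fun_prop

end Stabilizer

section Normalized

variable {u : ℂ} {b : ℝ} {S : Set (Matrix (Fin 4) (Fin 4) ℂ)}

/-- An element of `SU(2)` acting on the coordinates `1` and `2`. -/
def blockOneTwo (α β : ℂ) : Matrix (Fin 4) (Fin 4) ℂ :=
  !![1, 0, 0, 0; 0, α, β, 0; 0, -star β, star α, 0; 0, 0, 0, 1]

/-- An element of `SU(2)` acting on the coordinates `2` and `3`. -/
def blockTwoThree (α β : ℂ) : Matrix (Fin 4) (Fin 4) ℂ :=
  !![1, 0, 0, 0; 0, 1, 0, 0; 0, 0, α, β; 0, 0, -star β, star α]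

/-- An element of `SU(1, 1)` acting on the coordinates `0` and `1`. -/
def boostM (c : ℝ) (β : ℂ) : Matrix (Fin 4) (Fin 4) ℂ :=
  !![(c : ℂ), star β, 0, 0; β, c, 0, 0; 0, 0, 1, 0; 0, 0, 0, 1]

/-- An element of the center of the stabilizer of `e₀`. -/
def phaseM (t : ℝ) : Matrix (Fin 4) (Fin 4) ℂ :=
  Matrix.diagonal ![Real.cos (3 * t) + Real.sin (3 * t) * Complex.I,
    Real.cos t - Real.sin t * Complex.I, Real.cos t - Real.sin t * Complex.I,
    Real.cos t - Real.sin t * Complex.I]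

theorem exists_polar {c : ℝ} {β : ℂ} (h : c ^ 2 + ‖β‖ ^ 2 = 1) :
    ∃ (t : ℝ) (w : ℂ), ‖w‖ = 1 ∧ Real.cos t = c ∧ (Real.sin t : ℂ) * w = β := by
  have hc : ‖(⟨c, ‖β‖⟩ : ℂ)‖ = 1 := by
    rw [← sq_eq_sq₀ (norm_nonneg _) zero_le_one, ← Complex.normSq_eq_norm_sq, Complex.normSq_mk]
    linarith
  have hne : (⟨c, ‖β‖⟩ : ℂ) ≠ 0 := ne_zero_of_norm_eq_one hc
  have hcos := Complex.cos_arg hne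
  have hsin := Complex.sin_arg (⟨c, ‖β‖⟩ : ℂ)
  rw [hc, div_one] at hcos hsin
  by_cases hβ : β = 0
  · refine ⟨Complex.arg ⟨c, ‖β‖⟩, 1, by simp, hcos, ?_⟩
    rw [hsin]
    simp [hβ]
  · have hβ' : (‖β‖ : ℂ) ≠ 0 := by simpa using hβ
    refine ⟨Complex.arg ⟨c, ‖β‖⟩, β / ‖β‖, by simp [hβ], hcos, ?_⟩
    rw [hsin]
    field_simp

theorem exists_hyperbolic_polar {c : ℝ} {β : ℂ} (hc : 0 < c) (h : c ^ 2 - ‖β‖ ^ 2 = 1) :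
    ∃ (t : ℝ) (w : ℂ), ‖w‖ = 1 ∧ Real.cosh t = c ∧ (Real.sinh t : ℂ) * w = β := by
  have hcosh : Real.cosh (Real.arsinh ‖β‖) = c := by
    rw [Real.cosh_arsinh, show 1 + ‖β‖ ^ 2 = c ^ 2 by linarith, Real.sqrt_sq hc.le]
  by_cases hβ : β = 0
  · refine ⟨Real.arsinh ‖β‖, 1, by simp, hcosh, ?_⟩
    simp [hβ]
  · have hβ' : (‖β‖ : ℂ) ≠ 0 := by simpa using hβ
    refine ⟨Real.arsinh ‖β‖, β / ‖β‖, by simp [hβ], hcosh, ?_⟩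
    rw [Real.sinh_arsinh]
    field_simp

theorem mul_star_eq_one {w : ℂ} (hw : ‖w‖ = 1) : w * star w = 1 := by
  rw [conj_eq_inv hw, mul_inv_cancel₀ (ne_zero_of_norm_eq_one hw)]

theorem star_mul_eq_one {w : ℂ} (hw : ‖w‖ = 1) : star w * w = 1 := by
  rw [mul_comm, mul_star_eq_one hw]

theorem IsNormalizedGroup.real_blockOneTwo_mem (hS : IsNormalizedGroup u b S) {c : ℝ} {β : ℂ}
    (h : c ^ 2 + ‖β‖ ^ 2 = 1) : blockOneTwo c β ∈ closureStab S := by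
  obtain ⟨t, w, hw, hc, hs⟩ := exists_polar h
  have hww : w * (starRingEnd ℂ) w = 1 := mul_star_eq_one hw
  have hww' : (starRingEnd ℂ) w * w = 1 := star_mul_eq_one hw
  have hX := hS.rotGen_mem hS.single_mem_complexLie (i := 1) (j := 2) (by decide) (by decide)
    (by decide) w
  have := rotation_mem_closureStab hX (N := Matrix.diagonal ![0, 1, 1, 0]) ?_ ?_ t
  · convert this using 1
    rw [← hc, ← hs]
    generalize Real.cos t = x
    generalize Real.sin t = y
    ext i j
    fin_cases i <;> fin_cases j <;> simp [blockOneTwo, rotGen]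
  · ext i j
    fin_cases i <;> fin_cases j <;> simp [rotGen, Matrix.mul_apply, Fin.sum_univ_four, hww, hww']
  · ext i j
    fin_cases i <;> fin_cases j <;> simp [rotGen, Matrix.mul_apply, Fin.sum_univ_four]

theorem IsNormalizedGroup.real_blockTwoThree_mem (hS : IsNormalizedGroup u b S) {c : ℝ} {β : ℂ}
    (h : c ^ 2 + ‖β‖ ^ 2 = 1) : blockTwoThree c β ∈ closureStab S := by
  obtain ⟨t, w, hw, hc, hs⟩ := exists_polar h
  have hww : w * (starRingEnd ℂ) w = 1 := mul_star_eq_one hw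
  have hww' : (starRingEnd ℂ) w * w = 1 := star_mul_eq_one hw
  have hX := hS.rotGen_mem hS.single_mem_complexLie (i := 2) (j := 3) (by decide) (by decide)
    (by decide) w
  have := rotation_mem_closureStab hX (N := Matrix.diagonal ![0, 0, 1, 1]) ?_ ?_ t
  · convert this using 1
    rw [← hc, ← hs]
    generalize Real.cos t = x
    generalize Real.sin t = y
    ext i j
    fin_cases i <;> fin_cases j <;> simp [blockTwoThree, rotGen]
  · ext i j
    fin_cases i <;> fin_cases j <;> simp [rotGen, Matrix.mul_apply, Fin.sum_univ_four, hww, hww']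
  · ext i j
    fin_cases i <;> fin_cases j <;> simp [rotGen, Matrix.mul_apply, Fin.sum_univ_four]

theorem IsNormalizedGroup.boostM_mem (hS : IsNormalizedGroup u b S) {c : ℝ} {β : ℂ}
    (hc : 0 < c) (h : c ^ 2 - ‖β‖ ^ 2 = 1) : boostM c β ∈ closureStab S := by
  obtain ⟨t, w, hw, hc, hs⟩ := exists_hyperbolic_polar hc h
  have hww : w * (starRingEnd ℂ) w = 1 := mul_star_eq_one hw
  have hww' : (starRingEnd ℂ) w * w = 1 := star_mul_eq_one hw
  have hX := hS.boostGen_mem hS.single_mem_complexLie w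
  have := boost_mem_closureStab hX (N := Matrix.diagonal ![1, 1, 0, 0]) ?_ ?_ t
  · convert this using 1
    rw [← hc, ← hs]
    generalize Real.cosh t = x
    generalize Real.sinh t = y
    ext i j
    fin_cases i <;> fin_cases j <;> simp [boostM, boostGen]
  · ext i j
    fin_cases i <;> fin_cases j <;>
      simp [boostGen, Matrix.mul_apply, Fin.sum_univ_four, hww, hww']
  · ext i j
    fin_cases i <;> fin_cases j <;> simp [boostGen, Matrix.mul_apply, Fin.sum_univ_four]

/-- `phaseM t` is `exp(t * phaseGen)`, written as a real combination of constant matrices so that it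
can be differentiated termwise. -/
theorem IsNormalizedGroup.phaseM_mem (hS : IsNormalizedGroup u b S) (t : ℝ) :
    phaseM t ∈ closureStab S := by
  intro M hM
  have hX := hS.phaseGen_mem hS.single_mem_complexLie
  have hη : ∀ s : ℝ, phaseM s = Real.cos (3 * s) • Matrix.diagonal ![1, 0, 0, 0] +
      Real.sin (3 * s) • Matrix.diagonal ![Complex.I, 0, 0, 0] +
      Real.cos s • Matrix.diagonal ![0, 1, 1, 1] +
      Real.sin s • Matrix.diagonal ![0, -Complex.I, -Complex.I, -Complex.I] := by
    intro s
    rw [phaseM]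
    generalize Real.cos (3 * s) = x
    generalize Real.sin (3 * s) = y
    generalize Real.cos s = x'
    generalize Real.sin s = y'
    ext i j
    fin_cases i <;> fin_cases j <;> simp [sub_eq_add_neg]
  refine flow_mul_mem_zariskiClosure hX (η := phaseM) ?_ (fun t => ?_) (fun ℓ t => ?_) hM t
  · ext i j
    fin_cases i <;> fin_cases j <;> simp [phaseM]
  · have h3 : HasDerivAt (fun s : ℝ => 3 * s) 3 t := by
      simpa using (hasDerivAt_id t).const_mul 3
    have := hasWeakDerivAt_add (hasWeakDerivAt_add (hasWeakDerivAt_add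
      (hasWeakDerivAt_smul h3.cos (Matrix.diagonal ![(1 : ℂ), 0, 0, 0]))
      (hasWeakDerivAt_smul h3.sin (Matrix.diagonal ![Complex.I, 0, 0, 0])))
      (hasWeakDerivAt_smul (Real.hasDerivAt_cos t) (Matrix.diagonal ![(0 : ℂ), 1, 1, 1])))
      (hasWeakDerivAt_smul (Real.hasDerivAt_sin t)
        (Matrix.diagonal ![0, -Complex.I, -Complex.I, -Complex.I]))
    have e : phaseM = fun s => _ := funext hη
    rw [e]
    convert this using 1
    beta_reduce
    generalize Real.cos (3 * t) = x
    generalize Real.sin (3 * t) = y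
    generalize Real.cos t = x'
    generalize Real.sin t = y'
    rw [phaseGen, smul_mul_assoc]
    ext i j
    rw [Matrix.smul_apply, Matrix.diagonal_mul]
    fin_cases i <;> fin_cases j <;> simp <;> ring_nf <;> simp <;> ring
  · simp only [hη, map_add, map_smul, smul_eq_mul]
    fun_prop

end Normalized

end Bianchi
end

/-! ### Elimination: every special isometry is a product of flows. -/

noncomputable section
namespace Bianchi

section Elimination

variable {u : ℂ} {b : ℝ} {S : Set (Matrix (Fin 4) (Fin 4) ℂ)}

theorem exists_phase_decomposition (α : ℂ) : ∃ w : ℂ, ‖w‖ = 1 ∧ α = (‖α‖ : ℂ) * w := by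
  by_cases h : α = 0
  · exact ⟨1, by simp, by simp [h]⟩
  · have h' : (‖α‖ : ℂ) ≠ 0 := by simpa using h
    exact ⟨α / ‖α‖, by simp [h], by field_simp⟩

theorem blockOneTwo_mul (α β γ δ : ℂ) : blockOneTwo α β * blockOneTwo γ δ =
    blockOneTwo (α * γ - β * star δ) (α * δ + β * star γ) := by
  ext i j
  fin_cases i <;> fin_cases j <;>
    simp [blockOneTwo, Matrix.mul_apply, Fin.sum_univ_four] <;> ring

theorem blockTwoThree_mul (α β γ δ : ℂ) : blockTwoThree α β * blockTwoThree γ δ =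
    blockTwoThree (α * γ - β * star δ) (α * δ + β * star γ) := by
  ext i j
  fin_cases i <;> fin_cases j <;>
    simp [blockTwoThree, Matrix.mul_apply, Fin.sum_univ_four] <;> ring

/-- Write `α = |α| w` with `|w| = 1`. The two blocks with zero diagonal multiply to the block `(w,
0)`, and the block `(|α|, β w)` times it is the block `(α, β)`. -/
theorem IsNormalizedGroup.blockOneTwo_mem (hS : IsNormalizedGroup u b S) {α β : ℂ}
    (h : ‖α‖ ^ 2 + ‖β‖ ^ 2 = 1) : blockOneTwo α β ∈ closureStab S := by
  obtain ⟨w, hw, hα⟩ := exists_phase_decomposition α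
  have hww := mul_star_eq_one hw
  have h₁ := hS.real_blockOneTwo_mem (c := ‖α‖) (β := β * w) (by rwa [norm_mul, hw, mul_one])
  have h₂ := hS.real_blockOneTwo_mem (c := 0) (β := w) (by simp [hw])
  have h₃ := hS.real_blockOneTwo_mem (c := 0) (β := -1) (by simp)
  have := (closureStab S).mul_mem h₁ ((closureStab S).mul_mem h₂ h₃)
  rw [blockOneTwo_mul, blockOneTwo_mul] at this
  convert this using 2
  · simpa using hα
  · have e : star (((0 : ℝ) : ℂ) * ((0 : ℝ) : ℂ) - w * star (-1)) = star w := by simp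
    rw [e, Complex.ofReal_zero, star_zero]
    linear_combination -β * hww

theorem IsNormalizedGroup.blockTwoThree_mem (hS : IsNormalizedGroup u b S) {α β : ℂ}
    (h : ‖α‖ ^ 2 + ‖β‖ ^ 2 = 1) : blockTwoThree α β ∈ closureStab S := by
  obtain ⟨w, hw, hα⟩ := exists_phase_decomposition α
  have hww := mul_star_eq_one hw
  have h₁ := hS.real_blockTwoThree_mem (c := ‖α‖) (β := β * w) (by rwa [norm_mul, hw, mul_one])
  have h₂ := hS.real_blockTwoThree_mem (c := 0) (β := w) (by simp [hw])
  have h₃ := hS.real_blockTwoThree_mem (c := 0) (β := -1) (by simp)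
  have := (closureStab S).mul_mem h₁ ((closureStab S).mul_mem h₂ h₃)
  rw [blockTwoThree_mul, blockTwoThree_mul] at this
  convert this using 2
  · simpa using hα
  · have e : star (((0 : ℝ) : ℂ) * ((0 : ℝ) : ℂ) - w * star (-1)) = star w := by simp
    rw [e, Complex.ofReal_zero, star_zero]
    linear_combination -β * hww

/-- `M` belongs to the special unitary group of `formJ`. -/
def IsSpecialIsometry (M : Matrix (Fin 4) (Fin 4) ℂ) : Prop :=
  Mᴴ * formJ * M = formJ ∧ M.det = 1

theorem IsSpecialIsometry.mul {M N : Matrix (Fin 4) (Fin 4) ℂ} (hM : IsSpecialIsometry M)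
    (hN : IsSpecialIsometry N) : IsSpecialIsometry (M * N) := by
  refine ⟨?_, by rw [Matrix.det_mul, hM.2, hN.2, one_mul]⟩
  calc (M * N)ᴴ * formJ * (M * N) = Nᴴ * (Mᴴ * formJ * M) * N := by
        rw [Matrix.conjTranspose_mul]; simp only [mul_assoc]
    _ = formJ := by rw [hM.1, hN.1]

theorem IsSpecialIsometry.sum_eq {M : Matrix (Fin 4) (Fin 4) ℂ} (hM : IsSpecialIsometry M)
    (i j : Fin 4) : -(star (M 0 i) * M 0 j) + star (M 1 i) * M 1 j + star (M 2 i) * M 2 j +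
      star (M 3 i) * M 3 j = formJ i j := by
  rw [← hM.1, Matrix.mul_apply, Fin.sum_univ_four, formJ]
  simp [Matrix.mul_diagonal]

theorem star_mul_self_add {α β : ℂ} (h : ‖α‖ ^ 2 + ‖β‖ ^ 2 = 1) :
    star α * α + star β * β = 1 := by
  rw [Complex.star_def, ← Complex.normSq_eq_conj_mul_self,
    ← Complex.normSq_eq_conj_mul_self, Complex.normSq_eq_norm_sq, Complex.normSq_eq_norm_sq]
  exact_mod_cast h

theorem isSpecialIsometry_blockOneTwo {α β : ℂ} (h : ‖α‖ ^ 2 + ‖β‖ ^ 2 = 1) :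
    IsSpecialIsometry (blockOneTwo α β) := by
  have h' : (starRingEnd ℂ) α * α + (starRingEnd ℂ) β * β = 1 := star_mul_self_add h
  constructor
  · ext i j
    rw [formJ, Matrix.mul_apply, Fin.sum_univ_four]
    simp only [Matrix.mul_diagonal]
    fin_cases i <;> fin_cases j <;> simp [blockOneTwo] <;>
      first | ring1 | linear_combination h'
  · simp [blockOneTwo, Matrix.det_succ_row_zero, Fin.sum_univ_succ, Fin.succAbove]
    linear_combination h'

theorem isSpecialIsometry_blockTwoThree {α β : ℂ} (h : ‖α‖ ^ 2 + ‖β‖ ^ 2 = 1) :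
    IsSpecialIsometry (blockTwoThree α β) := by
  have h' : (starRingEnd ℂ) α * α + (starRingEnd ℂ) β * β = 1 := star_mul_self_add h
  constructor
  · ext i j
    rw [formJ, Matrix.mul_apply, Fin.sum_univ_four]
    simp only [Matrix.mul_diagonal]
    fin_cases i <;> fin_cases j <;> simp [blockTwoThree] <;>
      first | ring1 | linear_combination h'
  · simp [blockTwoThree, Matrix.det_succ_row_zero, Fin.sum_univ_succ, Fin.succAbove]
    linear_combination h'

theorem isSpecialIsometry_boostM {c : ℝ} {β : ℂ} (h : c ^ 2 - ‖β‖ ^ 2 = 1) :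
    IsSpecialIsometry (boostM c β) := by
  have h' : (c : ℂ) * c - (starRingEnd ℂ) β * β = 1 := by
    rw [← Complex.normSq_eq_conj_mul_self, Complex.normSq_eq_norm_sq, ← sq]
    exact_mod_cast h
  constructor
  · ext i j
    rw [formJ, Matrix.mul_apply, Fin.sum_univ_four]
    simp only [Matrix.mul_diagonal]
    fin_cases i <;> fin_cases j <;> simp [boostM] <;>
      first | ring1 | linear_combination h' | linear_combination -h'
  · simp [boostM, Matrix.det_succ_row_zero, Fin.sum_univ_succ, Fin.succAbove]
    linear_combination h'

theorem isSpecialIsometry_phaseM (t : ℝ) : IsSpecialIsometry (phaseM t) := by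
  have h₁ : (Real.cos t : ℂ) ^ 2 + (Real.sin t : ℂ) ^ 2 = 1 := by
    exact_mod_cast Real.cos_sq_add_sin_sq t
  have h₂ : (Real.cos (3 * t) : ℂ) ^ 2 + (Real.sin (3 * t) : ℂ) ^ 2 = 1 := by
    exact_mod_cast Real.cos_sq_add_sin_sq (3 * t)
  have h₃ : (Real.cos (3 * t) : ℂ) + Real.sin (3 * t) * Complex.I =
      (Real.cos t + Real.sin t * Complex.I) ^ 3 := by
    rw [Complex.ofReal_cos, Complex.ofReal_sin, Complex.ofReal_cos, Complex.ofReal_sin,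
      Complex.cos_add_sin_mul_I_pow]
    push_cast
    rfl
  constructor
  · have e₁ : star ((Real.cos (3 * t) : ℂ) + Real.sin (3 * t) * Complex.I) *
        ((Real.cos (3 * t) : ℂ) + Real.sin (3 * t) * Complex.I) = 1 := by
      simp only [star_add, star_mul, Complex.star_def, Complex.conj_ofReal, Complex.conj_I]
      linear_combination h₂ - (Real.sin (3 * t) : ℂ) ^ 2 * Complex.I_sq
    have e₂ : star ((Real.cos t : ℂ) - Real.sin t * Complex.I) *
        ((Real.cos t : ℂ) - Real.sin t * Complex.I) = 1 := by
      simp only [star_sub, star_mul, Complex.star_def, Complex.conj_ofReal, Complex.conj_I]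
      linear_combination h₁ - (Real.sin t : ℂ) ^ 2 * Complex.I_sq
    rw [phaseM]
    generalize (Real.cos (3 * t) : ℂ) + Real.sin (3 * t) * Complex.I = x at *
    generalize (Real.cos t : ℂ) - Real.sin t * Complex.I = y at *
    rw [formJ, Matrix.diagonal_conjTranspose, Matrix.diagonal_mul_diagonal,
      Matrix.diagonal_mul_diagonal]
    congr 1
    funext i
    rw [Complex.star_def] at e₁ e₂
    fin_cases i <;> simp <;> assumption
  · rw [phaseM, Matrix.det_diagonal, Fin.prod_univ_four, h₃]
    simp only [Matrix.cons_val]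
    have : ((Real.cos t : ℂ) + Real.sin t * Complex.I) *
        ((Real.cos t : ℂ) - Real.sin t * Complex.I) = 1 := by
      linear_combination h₁ - (Real.sin t : ℂ) ^ 2 * Complex.I_sq
    generalize (Real.cos t : ℂ) + Real.sin t * Complex.I = x at *
    generalize (Real.cos t : ℂ) - Real.sin t * Complex.I = y at *
    linear_combination (x ^ 2 * y ^ 2 + x * y + 1) * this

theorem exists_block_coeffs (x y : ℂ) : ∃ (α β : ℂ) (n : ℝ), 0 ≤ n ∧ ‖α‖ ^ 2 + ‖β‖ ^ 2 = 1 ∧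
    α * x + β * y = n ∧ -star β * x + star α * y = 0 := by
  by_cases h : x = 0 ∧ y = 0
  · obtain ⟨rfl, rfl⟩ := h
    exact ⟨1, 0, 0, le_rfl, by simp, by simp, by simp⟩
  · have hpos : 0 < ‖x‖ ^ 2 + ‖y‖ ^ 2 := by
      rcases not_and_or.1 h with h | h
      · have := norm_pos_iff.2 h; positivity
      · have := norm_pos_iff.2 h; positivity
    set n := Real.sqrt (‖x‖ ^ 2 + ‖y‖ ^ 2) with hn
    have hn0 : 0 < n := Real.sqrt_pos.2 hpos
    have hn2 : n ^ 2 = ‖x‖ ^ 2 + ‖y‖ ^ 2 := Real.sq_sqrt hpos.le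
    have hn0' : (n : ℂ) ≠ 0 := by exact_mod_cast hn0.ne'
    have hn2' : (n : ℂ) ^ 2 = star x * x + star y * y := by
      rw [Complex.star_def, ← Complex.normSq_eq_conj_mul_self, ← Complex.normSq_eq_conj_mul_self,
        Complex.normSq_eq_norm_sq, Complex.normSq_eq_norm_sq]
      exact_mod_cast hn2
    refine ⟨star x / n, star y / n, n, hn0.le, ?_, ?_, ?_⟩
    · rw [norm_div, norm_div, norm_star, norm_star, Complex.norm_real, Real.norm_of_nonneg hn0.le]
      field_simp
      linarith
    · field_simp
      linear_combination -hn2'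
    · rw [star_div₀, star_div₀, star_star, star_star, Complex.star_def, Complex.conj_ofReal]
      field_simp
      ring

theorem mem_zariskiClosure_of_mul_mem {k k' M : Matrix (Fin 4) (Fin 4) ℂ}
    (hk' : k' ∈ closureStab S) (h : k' * k = 1) (hM : k * M ∈ zariskiClosure S) :
    M ∈ zariskiClosure S := by
  rw [← one_mul M, ← h, mul_assoc]
  exact hk' _ hM

/-- A Givens rotation on rows `2` and `3`. The last clause records that columns already cleared in
these rows stay cleared. -/
theorem IsNormalizedGroup.reduce_two_three (hS : IsNormalizedGroup u b S)
    {M : Matrix (Fin 4) (Fin 4) ℂ} (hM : IsSpecialIsometry M) (j : Fin 4) :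
    ∃ M', IsSpecialIsometry M' ∧ (M' ∈ zariskiClosure S → M ∈ zariskiClosure S) ∧
      M' 3 j = 0 ∧ (∃ n : ℝ, 0 ≤ n ∧ M' 2 j = n) ∧ (∀ l, M' 0 l = M 0 l) ∧
      (∀ l, M' 1 l = M 1 l) ∧ ∀ l, M 2 l = 0 → M 3 l = 0 → M' 2 l = 0 ∧ M' 3 l = 0 := by
  obtain ⟨α, β, n, hn, hαβ, h₁, h₂⟩ := exists_block_coeffs (M 2 j) (M 3 j)
  have e : ∀ i l, (blockTwoThree α β * M) i l = ![M 0 l, M 1 l, α * M 2 l + β * M 3 l,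
      -star β * M 2 l + star α * M 3 l] i := by
    intro i l
    fin_cases i <;> simp [blockTwoThree, Matrix.mul_apply, Fin.sum_univ_four]
  have hinv : blockTwoThree (star α) (-β) * blockTwoThree α β = 1 := by
    rw [blockTwoThree_mul, show star α * α - -β * star β = 1 by
      linear_combination star_mul_self_add hαβ, show star α * β + -β * star α = 0 by ring]
    ext i j
    fin_cases i <;> fin_cases j <;> simp [blockTwoThree]
  refine ⟨blockTwoThree α β * M, (isSpecialIsometry_blockTwoThree hαβ).mul hM,
    mem_zariskiClosure_of_mul_mem (hS.blockTwoThree_mem (by simpa using hαβ)) hinv, ?_,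
    ⟨n, hn, ?_⟩, fun l => ?_, fun l => ?_, fun l h h' => ⟨?_, ?_⟩⟩
  · rw [e]; exact h₂
  · rw [e]; exact h₁
  · rw [e]; rfl
  · rw [e]; rfl
  · rw [e]; simp [h, h']
  · rw [e]; simp [h, h']

theorem IsNormalizedGroup.reduce_one_two (hS : IsNormalizedGroup u b S)
    {M : Matrix (Fin 4) (Fin 4) ℂ} (hM : IsSpecialIsometry M) (j : Fin 4) :
    ∃ M', IsSpecialIsometry M' ∧ (M' ∈ zariskiClosure S → M ∈ zariskiClosure S) ∧
      M' 2 j = 0 ∧ (∃ n : ℝ, 0 ≤ n ∧ M' 1 j = n) ∧ (∀ l, M' 0 l = M 0 l) ∧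
      (∀ l, M' 3 l = M 3 l) ∧ ∀ l, M 1 l = 0 → M 2 l = 0 → M' 1 l = 0 ∧ M' 2 l = 0 := by
  obtain ⟨α, β, n, hn, hαβ, h₁, h₂⟩ := exists_block_coeffs (M 1 j) (M 2 j)
  have e : ∀ i l, (blockOneTwo α β * M) i l = ![M 0 l, α * M 1 l + β * M 2 l,
      -star β * M 1 l + star α * M 2 l, M 3 l] i := by
    intro i l
    fin_cases i <;> simp [blockOneTwo, Matrix.mul_apply, Fin.sum_univ_four]
  have hinv : blockOneTwo (star α) (-β) * blockOneTwo α β = 1 := by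
    rw [blockOneTwo_mul, show star α * α - -β * star β = 1 by
      linear_combination star_mul_self_add hαβ, show star α * β + -β * star α = 0 by ring]
    ext i j
    fin_cases i <;> fin_cases j <;> simp [blockOneTwo]
  refine ⟨blockOneTwo α β * M, (isSpecialIsometry_blockOneTwo hαβ).mul hM,
    mem_zariskiClosure_of_mul_mem (hS.blockOneTwo_mem (by simpa using hαβ)) hinv, ?_,
    ⟨n, hn, ?_⟩, fun l => ?_, fun l => ?_, fun l h h' => ⟨?_, ?_⟩⟩
  · rw [e]; exact h₂
  · rw [e]; exact h₁
  · rw [e]; rfl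
  · rw [e]; rfl
  · rw [e]; simp [h, h']
  · rw [e]; simp [h, h']

/-- The first column is `(M₀₀, M₁₀, 0, 0)` with `|M₀₀|² - |M₁₀|² = 1`, so the boost with `c = |M₀₀|`
and `β = -c M₁₀ / M₀₀` is an isometry that clears `M₁₀`. -/
theorem IsNormalizedGroup.reduce_boost (hS : IsNormalizedGroup u b S)
    {M : Matrix (Fin 4) (Fin 4) ℂ} (hM : IsSpecialIsometry M) (h2 : M 2 0 = 0) (h3 : M 3 0 = 0) :
    ∃ M', IsSpecialIsometry M' ∧ (M' ∈ zariskiClosure S → M ∈ zariskiClosure S) ∧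
      M' 1 0 = 0 ∧ M' 2 0 = 0 ∧ M' 3 0 = 0 := by
  have hJ := hM.sum_eq 0 0
  have hJ' : ‖M 0 0‖ ^ 2 - ‖M 1 0‖ ^ 2 = 1 := by
    rw [h2, h3, Complex.star_def, ← Complex.normSq_eq_conj_mul_self,
      ← Complex.normSq_eq_conj_mul_self, Complex.normSq_eq_norm_sq, Complex.normSq_eq_norm_sq,
      formJ] at hJ
    simp at hJ
    have : -‖M 0 0‖ ^ 2 + ‖M 1 0‖ ^ 2 = -1 := by exact_mod_cast hJ
    linarith
  have hpos : 0 < ‖M 0 0‖ := by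
    by_contra hcon
    have : ‖M 0 0‖ = 0 := le_antisymm (not_lt.1 hcon) (norm_nonneg _)
    rw [this] at hJ'
    nlinarith [sq_nonneg ‖M 1 0‖]
  have h0 : M 0 0 ≠ 0 := norm_pos_iff.1 hpos
  set c := ‖M 0 0‖ with hc
  set β := -((c : ℂ) * M 1 0 / M 0 0) with hβ
  have hβn : ‖β‖ = ‖M 1 0‖ := by
    rw [hβ, norm_neg, norm_div, norm_mul, Complex.norm_real, Real.norm_of_nonneg hpos.le, ← hc]
    field_simp
  have hcβ : c ^ 2 - ‖β‖ ^ 2 = 1 := by rw [hβn]; exact hJ'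
  have hinv : boostM c (-β) * boostM c β = 1 := by
    have h' : (c : ℂ) * c - (starRingEnd ℂ) β * β = 1 := by
      rw [← Complex.normSq_eq_conj_mul_self, Complex.normSq_eq_norm_sq, ← sq]
      exact_mod_cast hcβ
    generalize β = β at *
    ext i j
    fin_cases i <;> fin_cases j <;>
      simp [boostM, Matrix.mul_apply, Fin.sum_univ_four] <;>
      first | ring1 | linear_combination h'
  refine ⟨boostM c β * M, (isSpecialIsometry_boostM hcβ).mul hM,
    mem_zariskiClosure_of_mul_mem (hS.boostM_mem hpos (by simpa using hcβ)) hinv, ?_, ?_, ?_⟩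
  · have : (boostM c β * M) 1 0 = β * M 0 0 + c * M 1 0 := by
      simp [boostM, Matrix.mul_apply, Fin.sum_univ_four]
    rw [this, hβ]
    field_simp
    ring
  · simpa [boostM, Matrix.mul_apply, Fin.sum_univ_four] using h2
  · simpa [boostM, Matrix.mul_apply, Fin.sum_univ_four] using h3

theorem IsNormalizedGroup.reduce_phase (hS : IsNormalizedGroup u b S)
    {M : Matrix (Fin 4) (Fin 4) ℂ} (hM : IsSpecialIsometry M) (h1 : M 1 0 = 0) (h2 : M 2 0 = 0)
    (h3 : M 3 0 = 0) :
    ∃ M', IsSpecialIsometry M' ∧ (M' ∈ zariskiClosure S → M ∈ zariskiClosure S) ∧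
      M' 0 0 = 1 ∧ M' 1 0 = 0 ∧ M' 2 0 = 0 ∧ M' 3 0 = 0 := by
  have hJ := hM.sum_eq 0 0
  have hn : ‖M 0 0‖ = 1 := by
    rw [h1, h2, h3, Complex.star_def, ← Complex.normSq_eq_conj_mul_self,
      Complex.normSq_eq_norm_sq, show formJ 0 0 = -1 by simp [formJ]] at hJ
    have : ‖M 0 0‖ ^ 2 = 1 := by
      have : ((‖M 0 0‖ ^ 2 : ℝ) : ℂ) = 1 := by linear_combination -hJ
      exact_mod_cast this
    nlinarith [norm_nonneg (M 0 0)]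
  -- `phaseM t` multiplies coordinate `0` by `exp(3it)`, whence the division by `3`.
  set t : ℝ := -(Complex.arg (M 0 0)) / 3 with ht
  have e : ∀ s l, ∀ i, (phaseM s * M) i l = ![Real.cos (3 * s) + Real.sin (3 * s) * Complex.I,
    Real.cos s - Real.sin s * Complex.I, Real.cos s - Real.sin s * Complex.I,
    Real.cos s - Real.sin s * Complex.I] i * M i l := by
    intro s l i
    rw [phaseM, Matrix.diagonal_mul]
  have hinv : phaseM (-t) * phaseM t = 1 := by
    have h : ∀ x : ℝ, (Real.cos x : ℂ) ^ 2 + (Real.sin x : ℂ) ^ 2 = 1 := fun x => by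
      exact_mod_cast Real.cos_sq_add_sin_sq x
    rw [phaseM, phaseM, Matrix.diagonal_mul_diagonal, ← Matrix.diagonal_one]
    congr 1
    funext i
    simp only [mul_neg, Real.cos_neg, Real.sin_neg, Complex.ofReal_neg]
    fin_cases i
    · change (_ + -_ * _) * (_ + _ * _) = (1 : ℂ)
      linear_combination h (3 * t) - (Real.sin (3 * t) : ℂ) ^ 2 * Complex.I_sq
    all_goals
      change (_ - -_ * _) * (_ - _ * _) = (1 : ℂ)
      linear_combination h t - (Real.sin t : ℂ) ^ 2 * Complex.I_sq
  refine ⟨phaseM t * M, (isSpecialIsometry_phaseM t).mul hM,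
    mem_zariskiClosure_of_mul_mem (hS.phaseM_mem (-t)) hinv, ?_, ?_, ?_, ?_⟩
  · rw [e]
    have h3t : 3 * t = -(Complex.arg (M 0 0)) := by rw [ht]; ring
    have hM0 : M 0 0 = Real.cos (Complex.arg (M 0 0)) + Real.sin (Complex.arg (M 0 0)) * Complex.I := by
      have := Complex.norm_mul_cos_add_sin_mul_I (M 0 0)
      rw [hn] at this
      push_cast
      simpa using this.symm
    have hcs : (Real.cos (Complex.arg (M 0 0)) : ℂ) ^ 2 +
        (Real.sin (Complex.arg (M 0 0)) : ℂ) ^ 2 = 1 := by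
      exact_mod_cast Real.cos_sq_add_sin_sq _
    rw [h3t, Real.cos_neg, Real.sin_neg]
    simp only [Matrix.cons_val_zero]
    generalize Real.cos (Complex.arg (M 0 0)) = x at *
    generalize Real.sin (Complex.arg (M 0 0)) = y at *
    rw [hM0, Complex.ofReal_neg]
    linear_combination hcs - (y : ℂ) ^ 2 * Complex.I_sq
  · rw [e, h1, mul_zero]
  · rw [e, h2, mul_zero]
  · rw [e, h3, mul_zero]

theorem IsSpecialIsometry.row_eq_zero {M : Matrix (Fin 4) (Fin 4) ℂ} (hM : IsSpecialIsometry M)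
    {j l : Fin 4} (hcol : ∀ k, M k j = if k = j then 1 else 0) (hjl : j ≠ l) : M j l = 0 := by
  have h := hM.sum_eq j l
  rw [formJ, Matrix.diagonal_apply_ne _ hjl] at h
  simp only [hcol] at h
  fin_cases j <;> simpa using h

theorem eq_one_of_sq_eq_one {n : ℝ} {z : ℂ} (hn : 0 ≤ n) (hz : z = n) (h : star z * z = 1) :
    z = 1 := by
  rw [hz, Complex.star_def, Complex.conj_ofReal] at h
  have h' : n * n = 1 := by exact_mod_cast h
  have : n = 1 := by nlinarith
  rw [hz, this, Complex.ofReal_one]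

/-- Every special isometry of `formJ` lies in the Zariski closure of `S`. -/
theorem IsNormalizedGroup.mem_zariskiClosure (hS : IsNormalizedGroup u b S)
    {M : Matrix (Fin 4) (Fin 4) ℂ} (hM : IsSpecialIsometry M) : M ∈ zariskiClosure S := by
  have hJ : formJ 1 1 = 1 ∧ formJ 2 2 = 1 := by simp [formJ]
  -- Column `0` is brought to `e₀`, then columns `1` and `2` to `e₁` and `e₂`. Orthogonality of the
  -- columns clears the corresponding rows, and the last diagonal entry is fixed by the determinant.
  obtain ⟨M₁, hM₁, z₁, a₁, -⟩ := hS.reduce_two_three hM 0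
  obtain ⟨M₂, hM₂, z₂, a₂, -, -, b₂, -⟩ := hS.reduce_one_two hM₁ 0
  obtain ⟨M₃, hM₃, z₃, a₃, b₃, c₃⟩ := hS.reduce_boost hM₂ a₂ ((b₂ 0).trans a₁)
  obtain ⟨M₄, hM₄, z₄, a₄, b₄, c₄, d₄⟩ := hS.reduce_phase hM₃ a₃ b₃ c₃
  obtain ⟨M₅, hM₅, z₅, a₅, -, b₅, c₅, d₅⟩ := hS.reduce_two_three hM₄ 1
  obtain ⟨M₆, hM₆, z₆, a₆, ⟨n₆, hn₆, e₆⟩, b₆, c₆, d₆⟩ := hS.reduce_one_two hM₅ 1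
  obtain ⟨M₇, hM₇, z₇, a₇, ⟨n₇, hn₇, e₇⟩, b₇, c₇, d₇⟩ := hS.reduce_two_three hM₆ 2
  have col0 : ∀ k, M₆ k 0 = if k = 0 then 1 else 0 := by
    have h5 := d₅ 0 c₄ d₄
    have h6 := d₆ 0 ((c₅ 0).trans b₄) h5.1
    intro k
    fin_cases k
    · exact (b₆ 0).trans ((b₅ 0).trans a₄)
    · exact h6.1
    · exact h6.2
    · exact (c₆ 0).trans h5.2
  have col1 : ∀ k, M₆ k 1 = if k = 1 then 1 else 0 := by
    have h0 : M₆ 0 1 = 0 := hM₆.row_eq_zero col0 (by decide)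
    have h3 : M₆ 3 1 = 0 := (c₆ 1).trans a₅
    have h1 : M₆ 1 1 = 1 := by
      refine eq_one_of_sq_eq_one hn₆ e₆ ?_
      have := hM₆.sum_eq 1 1
      rw [h0, h3, a₆, hJ.1] at this
      linear_combination this
    intro k
    fin_cases k
    · exact h0
    · exact h1
    · exact a₆
    · exact h3
  have col0' : ∀ k, M₇ k 0 = if k = 0 then 1 else 0 := by
    have h := d₇ 0 (col0 2) (col0 3)
    intro k
    fin_cases k
    · exact (b₇ 0).trans (col0 0)
    · exact (c₇ 0).trans (col0 1)
    · exact h.1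
    · exact h.2
  have col1' : ∀ k, M₇ k 1 = if k = 1 then 1 else 0 := by
    have h := d₇ 1 (col1 2) (col1 3)
    intro k
    fin_cases k
    · exact (b₇ 1).trans (col1 0)
    · exact (c₇ 1).trans (col1 1)
    · exact h.1
    · exact h.2
  have col2' : ∀ k, M₇ k 2 = if k = 2 then 1 else 0 := by
    have h0 : M₇ 0 2 = 0 := hM₇.row_eq_zero col0' (by decide)
    have h1 : M₇ 1 2 = 0 := hM₇.row_eq_zero col1' (by decide)
    have h2 : M₇ 2 2 = 1 := by
      refine eq_one_of_sq_eq_one hn₇ e₇ ?_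
      have := hM₇.sum_eq 2 2
      rw [h0, h1, a₇, hJ.2] at this
      linear_combination this
    intro k
    fin_cases k
    · exact h0
    · exact h1
    · exact h2
    · exact a₇
  have e : M₇ = Matrix.diagonal ![1, 1, 1, M₇ 3 3] := by
    ext i j
    fin_cases j
    · rw [show ((⟨0, by omega⟩ : Fin 4)) = 0 from rfl, col0']
      fin_cases i <;> simp
    · rw [show ((⟨1, by omega⟩ : Fin 4)) = 1 from rfl, col1']
      fin_cases i <;> simp
    · rw [show ((⟨2, by omega⟩ : Fin 4)) = 2 from rfl, col2']
      fin_cases i <;> simp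
    · fin_cases i
      · exact hM₇.row_eq_zero col0' (by decide)
      · exact hM₇.row_eq_zero col1' (by decide)
      · exact hM₇.row_eq_zero col2' (by decide)
      · rfl
  have hdet := hM₇.2
  rw [e, Matrix.det_diagonal, Fin.prod_univ_four] at hdet
  simp only [Matrix.cons_val, one_mul] at hdet
  have e' : M₇ = 1 := by
    rw [e, hdet, ← Matrix.diagonal_one]
    congr 1
    funext i
    fin_cases i <;> simp
  refine z₁ (z₂ (z₃ (z₄ (z₅ (z₆ (z₇ ?_))))))
  rw [e']
  exact subset_zariskiClosure S hS.one_mem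

end Elimination

end Bianchi
end

noncomputable section
namespace Bianchi

/-! ### Zariski density -/

/-- The real and imaginary parts of the entries of a matrix. -/
def matCoords (M : Matrix (Fin 4) (Fin 4) ℂ) : (Fin 4 × Fin 4) ⊕ (Fin 4 × Fin 4) → ℝ :=
  Sum.elim (fun p => (M p.1 p.2).re) (fun p => (M p.1 p.2).im)

theorem eval_matCoords_mem_polyFun
    (p : MvPolynomial ((Fin 4 × Fin 4) ⊕ (Fin 4 × Fin 4)) ℝ) :
    (fun M => MvPolynomial.eval (matCoords M) p) ∈ polyFun (Matrix (Fin 4) (Fin 4) ℂ) := by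
  induction p using MvPolynomial.induction_on with
  | C a =>
    simp only [MvPolynomial.eval_C]
    exact (polyFun _).algebraMap_mem a
  | add p q hp hq =>
    simp only [MvPolynomial.eval_add]
    exact add_mem hp hq
  | mul_X p i hp =>
    simp only [MvPolynomial.eval_mul, MvPolynomial.eval_X]
    refine mul_mem hp ?_
    rcases i with i | i
    · exact linear_mem_polyFun
        (Complex.reLm ∘ₗ (Matrix.entryLinearMap ℂ ℂ i.1 i.2).restrictScalars ℝ)
    · exact linear_mem_polyFun
        (Complex.imLm ∘ₗ (Matrix.entryLinearMap ℂ ℂ i.1 i.2).restrictScalars ℝ)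

/-- A matrix invariant under the generators is a multiple of `formJ`. -/
theorem eq_smul_formJ {F : Matrix (Fin 4) (Fin 4) ℂ} {a b : ℝ} (ha : a ≠ 0) (hb : b ≠ 0)
    (hdiag : ∀ i j, i ≠ j → F i j = 0) (hL : eigLᴴ * F * eigL = F)
    (hA : (stdA a b)ᴴ * F * stdA a b = F) : F = F 1 1 • formJ := by
  have ha' : (a : ℂ) ≠ 0 := by exact_mod_cast ha
  have hb' : (b : ℂ) ≠ 0 := by exact_mod_cast hb
  have hF : F = Matrix.diagonal fun i => F i i := by
    ext i j
    rcases eq_or_ne i j with rfl | h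
    · simp
    · rw [Matrix.diagonal_apply_ne _ h, hdiag i j h]
  generalize hf : (fun i => F i i) = f at hF
  subst hF
  have h22 := congrFun (congrFun hL 2) 2
  have h33 := congrFun (congrFun hL 3) 3
  have h01 := congrFun (congrFun hA 0) 1
  rw [Matrix.mul_apply] at h22 h33 h01
  simp only [Matrix.mul_diagonal, Fin.sum_univ_four, Matrix.conjTranspose_apply] at h22 h33 h01
  simp [eigL] at h22 h33
  simp [stdA] at h01
  -- The entries of column `1` of `A` below row `0` sum to `-a`, so with `f 1 = f 2 = f 3` the `(0,
  -- 1)` entry of the invariance reads `ab (f 0 + f 1) = 0`.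
  have h0 : f 0 = -f 1 := by
    rw [← h33, ← h22] at h01
    have : (a * b : ℂ) * (f 0 + f 1) = 0 := by linear_combination h01
    have := (mul_eq_zero.1 this).resolve_left (mul_ne_zero ha' hb')
    linear_combination this
  rw [formJ, ← Matrix.diagonal_smul]
  congr 1
  funext i
  fin_cases i <;> simp [h0, ← h22, ← h33]

/-- The invariant form is unique up to a factor, so whatever `H` is, conjugation by `q` carries `SU
H` to the special isometries of `formJ` and the image of `ρ` to a normalized group. -/
theorem isZariskiDenseIn {u : ℂ} (hu : ‖u‖ = 1) (h4 : 1 / 4 < u.re) (hlt : u.re < 1)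
    {ρ : Bi3 →* SL(4, ℂ)} (hρ : IsRho u ρ) {H : Matrix (Fin 4) (Fin 4) ℂ}
    (hH : PreservesForm ρ H) (hs : HasSignature H 3 1) :
    IsZariskiDenseIn (Set.range ρ) (SU H) := by
  have h0 := ne_zero_of_norm_eq_one hu
  have h1 : u ≠ -1 := by
    rintro rfl
    norm_num at h4
  have h1' : u ≠ 1 := by
    rintro rfl
    norm_num at hlt
  have ha1 := one_lt_eigParam hu h1' h4
  set a := eigParam u with ha
  have hpos : 0 < (a ^ 2 - 1) / 3 := by nlinarith
  set b := Real.sqrt ((a ^ 2 - 1) / 3) with hb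
  have hb0 : 0 < b := Real.sqrt_pos.2 hpos
  have hbsq : b ^ 2 = (a ^ 2 - 1) / 3 := Real.sq_sqrt hpos.le
  have hb0' : (b : ℂ) ≠ 0 := by exact_mod_cast hb0.ne'
  -- Since `(1 - a²)/3 = -b²`, rescaling the first eigenvector by `b⁻¹` turns the diagonal invariant
  -- form into `formJ`.
  set D : Matrix (Fin 4) (Fin 4) ℂ := Matrix.diagonal ![(b : ℂ)⁻¹, 1, 1, 1] with hD
  have hdet : (eigQ u * D).det ≠ 0 := by
    rw [Matrix.det_mul, hD, Matrix.det_diagonal, Fin.prod_univ_four]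
    exact mul_ne_zero (det_eigQ_ne_zero h0 h1 h1') (by simpa using hb0')
  set Q := Matrix.GeneralLinearGroup.mkOfDetNeZero (eigQ u * D) hdet with hQ
  obtain ⟨q, hq⟩ : ∃ q : Matrix (Fin 4) (Fin 4) ℂ, q = eigQ u * D := ⟨_, rfl⟩
  obtain ⟨q', hqq', hq'q⟩ : ∃ q', q * q' = 1 ∧ q' * q = 1 := by
    refine ⟨((Q⁻¹ : GL (Fin 4) ℂ) : Matrix (Fin 4) (Fin 4) ℂ), ?_, ?_⟩
    · rw [hq, show eigQ u * D = (Q : Matrix (Fin 4) (Fin 4) ℂ) from rfl, ← Units.val_mul,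
        mul_inv_cancel, Units.val_one]
    · rw [hq, show eigQ u * D = (Q : Matrix (Fin 4) (Fin 4) ℂ) from rfl, ← Units.val_mul,
        inv_mul_cancel, Units.val_one]
  set S : Set (Matrix (Fin 4) (Fin 4) ℂ) :=
    {N | ∃ g, (ρ g : Matrix (Fin 4) (Fin 4) ℂ) * q = q * N} with hS
  have hmemS : ∀ {g : Bi3} {N N' : Matrix (Fin 4) (Fin 4) ℂ},
      (ρ g : Matrix (Fin 4) (Fin 4) ℂ) * eigQ u = eigQ u * N' → N' * D = D * N →
      (ρ g : Matrix (Fin 4) (Fin 4) ℂ) * q = q * N := by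
    intro g N N' e e'
    rw [hq, ← mul_assoc, e, mul_assoc, e', mul_assoc]
  have hcomm : ∀ d : Fin 4 → ℂ, Matrix.diagonal d * D = D * Matrix.diagonal d := by
    intro d
    rw [hD, Matrix.diagonal_mul_diagonal, Matrix.diagonal_mul_diagonal]
    simp only [mul_comm]
  have hT := hmemS (by rw [hρ.1]; exact rhoT_mul_eigQ h0 h1') (hcomm (eigT u))
  have hU := hmemS (by rw [hρ.2.1]; exact rhoU_mul_eigQ h0 h1 h1') (hcomm (eigU u))
  have hA := hmemS (g := genA) (N' := eigA a) (N := stdA a b)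
    (by rw [hρ.2.2.1, rhoA_mul_eigQ h0 h1', eigParam_eq hu h1'])
    (eigA_mul_scale hbsq hb0.ne')
  have hL := hmemS (g := genL) (N' := eigL) (N := eigL)
    (by rw [hρ.2.2.2]; exact rhoL_mul_eigQ h0 h1 h1') (by
      ext i j
      rw [hD, Matrix.mul_diagonal, Matrix.diagonal_mul]
      fin_cases i <;> fin_cases j <;> simp [eigL])
  obtain ⟨F, hF⟩ : ∃ F, F = qᴴ * H * q := ⟨_, rfl⟩
  have hinv : ∀ {M N : Matrix (Fin 4) (Fin 4) ℂ}, Mᴴ * H * M = H → M * q = q * N →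
      Nᴴ * F * N = F := by
    intro M N hM e
    rw [hF]
    exact conj_form_invariant e hM
  have hFJ : F = F 1 1 • formJ := by
    refine eq_smul_formJ (a := a) (b := b) (by linarith) hb0.ne' ?_ (hinv (hH.2 genL) hL)
      (hinv (hH.2 genA) hA)
    intro i j hij
    have e : F = Dᴴ * ((eigQ u)ᴴ * H * eigQ u) * D := by
      rw [hF, hq, Matrix.conjTranspose_mul]
      simp only [mul_assoc]
    rw [e, hD, Matrix.mul_diagonal, Matrix.diagonal_conjTranspose, Matrix.diagonal_mul,
      eigenbasis_orthogonal hu h1 h1' hρ hH hij, mul_zero, zero_mul]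
  have hc : F 1 1 ≠ 0 := by
    intro hc
    rw [hc, zero_smul] at hFJ
    have hH0 : H = 0 := by
      calc H = (q * q')ᴴ * H * (q * q') := by rw [hqq']; simp
        _ = q'ᴴ * (qᴴ * H * q) * q' := by
          rw [Matrix.conjTranspose_mul]; simp only [mul_assoc]
        _ = 0 := by rw [← hF, hFJ]; simp
    obtain ⟨-, P, hP⟩ := hs
    rw [hH0, mul_zero, zero_mul] at hP
    have := congrFun (congrFun hP 0) 0
    simp at this
  have hJ : ∀ {M N : Matrix (Fin 4) (Fin 4) ℂ}, Mᴴ * H * M = H → M * q = q * N →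
      Nᴴ * formJ * N = formJ := by
    intro M N hM e
    have := hinv hM e
    rw [hFJ, mul_smul_comm, smul_mul_assoc] at this
    exact smul_right_injective _ hc this
  have hN : IsNormalizedGroup u b S :=
    { norm_eq := hu
      lt_re := h4
      re_lt := hlt
      b_pos := hb0
      b_sq := hbsq
      one_mem := ⟨1, by simp⟩
      mul_mem := by
        rintro N ⟨g, hg⟩ N' ⟨g', hg'⟩
        refine ⟨g * g', ?_⟩
        rw [map_mul, Matrix.SpecialLinearGroup.coe_mul, mul_assoc, hg', ← mul_assoc, hg, mul_assoc]
      exists_inv := by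
        rintro N ⟨g, hg⟩
        have e : (ρ g : Matrix (Fin 4) (Fin 4) ℂ) * (ρ g⁻¹ : Matrix (Fin 4) (Fin 4) ℂ) = 1 := by
          rw [← Matrix.SpecialLinearGroup.coe_mul, ← map_mul, mul_inv_cancel, map_one,
            Matrix.SpecialLinearGroup.coe_one]
        refine ⟨q' * (ρ g⁻¹ : Matrix (Fin 4) (Fin 4) ℂ) * q, ⟨g⁻¹, ?_⟩, ?_⟩
        · rw [← mul_assoc, ← mul_assoc, hqq', one_mul]
        · have hN' : N = q' * ρ g * q := by
            rw [mul_assoc, hg, ← mul_assoc, hq'q, one_mul]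
          calc N * (q' * (ρ g⁻¹ : Matrix (Fin 4) (Fin 4) ℂ) * q)
              = q' * ρ g * (q * q') * (ρ g⁻¹ : Matrix (Fin 4) (Fin 4) ℂ) * q := by
                rw [hN']; simp only [mul_assoc]
            _ = q' * ((ρ g : Matrix (Fin 4) (Fin 4) ℂ) * ρ g⁻¹) * q := by
                rw [hqq', mul_one]; simp only [mul_assoc]
            _ = 1 := by rw [e, mul_one, hq'q]
      T_mem := ⟨genT, hT⟩
      U_mem := ⟨genU, hU⟩
      A_mem := ⟨genA, hA⟩
      form := by
        rintro N ⟨g, hg⟩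
        exact hJ (hH.2 g) hg }
  refine ⟨?_, fun p hp g hg => ?_⟩
  · rintro _ ⟨g, rfl⟩
    exact hH.2 g
  · set N := q' * (g : Matrix (Fin 4) (Fin 4) ℂ) * q with hNdef
    have hgN : (g : Matrix (Fin 4) (Fin 4) ℂ) * q = q * N := by
      rw [hNdef, ← mul_assoc, ← mul_assoc, hqq', one_mul]
    have hspec : IsSpecialIsometry N := by
      refine ⟨hJ hg hgN, ?_⟩
      have e : q'.det * q.det = 1 := by rw [← Matrix.det_mul, hq'q, Matrix.det_one]
      rw [hNdef, Matrix.det_mul, Matrix.det_mul, g.2, mul_one, e]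
    have hback : ∀ {M N : Matrix (Fin 4) (Fin 4) ℂ}, M * q = q * N → q * N * q' = M := by
      intro M N e
      rw [← e, mul_assoc, hqq', mul_one]
    -- The polynomial is transported by the linear map `M ↦ q M q'`, so it remains a polynomial
    -- function and vanishes on the normalized group.
    have := hN.mem_zariskiClosure hspec (fun M => MvPolynomial.eval (matCoords (q * M * q')) p)
      (polyFun_comp (eval_matCoords_mem_polyFun p)
        (LinearMap.mulRight ℝ q' ∘ₗ LinearMap.mulLeft ℝ q)) ?_
    · rw [hback hgN] at this
      exact this
    · rintro M ⟨k, hk⟩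
      rw [hback hk]
      exact hp _ ⟨k, rfl⟩

end Bianchi
end

open Bianchi in
theorem mainTheorem4 :
    -- the matrices satisfy Swan's relations, and define a unique representation of `Bi(3)`
    (∀ u : ℂ, u ≠ 0 → u ≠ -1 →
      (∃ t v a l : SL(4, ℂ),
        (t : Matrix (Fin 4) (Fin 4) ℂ) = rhoT u ∧ (v : Matrix (Fin 4) (Fin 4) ℂ) = rhoU u ∧
        (a : Matrix (Fin 4) (Fin 4) ℂ) = rhoA u ∧ (l : Matrix (Fin 4) (Fin 4) ℂ) = rhoL u ∧
        SwanRelations t v a l) ∧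
      ∃! ρ : Bi3 →* SL(4, ℂ), IsRho u ρ) ∧
    -- `ρ_1` is the hyperbolic representation; non-conjugacy
    (∀ ρ : Bi3 →* SL(4, ℂ), IsRho 1 ρ → IsConjugateToHyp ρ) ∧
    (∀ u u' : ℂ, u ≠ 0 → u ≠ -1 → u' ≠ 0 → u' ≠ -1 → u' ≠ u → u' ≠ 1 / u →
      ∀ ρ ρ' : Bi3 →* SL(4, ℂ), IsRho u ρ → IsRho u' ρ' → ¬ AreConjugate ρ ρ') ∧
    -- the invariant Hermitian form and its signature
    (∀ u : ℂ, ‖u‖ = 1 → u ≠ -1 → ∀ ρ : Bi3 →* SL(4, ℂ), IsRho u ρ →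
      ∃ H : Matrix (Fin 4) (Fin 4) ℂ, H ≠ 0 ∧ PreservesForm ρ H ∧
        (1 / 4 < u.re → HasSignature H 3 1) ∧ (u.re < 1 / 4 → HasSignature H 4 0)) ∧
    -- ellipticity of `ρ_u(T)` and `ρ_u(U)`; `ρ_u` is not both discrete and faithful
    (∀ u : ℂ, ‖u‖ = 1 → u ≠ 1 → u ≠ -1 → ∀ ρ : Bi3 →* SL(4, ℂ), IsRho u ρ →
      IsElliptic (ρ genT) ∧ IsElliptic (ρ genU) ∧
      (∀ H : Matrix (Fin 4) (Fin 4) ℂ, PreservesForm ρ H → HasSignature H 3 1 →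
        FixesHyperbolicPoint H (ρ genT) ∧ FixesHyperbolicPoint H (ρ genU)) ∧
      ¬ (DiscreteTopology ρ.range ∧ Function.Injective ρ)) ∧
    -- Zariski density in `SU(3, 1)`
    (∀ u : ℂ, ‖u‖ = 1 → 1 / 4 < u.re → u.re < 1 → ∀ ρ : Bi3 →* SL(4, ℂ), IsRho u ρ →
      ∀ H : Matrix (Fin 4) (Fin 4) ℂ, PreservesForm ρ H → HasSignature H 3 1 →
        IsZariskiDenseIn (Set.range ρ) (SU H)) := by
  refine ⟨fun u h0 h1 => ⟨exists_swan h0 h1, existsUnique_rho h0 h1⟩,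
    fun ρ hρ => isConjugateToHyp hρ,
    fun u u' h0 _ h0' _ hne hne' ρ ρ' hρ hρ' => not_areConjugate h0 h0' hne hne' hρ hρ',
    fun u hu h1 ρ hρ => exists_form hu h1 hρ, fun u hu h1' h1 ρ hρ => ⟨?_, ?_,
      fun H hH hs => fixesHyperbolicPoint hu h1 h1' hρ hH hs,
      not_discrete_and_injective hu h1 h1' hρ⟩, ?_⟩
  · have h0 := ne_zero_of_norm_eq_one hu
    exact isElliptic_of_diagonal (eigGL h0 h1 h1') (norm_eigT hu)
      (by rw [hρ.1]; exact rhoT_mul_eigQ h0 h1')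
  · have h0 := ne_zero_of_norm_eq_one hu
    exact isElliptic_of_diagonal (eigGL h0 h1 h1') (norm_eigU hu)
      (by rw [hρ.2.1]; exact rhoU_mul_eigQ h0 h1 h1')
  · exact fun u hu h4 hlt ρ hρ H hH hs => isZariskiDenseIn hu h4 hlt hρ hH hs
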